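/- Let $U\subseteq\mathbb R^2$ be a non-empty open set with coordinates $(t^1,t^2)$ and consider on $U\times\mathbb R^2$, with further coordinates $(z^1,z^2)$, a smooth metric $$ \mathbf g=\tilde g_{ij}\,dt^i\,dt^j+h_{kl}\,(dz^k+f^k_i\,dt^i)(dz^l+f^l_j\,dt^j), $$ where $\tilde g=(\tilde g_{ij})$ and $H=(h_{kl})$ are symmetric and non-degenerate and $\tilde g_{ij},f_i^k,h_{kl}$ are smooth functions of $(t^1,t^2)\in U$ only. Put $$ C_\rho=\frac{(\det H)_{,i}(\det H)_{,j}\,\tilde g^{ij}}{(\det H)^2},\qquad \mathcal C=\mathcal C^k\frac{\partial}{\partial z^k},\quad \mathcal C^k=\frac{\partial_{t^2}f^k_1-\partial_{t^1}f^k_2}{\sqrt{|\det\tilde g|}},\qquad \ell_{\mathcal C}=\mathbf g(\mathcal C,\mathcal C). $$ A change of adapted coordinates is a transformation $\bar t^{\,i}=\phi^i(t^1,t^2)$, $\bar z^{\,i}=\alpha^i_jz^j+\psi^i(t^1,t^2)$ with $\phi$ a diffeomorphism onto its image, $\psi^i$ smooth and $(\alpha^i_j)\in \mathrm{GL}(2,\mathbb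 R)$ constant. Suppose that $\mathrm{Ric}(\mathbf g)=\Lambda\,\mathbf g$ for a constant $\Lambda\in\mathbb R$, and that $C_\rho=0$, $\det\tilde g<0$ and $\det H>0$ everywhere. Then: 1. $\Lambda=0$. 2. $\mathcal C=0$, hence $\ell_{\mathcal C}=0$, and $\mathbf g$ is orthogonally transitive, i.e. the distribution orthogonal to the leaves spanned by $\partial_{z^1},\partial_{z^2}$ is integrable (closed under Lie brackets). 3. In a neighbourhood of every point of $U$ there are new adapted coordinates (again denoted $t^1,t^2,z^1,z^2$) in which $$ \mathbf g=dt^1\,dt^2+\varepsilon\left(R^2\,(dz^1+W\,dz^2)^2+S^2\,(dz^2)^2\right), $$ where $\varepsilon=1$ if $H$ is positive definite and $\varepsilon=-1$ if $H$ is negative definite at that point, and $R,W,S$ are smooth functions of $t^1$ on an open interval with $RS\neq0$ and $$ (W')^2=-\frac{2S^2}{R^2}\left(\frac{R''}{R}+\frac{S''}{S}\right). $$ 4. $\mathbf g$ is locally a pp-wave: in the coordinates of 3, the vector field $\partial_{t^2}$ is a null Killing field with $\nabla\partial_{t^2}=0$. -/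

import Mathlib

open scoped ContDiff

noncomputable section

namespace G2

/-- Space-time coordinates `(t¹, t², z¹, z²)`: `Sum.inl 0, Sum.inl 1` are the indices of
`t¹, t²` and `Sum.inr 0, Sum.inr 1` those of `z¹, z²`. -/
abbrev Idx := Fin 2 ⊕ Fin 2

abbrev Coord := Idx → ℝ

/-- Coordinates `(t¹, t²)` on the orbit space. -/
abbrev Orbit := Fin 2 → ℝ

def tPart (x : Coord) : Orbit := fun i => x (Sum.inl i)

def zPart (x : Coord) : Fin 2 → ℝ := fun k => x (Sum.inr k)

/-- The set of all space-time points whose `t`-coordinates lie in `U`. -/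
def cyl (U : Set Orbit) : Set Coord := {x | tPart x ∈ U}

/-- The partial derivative `∂F/∂xᵃ` at `x`. -/
def pd {ι : Type} [Fintype ι] [DecidableEq ι] (a : ι) (F : (ι → ℝ) → ℝ) (x : ι → ℝ) : ℝ :=
  fderiv ℝ F x (Pi.single a 1)

/-! ### Metrics in coordinates: connection, curvature, special vector fields -/

/-- A covariant symmetric 2-tensor field, given by its matrix of components `g_{ab}(x)`. -/
abbrev MetricField := Coord → Matrix Idx Idx ℝ

/-- The Christoffel symbols `Γᶜ_{ab}` of the Levi-Civita connection. -/
def christoffel (g : MetricField) (c a b : Idx) (x : Coord) : ℝ :=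
  (1 / 2) * ∑ d, (g x)⁻¹ c d *
    (pd a (fun y => g y d b) x + pd b (fun y => g y d a) x - pd d (fun y => g y a b) x)

/-- The Ricci tensor
`R_{ab} = ∂_c Γᶜ_{ab} - ∂_b Γᶜ_{ac} + Γᶜ_{cd} Γᵈ_{ab} - Γᶜ_{bd} Γᵈ_{ac}`. -/
def ricci (g : MetricField) (a b : Idx) (x : Coord) : ℝ :=
  ∑ c, (pd c (christoffel g c a b) x - pd b (christoffel g c a c) x)
    + ∑ c, ∑ d, (christoffel g c c d x * christoffel g d a b x
        - christoffel g c b d x * christoffel g d a c x)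

/-- The `Λ`-vacuum Einstein equations `R_{ab} = Λ g_{ab}` on `Ω`. -/
def IsLambdaVacuum (g : MetricField) (Λ : ℝ) (Ω : Set Coord) : Prop :=
  ∀ x ∈ Ω, ∀ a b, ricci g a b x = Λ * g x a b

/-- The scalar product `g(v, w)` of two tangent vectors at `x`. -/
def inner (g : MetricField) (x : Coord) (v w : Coord) : ℝ :=
  ∑ a, ∑ b, g x a b * v a * w b

/-- `N` is null: `g(N, N) = 0`. -/
def IsNullField (g : MetricField) (N : Coord → Coord) (Ω : Set Coord) : Prop :=
  ∀ x ∈ Ω, inner g x (N x) (N x) = 0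

/-- `N` is a Killing field: the Lie derivative
`(L_N g)_{ab} = Nᶜ ∂_c g_{ab} + g_{cb} ∂_a Nᶜ + g_{ac} ∂_b Nᶜ` vanishes. -/
def IsKillingField (g : MetricField) (N : Coord → Coord) (Ω : Set Coord) : Prop :=
  ∀ x ∈ Ω, ∀ a b,
    ∑ c, (N x c * pd c (fun y => g y a b) x
      + g x c b * pd a (fun y => N y c) x + g x a c * pd b (fun y => N y c) x) = 0

/-- `N` is covariantly constant: `∇_a Nᶜ = ∂_a Nᶜ + Γᶜ_{ab} Nᵇ = 0`. -/
def IsParallelField (g : MetricField) (N : Coord → Coord) (Ω : Set Coord) : Prop :=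
  ∀ x ∈ Ω, ∀ a c,
    pd a (fun y => N y c) x + ∑ b, christoffel g c a b x * N x b = 0

/-- The distribution `Ξ^⊥` orthogonal to the Killing leaves, which are spanned by
`∂/∂z¹, ∂/∂z²`, is integrable: it is closed under Lie brackets. -/
def IsOrthogonallyTransitive (g : MetricField) (Ω : Set Coord) : Prop :=
  ∀ O : Set Coord, IsOpen O → O ⊆ Ω → ∀ X Y : Coord → Coord,
    ContDiffOn ℝ ∞ X O → ContDiffOn ℝ ∞ Y O →
    (∀ x ∈ O, ∀ k : Fin 2, inner g x (X x) (Pi.single (Sum.inr k) 1) = 0) →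
    (∀ x ∈ O, ∀ k : Fin 2, inner g x (Y x) (Pi.single (Sum.inr k) 1) = 0) →
    ∀ x ∈ O, ∀ k : Fin 2,
      inner g x (VectorField.lieBracket ℝ X Y x) (Pi.single (Sum.inr k) 1) = 0

/-! ### Metrics with two commuting Killing fields in adapted coordinates -/

/-- The coefficients of a smooth semi-Riemannian metric
`g̃_{ij} dtⁱ dtʲ + h_{kl} (dzᵏ + f_iᵏ dtⁱ)(dzˡ + f_jˡ dtʲ)`
over the open set `U` of the `t`-plane; `f t i k` is `f_iᵏ(t)`. Both `g̃` (the orbit metric)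
and `h` (the metric of the Killing leaves) are symmetric and non-degenerate. -/
structure Coeffs (U : Set Orbit) where
  gt : Orbit → Matrix (Fin 2) (Fin 2) ℝ
  f : Orbit → Matrix (Fin 2) (Fin 2) ℝ
  h : Orbit → Matrix (Fin 2) (Fin 2) ℝ
  gt_smooth : ∀ i j, ContDiffOn ℝ ∞ (fun t => gt t i j) U
  f_smooth : ∀ i k, ContDiffOn ℝ ∞ (fun t => f t i k) U
  h_smooth : ∀ k l, ContDiffOn ℝ ∞ (fun t => h t k l) U
  gt_symm : ∀ t ∈ U, (gt t).IsSymm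
  h_symm : ∀ t ∈ U, (h t).IsSymm
  gt_det : ∀ t ∈ U, (gt t).det ≠ 0
  h_det : ∀ t ∈ U, (h t).det ≠ 0

namespace Coeffs

variable {U : Set Orbit}

/-- The components of the 1-form `dzᵏ + f_iᵏ dtⁱ`. -/
def vertForm (G : Coeffs U) (t : Orbit) (k : Fin 2) : Idx → ℝ :=
  Sum.elim (fun i => G.f t i k) (Pi.single k 1)

/-- The metric `g̃_{ij} dtⁱ dtʲ + h_{kl} (dzᵏ + f_iᵏ dtⁱ)(dzˡ + f_jˡ dtʲ)`. -/
def metric (G : Coeffs U) : MetricField := fun x => Matrix.of fun a b =>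
  ∑ i, ∑ j, G.gt (tPart x) i j *
      (Pi.single (Sum.inl i) 1 : Idx → ℝ) a * (Pi.single (Sum.inl j) 1 : Idx → ℝ) b
    + ∑ k, ∑ l, G.h (tPart x) k l * G.vertForm (tPart x) k a * G.vertForm (tPart x) l b

/-- The scalar invariant `C_ρ = (det h)⁻² (det h)_{,i} (det h)_{,j} g̃^{ij}`. -/
def Crho (G : Coeffs U) (t : Orbit) : ℝ :=
  1 / (G.h t).det ^ 2 *
    ∑ i, ∑ j, pd i (fun s => (G.h s).det) t * pd j (fun s => (G.h s).det) t * (G.gt t)⁻¹ i j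

/-- The components `Cᵏ = (∂_{t²} f_1ᵏ - ∂_{t¹} f_2ᵏ) / √|det g̃|` of the curvature vector field
`Cᵏ ∂/∂zᵏ`. -/
def curv (G : Coeffs U) (t : Orbit) (k : Fin 2) : ℝ :=
  (pd 1 (fun s => G.f s 0 k) t - pd 0 (fun s => G.f s 1 k) t) / √|(G.gt t).det|

/-- The squared length `ℓ_C = h_{kl} Cᵏ Cˡ` of the curvature vector field. -/
def ellC (G : Coeffs U) (t : Orbit) : ℝ :=
  ∑ k, ∑ l, G.h t k l * G.curv t k * G.curv t l

end Coeffs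

/-! ### Changes of adapted coordinates -/

/-- The Jacobian matrix `∂Φᵐ/∂xᵃ` of a map. -/
def jac {ι : Type} [Fintype ι] [DecidableEq ι] (Φ : (ι → ℝ) → ι → ℝ) (x : ι → ℝ) :
    Matrix ι ι ℝ :=
  Matrix.of fun m a => pd a (fun y => Φ y m) x

/-- A change of adapted coordinates over `V`: `t̄ⁱ = φⁱ(t)`, `z̄ⁱ = αⁱ_j zʲ + ψⁱ(t)`, with `φ` a
diffeomorphism of `V` onto its image and `α` an invertible constant matrix. -/
structure AdaptedChange (V : Set Orbit) where
  φ : Orbit → Orbit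
  ψ : Orbit → Fin 2 → ℝ
  α : Matrix (Fin 2) (Fin 2) ℝ
  φ_smooth : ContDiffOn ℝ ∞ φ V
  ψ_smooth : ContDiffOn ℝ ∞ ψ V
  φ_inj : Set.InjOn φ V
  φ_jac : ∀ t ∈ V, (jac φ t).det ≠ 0
  α_det : α.det ≠ 0

/-- The coordinate transformation `(t, z) ↦ (φ(t), α z + ψ(t))`. -/
def AdaptedChange.toMap {V : Set Orbit} (A : AdaptedChange V) (x : Coord) : Coord :=
  Sum.elim (A.φ (tPart x)) (A.α.mulVec (zPart x) + A.ψ (tPart x))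

/-- The pull-back `(Φ^* ḡ)_{ab}(x) = ∂_aΦᵐ ∂_bΦⁿ ḡ_{mn}(Φ(x))`, i.e. the expression in the old
coordinates `x` of the metric that has components `ḡ` in the new coordinates `Φ(x)`. -/
def pullback (Φ : Coord → Coord) (g' : MetricField) : MetricField := fun x =>
  (jac Φ x).transpose * g' (Φ x) * jac Φ x

/-- The metric `dt¹ dt² + ε (R² (dz¹ + W dz²)² + S² (dz²)²)` with `R, W, S` functions of `t¹`;
`dt¹ dt²` is the symmetric product, so its components are `g₁₂ = g₂₁ = 1/2`. -/
def ppMetric (ε : ℝ) (R W S : ℝ → ℝ) : MetricField := fun x => Matrix.of fun a b =>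
  let t1 : ℝ := x (Sum.inl 0)
  let dt1 : Idx → ℝ := Pi.single (Sum.inl 0) 1
  let dt2 : Idx → ℝ := Pi.single (Sum.inl 1) 1
  let dz1 : Idx → ℝ := Pi.single (Sum.inr 0) 1
  let dz2 : Idx → ℝ := Pi.single (Sum.inr 1) 1
  (1 / 2) * (dt1 a * dt2 b + dt2 a * dt1 b)
    + ε * (R t1 ^ 2 * ((dz1 a + W t1 * dz2 a) * (dz1 b + W t1 * dz2 b))
      + S t1 ^ 2 * (dz2 a * dz2 b))

end G2

end

/-! Locally the orbit metric factors as g̃ = p q with null 1-forms p, q. Let e₁, e₂ be the dual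
frame and τ = det H. Then C_ρ = 4 e₁(τ) e₂(τ) / τ² (`Crho_eq`), so C_ρ = 0 says that at every point
one of the two null derivatives of τ vanishes.

Suppose e₂(τ) = 0 on an open set. Since g(e₂, e₂) = 0, the field equations give Ric(e₂, e₂) = 0, a
Raychaudhuri-type equation (`ricci_e₁_e₁`, up to exchanging the null directions) that reduces to
det(e₂(H)) = 0. On the other hand e₂(τ) = 0 says that e₂(H) is trace-free with respect to H. As det
H > 0, H is definite, and both together force e₂(H) = 0 (`const_e₁_of_τ`, `const_e₂_of_τ`). The leaf
components of the field equations become Λ h_kl = -2 F_k F_l, where F is the lowered curvature of f.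
The right side has rank at most one and h is non-degenerate, so Λ = 0 and F = 0; then Ric(e₁, e₂) =
0 says that the orbit metric is flat (`flat_of_const_e₂`). Which null derivative vanishes may change
from point to point, so these conclusions are spread over U by a continuity argument (`isFlatAt`).

Flatness yields null coordinates with g̃ = du dv (`exists_flat_coords`), and closedness of f yields
ψ with dψ = f, so that z + ψ removes f. On a square of null coordinates ∂_u τ ∂_v τ = 0 forces ∂_u
∂_v τ = 0, and hence one of the factors vanishes on the whole square (`pd_eq_zero_of_mul`). If it is
∂_v τ, then H depends on u alone, completing the square gives R, W, S, and Ric(∂_u, ∂_u) = 0 is the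
differential equation for W (`ode_of_field_eq`). The lift of ∂_v is Killing with closed dual form
du/2, hence parallel.

The curvature is computed at one point t₀ at a time, in a frame with constant coefficients that is
null and orthogonal to the leaves at t₀. Constant frames commute, so the coordinate formula for
Ricci holds in them and transforms tensorially (`ricFrame_changeFrame`); at t₀ it is a polynomial in
the inverse metric and the derivatives of order one and two (`ricFrame_eq_jetRic`), of which only
the components `ric_zz`, `ric_00`, `ric_01` are needed. -/

noncomputable section

namespace G2

/-! ### Directional derivatives of functions on the orbit space -/

/-- The derivative of `F` in the constant direction `v`. -/
def ddir (v : Orbit) (F : Orbit → ℝ) (t : Orbit) : ℝ := fderiv ℝ F t v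

section ddir
variable {U : Set Orbit} {F K : Orbit → ℝ} {t v w : Orbit}

theorem differentiableAt_of_smoothOn (hU : IsOpen U) (hF : ContDiffOn ℝ ∞ F U) (ht : t ∈ U) :
    DifferentiableAt ℝ F t :=
  (hF.contDiffAt (hU.mem_nhds ht)).differentiableAt (by simp)

theorem smoothOn_ddir (hU : IsOpen U) (hF : ContDiffOn ℝ ∞ F U) (v : Orbit) :
    ContDiffOn ℝ ∞ (ddir v F) U :=
  (hF.fderiv_of_isOpen hU (m := ∞) (by simp)).clm_apply contDiffOn_const

theorem smoothOn_pd (hU : IsOpen U) (hF : ContDiffOn ℝ ∞ F U) (i : Fin 2) :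
    ContDiffOn ℝ ∞ (pd i F) U :=
  smoothOn_ddir hU hF (Pi.single i 1)

theorem ddir_congr (hU : IsOpen U) (h : ∀ s ∈ U, F s = K s) (ht : t ∈ U) :
    ddir v F t = ddir v K t := by
  unfold ddir
  rw [Filter.EventuallyEq.fderiv_eq (Filter.eventuallyEq_of_mem (hU.mem_nhds ht) h)]

theorem ddir_const (c : ℝ) : ddir v (fun _ => c) t = 0 := by simp [ddir]

theorem ddir_zero : ddir 0 F t = 0 := by simp [ddir]

theorem ddir_add (hF : DifferentiableAt ℝ F t) (hK : DifferentiableAt ℝ K t) :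
    ddir v (fun s => F s + K s) t = ddir v F t + ddir v K t := by
  simp [ddir, fderiv_fun_add hF hK]

theorem ddir_sub (hF : DifferentiableAt ℝ F t) (hK : DifferentiableAt ℝ K t) :
    ddir v (fun s => F s - K s) t = ddir v F t - ddir v K t := by
  simp [ddir, fderiv_fun_sub hF hK]

theorem ddir_neg : ddir v (fun s => - F s) t = - ddir v F t := by
  simp [ddir]

theorem ddir_mul (hF : DifferentiableAt ℝ F t) (hK : DifferentiableAt ℝ K t) :
    ddir v (fun s => F s * K s) t = ddir v F t * K t + F t * ddir v K t := by
  simp [ddir, fderiv_fun_mul hF hK]; ring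

theorem ddir_const_mul (hF : DifferentiableAt ℝ F t) (c : ℝ) :
    ddir v (fun s => c * F s) t = c * ddir v F t := by
  simp [ddir, fderiv_const_mul hF]

theorem ddir_sum {ι : Type*} (S : Finset ι) {Fs : ι → Orbit → ℝ}
    (h : ∀ i ∈ S, DifferentiableAt ℝ (Fs i) t) :
    ddir v (fun s => ∑ i ∈ S, Fs i s) t = ∑ i ∈ S, ddir v (Fs i) t := by
  simp [ddir, fderiv_fun_sum h]

theorem ddir_sum_smul {ι : Type*} (S : Finset ι) (c : ι → ℝ) (w : ι → Orbit) :
    ddir (∑ i ∈ S, c i • w i) F t = ∑ i ∈ S, c i * ddir (w i) F t := by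
  simp [ddir]

theorem ddir_eq_pd : ddir v F t = v 0 * pd 0 F t + v 1 * pd 1 F t := by
  have : v = v 0 • (Pi.single 0 1 : Orbit) + v 1 • (Pi.single 1 1 : Orbit) := by
    ext i; fin_cases i <;> simp
  conv_lhs => rw [this]
  simp [ddir, pd]

theorem ddir_comm (hU : IsOpen U) (hF : ContDiffOn ℝ ∞ F U) (ht : t ∈ U) :
    ddir v (ddir w F) t = ddir w (ddir v F) t := by
  have h1 : ContDiffAt ℝ ∞ F t := hF.contDiffAt (hU.mem_nhds ht)
  have h2 : DifferentiableAt ℝ (fderiv ℝ F) t :=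
    (h1.fderiv_right (m := 1) (by norm_cast)).differentiableAt (by simp)
  have hsym : IsSymmSndFDerivAt ℝ F t := h1.isSymmSndFDerivAt (by simp; norm_cast)
  have key : ∀ a b : Orbit, ddir a (ddir b F) t = fderiv ℝ (fderiv ℝ F) t a b := by
    intro a b
    change fderiv ℝ (fun s => fderiv ℝ F s b) t a = _
    rw [fderiv_clm_apply h2 (differentiableAt_const b)]
    simp
  rw [key, key]; exact hsym v w

end ddir

/-! ### The Ricci tensor of a metric depending on the orbit coordinates only -/

/-- Christoffel symbols, with respect to a constant frame whose projections to the orbit space are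
`w`, of a metric with components `Q` depending on the orbit coordinates only. -/
def chrFrame (w : Idx → Orbit) (Q : Orbit → Matrix Idx Idx ℝ) (c a b : Idx) (t : Orbit) : ℝ :=
  (1 / 2) * ∑ d, (Q t)⁻¹ c d *
    (ddir (w a) (fun s => Q s d b) t + ddir (w b) (fun s => Q s d a) t
      - ddir (w d) (fun s => Q s a b) t)

/-- The Ricci tensor with respect to a constant frame, see `chrFrame`. -/
def ricFrame (w : Idx → Orbit) (Q : Orbit → Matrix Idx Idx ℝ) (a b : Idx) (t : Orbit) : ℝ :=
  ∑ c, (ddir (w c) (chrFrame w Q c a b) t - ddir (w b) (chrFrame w Q c a c) t)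
    + ∑ c, ∑ d, (chrFrame w Q c c d t * chrFrame w Q d a b t
        - chrFrame w Q c b d t * chrFrame w Q d a c t)

/-- The projections to the orbit space of the coordinate frame. -/
def coordFrame : Idx → Orbit := Sum.elim (fun i => Pi.single i 1) (fun _ => 0)

/-- `tPart` as a continuous linear map. -/
def tPartL : Coord →L[ℝ] Orbit := ContinuousLinearMap.pi fun i => ContinuousLinearMap.proj (Sum.inl i)

theorem tPartL_apply (x : Coord) : tPartL x = tPart x := rfl

theorem tPart_single (a : Idx) : tPart (Pi.single a 1) = coordFrame a := by
  rcases a with i | k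
  · ext j; by_cases h : j = i
    · subst h; simp [tPart, coordFrame]
    · simp [tPart, coordFrame, h]
  · ext j; simp [tPart, coordFrame]

theorem isOpen_cyl {U : Set Orbit} (hU : IsOpen U) : IsOpen (cyl U) :=
  hU.preimage tPartL.continuous

/-- This moves the curvature computation from four dimensions to the orbit space: the frame vectors
along z project to 0, so derivatives along them drop out. -/
theorem pd_comp_tPart {F : Orbit → ℝ} {x : Coord} (hF : DifferentiableAt ℝ F (tPart x)) (a : Idx) :
    pd a (fun y => F (tPart y)) x = ddir (coordFrame a) F (tPart x) := by
  have h : HasFDerivAt (fun y => F (tPart y)) ((fderiv ℝ F (tPart x)).comp tPartL) x :=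
    HasFDerivAt.comp x (f := tPart) hF.hasFDerivAt tPartL.hasFDerivAt
  rw [pd, h.fderiv]
  simp [ddir, tPartL_apply, tPart_single]

theorem pd_congr {Ω : Set Coord} (hΩ : IsOpen Ω) {F K : Coord → ℝ} (h : ∀ y ∈ Ω, F y = K y)
    {x : Coord} (hx : x ∈ Ω) (a : Idx) : pd a F x = pd a K x := by
  unfold pd
  rw [Filter.EventuallyEq.fderiv_eq (Filter.eventuallyEq_of_mem (hΩ.mem_nhds hx) h)]

section
variable {U : Set Orbit} {Q : Orbit → Matrix Idx Idx ℝ}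

theorem smoothOn_det {n : Type*} [Fintype n] [DecidableEq n] {Q : Orbit → Matrix n n ℝ}
    (hQ : ∀ a b, ContDiffOn ℝ ∞ (fun t => Q t a b) U) :
    ContDiffOn ℝ ∞ (fun t => (Q t).det) U := by
  simp only [Matrix.det_apply']
  refine ContDiffOn.sum fun σ _ => ?_
  exact contDiffOn_const.mul (contDiffOn_prod fun i _ => hQ _ _)

theorem smoothOn_inv {n : Type*} [Fintype n] [DecidableEq n] {Q : Orbit → Matrix n n ℝ}
    (hQ : ∀ a b, ContDiffOn ℝ ∞ (fun t => Q t a b) U) (hdet : ∀ t ∈ U, (Q t).det ≠ 0) (a b : n) :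
    ContDiffOn ℝ ∞ (fun t => (Q t)⁻¹ a b) U := by
  have h1 : ContDiffOn ℝ ∞ (fun t => (Q t).det⁻¹ * (Q t).adjugate a b) U := by
    refine ((smoothOn_det hQ).inv hdet).mul ?_
    simp only [Matrix.adjugate_apply]
    refine smoothOn_det fun c d => ?_
    by_cases h : c = b
    · subst h; simpa using contDiffOn_const
    · simpa [Matrix.updateRow_ne h] using hQ c d
  refine h1.congr fun t _ => ?_
  simp [Matrix.inv_def]

theorem smoothOn_chrFrame (hU : IsOpen U) (hQ : ∀ a b, ContDiffOn ℝ ∞ (fun t => Q t a b) U)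
    (hdet : ∀ t ∈ U, (Q t).det ≠ 0) (w : Idx → Orbit) (c a b : Idx) :
    ContDiffOn ℝ ∞ (chrFrame w Q c a b) U := by
  unfold chrFrame
  refine contDiffOn_const.mul (ContDiffOn.sum fun d _ => ?_)
  exact (smoothOn_inv hQ hdet _ _).mul
    (((smoothOn_ddir hU (hQ _ _) _).add (smoothOn_ddir hU (hQ _ _) _)).sub
      (smoothOn_ddir hU (hQ _ _) _))

theorem christoffel_comp_tPart (hU : IsOpen U)
    (hQ : ∀ a b, ContDiffOn ℝ ∞ (fun t => Q t a b) U) {x : Coord} (hx : x ∈ cyl U) (c a b : Idx) :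
    christoffel (fun y => Q (tPart y)) c a b x = chrFrame coordFrame Q c a b (tPart x) := by
  have hd : ∀ a b, DifferentiableAt ℝ (fun s => Q s a b) (tPart x) := fun a b =>
    differentiableAt_of_smoothOn hU (hQ a b) hx
  simp only [christoffel, chrFrame]
  congr 1
  refine Finset.sum_congr rfl fun d _ => ?_
  rw [pd_comp_tPart (hd d b), pd_comp_tPart (hd d a), pd_comp_tPart (hd a b)]

theorem ricci_comp_tPart (hU : IsOpen U)
    (hQ : ∀ a b, ContDiffOn ℝ ∞ (fun t => Q t a b) U) (hdet : ∀ t ∈ U, (Q t).det ≠ 0)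
    {x : Coord} (hx : x ∈ cyl U) (a b : Idx) :
    ricci (fun y => Q (tPart y)) a b x = ricFrame coordFrame Q a b (tPart x) := by
  have key : ∀ e c a b, pd e (christoffel (fun y => Q (tPart y)) c a b) x
      = ddir (coordFrame e) (chrFrame coordFrame Q c a b) (tPart x) := by
    intro e c a b
    rw [pd_congr (isOpen_cyl hU) (fun y hy => christoffel_comp_tPart hU hQ hy c a b) hx,
      pd_comp_tPart (differentiableAt_of_smoothOn hU (smoothOn_chrFrame hU hQ hdet _ _ _ _) hx)]
  simp only [ricci, ricFrame, key, christoffel_comp_tPart hU hQ hx]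

end

/-! ### Change of the constant frame -/

section
variable {U : Set Orbit} {Q : Orbit → Matrix Idx Idx ℝ} {t : Orbit}

/-- The frame obtained from `w` by the constant matrix `L`. -/
def changeFrame (L : Matrix Idx Idx ℝ) (w : Idx → Orbit) (a : Idx) : Orbit := ∑ e, L e a • w e

/-- Twice the Christoffel symbols of the first kind. -/
def chrLower (w : Idx → Orbit) (Q : Orbit → Matrix Idx Idx ℝ) (a b d : Idx) (t : Orbit) : ℝ :=
  ddir (w a) (fun s => Q s d b) t + ddir (w b) (fun s => Q s d a) t
      - ddir (w d) (fun s => Q s a b) t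

theorem chrFrame_eq_mulVec (w : Idx → Orbit) (c a b : Idx) :
    chrFrame w Q c a b t = ((1 / 2 : ℝ) • ((Q t)⁻¹.mulVec fun d => chrLower w Q a b d t)) c := by
  simp [chrFrame, chrLower, Matrix.mulVec, dotProduct]

theorem ddir_conj (hQ : ∀ a b, DifferentiableAt ℝ (fun t => Q t a b) t) (L : Matrix Idx Idx ℝ)
    (v : Orbit) (a b : Idx) :
    ddir v (fun s => (L.transpose * Q s * L) a b) t
      = ∑ e, ∑ f, L e a * L f b * ddir v (fun s => Q s e f) t := by
  have h : (fun s => (L.transpose * Q s * L) a b)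
      = fun s => ∑ e, ∑ f, (L e a * L f b) * Q s e f := by
    ext s
    simp only [Matrix.mul_apply, Matrix.transpose_apply, Finset.sum_mul]
    rw [Finset.sum_comm]
    exact Finset.sum_congr rfl fun e _ => Finset.sum_congr rfl fun f _ => by ring
  rw [h, ddir_sum]
  · refine Finset.sum_congr rfl fun e _ => ?_
    rw [ddir_sum]
    · exact Finset.sum_congr rfl fun f _ => ddir_const_mul (hQ e f) _
    · exact fun f _ => (hQ e f).const_mul _
  · exact fun e _ => DifferentiableAt.fun_sum fun f _ => (hQ e f).const_mul _

theorem chrLower_changeFrame (hQ : ∀ a b, DifferentiableAt ℝ (fun t => Q t a b) t)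
    (L : Matrix Idx Idx ℝ) (w : Idx → Orbit) (a b d : Idx) :
    chrLower (changeFrame L w) (fun s => L.transpose * Q s * L) a b d t
      = ∑ e, ∑ f, ∑ m, L e a * L f b * L m d * chrLower w Q e f m t := by
  simp only [chrLower, ddir_conj hQ]
  simp only [changeFrame, ddir_sum_smul, Finset.mul_sum]
  have h1 : ∀ T : Idx → Idx → Idx → ℝ, ∑ m, ∑ f, ∑ e, T e f m = ∑ e, ∑ f, ∑ m, T e f m := by
    intro T
    rw [Finset.sum_comm, Finset.sum_congr rfl fun f _ => Finset.sum_comm, Finset.sum_comm]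
  have h2 : ∀ T : Idx → Idx → Idx → ℝ, ∑ m, ∑ e, ∑ f, T e f m = ∑ e, ∑ f, ∑ m, T e f m := by
    intro T
    rw [Finset.sum_comm, Finset.sum_congr rfl fun e _ => Finset.sum_comm]
  rw [h1 (fun e f m => L m d * L f b * (L e a * ddir (w e) (fun s => Q s m f) t)),
    h2 (fun e f m => L m d * L e a * (L f b * ddir (w f) (fun s => Q s m e) t))]
  simp only [← Finset.sum_add_distrib, ← Finset.sum_sub_distrib]
  refine Finset.sum_congr rfl fun e _ => Finset.sum_congr rfl fun f _ =>
    Finset.sum_congr rfl fun m _ => ?_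
  ring

/-- Because `L` is constant, the inhomogeneous term of the usual transformation law, which contains
derivatives of `L`, is absent, and Γ behaves like a tensor. -/
theorem chrFrame_changeFrame (hQ : ∀ a b, DifferentiableAt ℝ (fun t => Q t a b) t)
    {L : Matrix Idx Idx ℝ} (hL : L.det ≠ 0) (w : Idx → Orbit) (c a b : Idx) :
    chrFrame (changeFrame L w) (fun s => L.transpose * Q s * L) c a b t
      = ∑ k, L⁻¹ c k * ∑ e, ∑ f, L e a * L f b * chrFrame w Q k e f t := by
  have hlow : (fun d => chrLower (changeFrame L w) (fun s => L.transpose * Q s * L) a b d t)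
      = L.transpose.mulVec (∑ e, ∑ f, (L e a * L f b) • fun m => chrLower w Q e f m t) := by
    ext d
    rw [chrLower_changeFrame hQ]
    simp only [Finset.sum_apply, Pi.smul_apply,
      Matrix.mulVec, dotProduct, Matrix.transpose_apply, smul_eq_mul, Finset.mul_sum]
    symm
    rw [Finset.sum_comm]
    refine Finset.sum_congr rfl fun e _ => ?_
    rw [Finset.sum_comm]
    exact Finset.sum_congr rfl fun f _ => Finset.sum_congr rfl fun m _ => by ring
  have hLT : IsUnit L.transpose.det := by simpa using hL
  rw [chrFrame_eq_mulVec, hlow, Matrix.mulVec_mulVec, Matrix.mul_inv_rev, Matrix.mul_inv_rev,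
    Matrix.mul_assoc, Matrix.mul_assoc, Matrix.nonsing_inv_mul _ hLT, Matrix.mul_one,
    ← Matrix.mulVec_mulVec, ← Matrix.mulVec_smul, ← Matrix.mulVec_smul]
  have hmv : ∀ v, (L⁻¹.mulVec v) c = ∑ k, L⁻¹ c k * v k := fun v => rfl
  rw [hmv]
  refine Finset.sum_congr rfl fun k _ => ?_
  congr 1
  simp only [chrFrame_eq_mulVec, Matrix.mulVec_smul, Matrix.mulVec_sum, Finset.smul_sum,
    Finset.sum_apply, Pi.smul_apply, smul_eq_mul]
  exact Finset.sum_congr rfl fun e _ => Finset.sum_congr rfl fun f _ => by ring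

/-- Index form of L L⁻¹ = 1: contracting an upper with a lower index does not depend on the frame.
-/
theorem sum_mul_inv_contract {L : Matrix Idx Idx ℝ} (hL : L.det ≠ 0) (T : Idx → Idx → ℝ) :
    ∑ c, ∑ m, ∑ k, L m c * (L⁻¹ c k * T m k) = ∑ m, T m m := by
  have h1 : ∀ m k, ∑ c, L m c * L⁻¹ c k = (1 : Matrix Idx Idx ℝ) m k := fun m k => by
    rw [← Matrix.mul_apply, Matrix.mul_nonsing_inv _ (by simpa using hL)]
  rw [Finset.sum_comm]
  refine Finset.sum_congr rfl fun m _ => ?_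
  rw [Finset.sum_comm]
  have : ∀ k, ∑ c, L m c * (L⁻¹ c k * T m k) = (1 : Matrix Idx Idx ℝ) m k * T m k := fun k => by
    rw [← h1, Finset.sum_mul]
    exact Finset.sum_congr rfl fun c _ => by ring
  simp [this, Matrix.one_apply]

/-- This allows the field equations at a point to be read in a frame that brings the metric to
normal form at that point. -/
theorem ricFrame_changeFrame (hU : IsOpen U) (hQ : ∀ a b, ContDiffOn ℝ ∞ (fun t => Q t a b) U)
    (hdet : ∀ t ∈ U, (Q t).det ≠ 0) {L : Matrix Idx Idx ℝ} (hL : L.det ≠ 0) (w : Idx → Orbit)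
    (ht : t ∈ U) (a b : Idx) :
    ricFrame (changeFrame L w) (fun s => L.transpose * Q s * L) a b t
      = ∑ e, ∑ f, L e a * L f b * ricFrame w Q e f t := by
  set G : Idx → Idx → Idx → Orbit → ℝ := chrFrame w Q with hG
  set G' : Idx → Idx → Idx → Orbit → ℝ :=
    chrFrame (changeFrame L w) (fun s => L.transpose * Q s * L) with hG'
  have hGd : ∀ c a b, DifferentiableAt ℝ (G c a b) t := fun c a b =>
    differentiableAt_of_smoothOn hU (smoothOn_chrFrame hU hQ hdet w c a b) ht
  have hGG : ∀ c a b, ∀ s ∈ U, G' c a b s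
      = ∑ k, ∑ e, ∑ f, (L⁻¹ c k * (L e a * L f b)) * G k e f s := fun c a b s hs => by
    rw [hG', chrFrame_changeFrame (fun a b => differentiableAt_of_smoothOn hU (hQ a b) hs) hL]
    simp only [Finset.mul_sum]
    exact Finset.sum_congr rfl fun k _ => Finset.sum_congr rfl fun e _ =>
      Finset.sum_congr rfl fun f _ => by ring
  have hdG : ∀ d c a b, ddir (changeFrame L w d) (G' c a b) t
      = ∑ m, ∑ k, L m d * (L⁻¹ c k * ∑ e, ∑ f, L e a * L f b * ddir (w m) (G k e f) t) := by
    intro d c a b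
    rw [ddir_congr hU (hGG c a b) ht]
    simp only [changeFrame, ddir_sum_smul]
    refine Finset.sum_congr rfl fun m _ => ?_
    rw [ddir_sum, Finset.mul_sum]
    · refine Finset.sum_congr rfl fun k _ => ?_
      rw [ddir_sum]
      · simp only [Finset.mul_sum]
        refine Finset.sum_congr rfl fun e _ => ?_
        rw [ddir_sum, Finset.mul_sum]
        · refine Finset.sum_congr rfl fun f _ => ?_
          rw [ddir_const_mul (hGd k e f)]; ring
        · exact fun f _ => (hGd k e f).const_mul _
      · exact fun e _ => DifferentiableAt.fun_sum fun f _ => (hGd k e f).const_mul _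
    · exact fun k _ => DifferentiableAt.fun_sum fun e _ => DifferentiableAt.fun_sum fun f _ =>
        (hGd k e f).const_mul _
  have hG't : ∀ c a b, G' c a b t = ∑ k, L⁻¹ c k * ∑ e, ∑ f, L e a * L f b * G k e f t :=
    fun c a b => chrFrame_changeFrame
      (fun a b => differentiableAt_of_smoothOn hU (hQ a b) ht) hL w c a b
  have hLL : L * L⁻¹ = 1 := Matrix.mul_nonsing_inv _ (by simpa using hL)
  have htr : ∀ M : Matrix Idx Idx ℝ, (L⁻¹ * M * L).trace = M.trace := fun M => by
    rw [Matrix.trace_mul_comm, ← Matrix.mul_assoc, hLL, Matrix.one_mul]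
  have hsnd : ∀ b, (Matrix.of fun c d => G' c b d t)
      = L⁻¹ * (Matrix.of fun k f => ∑ e, L e b * G k e f t) * L := fun b => by
    ext c d
    simp only [Matrix.of_apply, hG't, Matrix.mul_apply, Finset.mul_sum, Finset.sum_mul]
    symm
    rw [Finset.sum_comm]
    refine Finset.sum_congr rfl fun k _ => ?_
    rw [Finset.sum_comm]
    exact Finset.sum_congr rfl fun e _ => Finset.sum_congr rfl fun f _ => by ring
  have hfst : ∀ d, (Matrix.of fun c a => G' c a d t)
      = L⁻¹ * (Matrix.of fun k e => ∑ f, L f d * G k e f t) * L := fun d => by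
    ext c a
    simp only [Matrix.of_apply, hG't, Matrix.mul_apply, Finset.mul_sum, Finset.sum_mul]
    rw [Finset.sum_comm]
    exact Finset.sum_congr rfl fun e _ => Finset.sum_congr rfl fun k _ =>
      Finset.sum_congr rfl fun f _ => by ring
  -- `T1` to `T4` treat the four sums of the Ricci formula separately. Each contains one or two
  -- contractions, which are frame independent either by `sum_mul_inv_contract` or as traces of
  -- matrices conjugated by `L`.
  have T1 : ∑ c, ddir (changeFrame L w c) (G' c a b) t
      = ∑ e, ∑ f, L e a * L f b * ∑ m, ddir (w m) (G m e f) t := by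
    simp only [hdG]
    rw [sum_mul_inv_contract hL fun m k => ∑ e, ∑ f, L e a * L f b * ddir (w m) (G k e f) t]
    simp only [Finset.mul_sum]
    rw [Finset.sum_comm]
    exact Finset.sum_congr rfl fun e _ => Finset.sum_comm
  have T2 : ∑ c, ddir (changeFrame L w b) (G' c a c) t
      = ∑ e, ∑ f, L e a * L f b * ∑ m, ddir (w f) (G m e m) t := by
    simp only [hdG]
    rw [Finset.sum_comm]
    have h1 : ∀ m, ∑ c, ∑ k, L m b * (L⁻¹ c k * ∑ e, ∑ f, L e a * L f c * ddir (w m) (G k e f) t)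
        = L m b * ∑ k, ∑ e, L e a * ddir (w m) (G k e k) t := fun m => by
      simp only [← Finset.mul_sum]
      congr 1
      have := htr (Matrix.of fun k f => ∑ e, L e a * ddir (w m) (G k e f) t)
      simp only [Matrix.trace, Matrix.diag, Matrix.of_apply, Matrix.mul_apply, Finset.sum_mul,
        Finset.mul_sum] at this
      rw [← this]
      refine Finset.sum_congr rfl fun c _ => ?_
      simp only [Finset.mul_sum]
      symm
      rw [Finset.sum_comm]
      refine Finset.sum_congr rfl fun k _ => ?_
      rw [Finset.sum_comm]
      exact Finset.sum_congr rfl fun e _ => Finset.sum_congr rfl fun f _ => by ring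
    simp only [h1]
    simp only [Finset.mul_sum]
    symm
    rw [Finset.sum_comm]
    refine Finset.sum_congr rfl fun m _ => ?_
    rw [Finset.sum_comm]
    exact Finset.sum_congr rfl fun k _ => Finset.sum_congr rfl fun e _ => by ring
  have T3 : ∑ c, ∑ d, G' c c d t * G' d a b t
      = ∑ e, ∑ f, L e a * L f b * ∑ c, ∑ d, G c c d t * G d e f t := by
    have h1 : ∀ d, ∑ c, G' c c d t = ∑ f, L f d * ∑ k, G k k f t := fun d => by
      have := htr (Matrix.of fun k e => ∑ f, L f d * G k e f t)
      rw [← hfst] at this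
      simp only [Matrix.trace, Matrix.diag, Matrix.of_apply] at this
      rw [this, Finset.sum_comm]
      simp only [Finset.mul_sum]
    rw [Finset.sum_comm]
    simp only [← Finset.sum_mul, h1]
    have h2 : ∀ d, (∑ f, L f d * ∑ k, G k k f t) * G' d a b t = ∑ f, ∑ m,
        L f d * (L⁻¹ d m * ((∑ k, G k k f t) * ∑ e, ∑ i, L e a * L i b * G m e i t)) := fun d => by
      rw [hG't, Finset.sum_mul_sum]
      exact Finset.sum_congr rfl fun f _ => Finset.sum_congr rfl fun m _ => by ring
    simp only [h2]
    rw [sum_mul_inv_contract hL fun f m =>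
      (∑ k, G k k f t) * ∑ e, ∑ i, L e a * L i b * G m e i t]
    simp only [Finset.mul_sum, Finset.sum_mul]
    rw [Finset.sum_comm]
    refine Finset.sum_congr rfl fun e _ => ?_
    rw [Finset.sum_comm]
    refine Finset.sum_congr rfl fun f _ => ?_
    rw [Finset.sum_comm]
    exact Finset.sum_congr rfl fun c _ => Finset.sum_congr rfl fun d _ => by ring
  have T4 : ∑ c, ∑ d, G' c b d t * G' d a c t
      = ∑ e, ∑ f, L e a * L f b * ∑ c, ∑ d, G c f d t * G d e c t := by
    have h1 : ∑ c, ∑ d, G' c b d t * G' d a c t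
        = ((Matrix.of fun c d => G' c b d t) * (Matrix.of fun c d => G' c a d t)).trace := by
      simp [Matrix.trace, Matrix.diag, Matrix.mul_apply]
    rw [h1, hsnd, hsnd]
    rw [show ∀ A B : Matrix Idx Idx ℝ, L⁻¹ * A * L * (L⁻¹ * B * L) = L⁻¹ * (A * (L * L⁻¹) * B) * L
      from fun A B => by simp only [Matrix.mul_assoc], hLL, Matrix.mul_one, htr]
    simp only [Matrix.trace, Matrix.diag, Matrix.mul_apply, Matrix.of_apply, Finset.mul_sum,
      Finset.sum_mul]
    have h2 : ∀ T : Idx → Idx → Idx → Idx → ℝ,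
        ∑ c, ∑ d, ∑ e, ∑ f, T c d e f = ∑ e, ∑ f, ∑ c, ∑ d, T c d e f := fun T => by
      rw [Finset.sum_congr rfl fun c _ => Finset.sum_comm, Finset.sum_comm]
      refine Finset.sum_congr rfl fun e _ => ?_
      rw [Finset.sum_congr rfl fun c _ => Finset.sum_comm, Finset.sum_comm]
    rw [h2]
    exact Finset.sum_congr rfl fun e _ => Finset.sum_congr rfl fun f _ =>
      Finset.sum_congr rfl fun c _ => Finset.sum_congr rfl fun d _ => by ring
  simp only [ricFrame, ← hG, ← hG', Finset.sum_sub_distrib, T1, T2, T3, T4, mul_add, mul_sub,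
    Finset.sum_add_distrib]

end

/-! ### The Ricci tensor in terms of the 2-jet of the metric -/

/-- The differentiation index comes first: `g₁ c a b` stands for ∂_c g_{ab}. -/
def jetChr (K : Matrix Idx Idx ℝ) (g₁ : Idx → Idx → Idx → ℝ) (c a b : Idx) : ℝ :=
  (1 / 2) * ∑ d, K c d * (g₁ a d b + g₁ b d a - g₁ d a b)

/-- The product rule for `jetChr`, with ∂_e K replaced by -K (∂_e g) K and `g₂ e c a b` standing for
∂_e ∂_c g_{ab}. -/
def jetDChr (K : Matrix Idx Idx ℝ) (g₁ : Idx → Idx → Idx → ℝ) (g₂ : Idx → Idx → Idx → Idx → ℝ)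
    (e c a b : Idx) : ℝ :=
  (1 / 2) * ∑ d, ((-∑ m, ∑ n, K c m * g₁ e m n * K n d) * (g₁ a d b + g₁ b d a - g₁ d a b)
    + K c d * (g₂ e a d b + g₂ e b d a - g₂ e d a b))

/-- The Ricci tensor in terms of the inverse `K` of the metric and of its first and second
derivatives `g₁`, `g₂`. -/
def jetRic (K : Matrix Idx Idx ℝ) (g₁ : Idx → Idx → Idx → ℝ) (g₂ : Idx → Idx → Idx → Idx → ℝ)
    (a b : Idx) : ℝ :=
  ∑ c, (jetDChr K g₁ g₂ c c a b - jetDChr K g₁ g₂ b c a c)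
    + ∑ c, ∑ d, (jetChr K g₁ c c d * jetChr K g₁ d a b - jetChr K g₁ c b d * jetChr K g₁ d a c)

section
variable {U : Set Orbit} {Q : Orbit → Matrix Idx Idx ℝ} {t : Orbit}

/-- Differentiating Q⁻¹ Q = 1 gives dQ⁻¹ = -Q⁻¹ dQ Q⁻¹. -/
theorem ddir_inv (hU : IsOpen U) (hQ : ∀ a b, ContDiffOn ℝ ∞ (fun t => Q t a b) U)
    (hdet : ∀ t ∈ U, (Q t).det ≠ 0) (ht : t ∈ U) (v : Orbit) (c d : Idx) :
    ddir v (fun s => (Q s)⁻¹ c d) t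
      = -∑ m, ∑ n, (Q t)⁻¹ c m * ddir v (fun s => Q s m n) t * (Q t)⁻¹ n d := by
  set D : Matrix Idx Idx ℝ := Matrix.of fun c d => ddir v (fun s => (Q s)⁻¹ c d) t with hD
  set N : Matrix Idx Idx ℝ := Matrix.of fun c d => ddir v (fun s => Q s c d) t with hN
  have hQd := fun a b => differentiableAt_of_smoothOn hU (hQ a b) ht
  have hKd := fun a b => differentiableAt_of_smoothOn hU (smoothOn_inv hQ hdet a b) ht
  have h1 : D * Q t + (Q t)⁻¹ * N = 0 := by
    ext c n
    have h2 : ddir v (fun s => ∑ m, (Q s)⁻¹ c m * Q s m n) t = 0 := by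
      rw [ddir_congr hU (K := fun _ => (1 : Matrix Idx Idx ℝ) c n) (fun s hs => ?_) ht, ddir_const]
      rw [← Matrix.mul_apply, Matrix.nonsing_inv_mul _ (by simpa using hdet s hs)]
    rw [ddir_sum _ (fun m _ => (hKd c m).fun_mul (hQd m n))] at h2
    simp only [Matrix.add_apply, Matrix.mul_apply, hD, hN, Matrix.of_apply, Matrix.zero_apply]
    rw [← Finset.sum_add_distrib, ← h2]
    exact Finset.sum_congr rfl fun m _ => (ddir_mul (hKd c m) (hQd m n)).symm
  have h3 : D = -((Q t)⁻¹ * N * (Q t)⁻¹) := by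
    have : D * Q t * (Q t)⁻¹ = -((Q t)⁻¹ * N) * (Q t)⁻¹ := by rw [eq_neg_of_add_eq_zero_left h1]
    rwa [Matrix.mul_assoc, Matrix.mul_nonsing_inv _ (by simpa using hdet t ht), Matrix.mul_one,
      Matrix.neg_mul] at this
  have h4 := congrFun (congrFun h3 c) d
  simp only [hD, hN, Matrix.of_apply, Matrix.neg_apply, Matrix.mul_apply, Finset.sum_mul] at h4
  rw [h4, Finset.sum_comm]

/-- After this step the Ricci tensor at a point is a polynomial in finitely many numbers, so its
components can be expanded by `ring`. -/
theorem ricFrame_eq_jetRic (hU : IsOpen U) (hQ : ∀ a b, ContDiffOn ℝ ∞ (fun t => Q t a b) U)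
    (hdet : ∀ t ∈ U, (Q t).det ≠ 0) (ht : t ∈ U) (w : Idx → Orbit) (a b : Idx) :
    ricFrame w Q a b t = jetRic (Q t)⁻¹ (fun c a b => ddir (w c) (fun s => Q s a b) t)
      (fun e c a b => ddir (w e) (ddir (w c) (fun s => Q s a b)) t) a b := by
  have hQd := fun a b v => differentiableAt_of_smoothOn hU (smoothOn_ddir hU (hQ a b) v) ht
  have hKd := fun a b => differentiableAt_of_smoothOn hU (smoothOn_inv hQ hdet a b) ht
  have key : ∀ e c a b, ddir (w e) (chrFrame w Q c a b) t
      = jetDChr (Q t)⁻¹ (fun c a b => ddir (w c) (fun s => Q s a b) t)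
      (fun e c a b => ddir (w e) (ddir (w c) (fun s => Q s a b)) t) e c a b := by
    intro e c a b
    have hB := fun d => ((hQd d b (w a)).fun_add (hQd d a (w b))).fun_sub (hQd a b (w d))
    unfold chrFrame jetDChr
    rw [ddir_const_mul (DifferentiableAt.fun_sum fun d _ => (hKd c d).fun_mul (hB d)),
      ddir_sum _ (fun d _ => (hKd c d).fun_mul (hB d))]
    congr 1
    refine Finset.sum_congr rfl fun d _ => ?_
    rw [ddir_mul (hKd c d) (hB d), ddir_inv hU hQ hdet ht,
      ddir_sub ((hQd d b (w a)).fun_add (hQd d a (w b))) (hQd a b (w d)),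
      ddir_add (hQd d b (w a)) (hQd d a (w b))]
  simp only [ricFrame, jetRic, key]
  rfl

end

/-! ### Evaluation in an adapted frame -/

section
open Sum

variable {K : Matrix Idx Idx ℝ} {g₁ : Idx → Idx → Idx → ℝ} {g₂ : Idx → Idx → Idx → Idx → ℝ}
  {η : Fin 2 → Fin 2 → ℝ} {H : Fin 2 → Fin 2 → Fin 2 → ℝ} {B : Fin 2 → Fin 2 → Fin 2 → ℝ}
  {A : Fin 2 → Fin 2 → Fin 2 → ℝ}

/-- The inverse metric and the first derivatives of the metric in a frame that is null for the
orbit metric and orthogonal to the Killing leaves at the given point. -/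
structure AdaptedJet (K : Matrix Idx Idx ℝ) (g₁ : Idx → Idx → Idx → ℝ)
    (g₂ : Idx → Idx → Idx → Idx → ℝ) (η : Fin 2 → Fin 2 → ℝ)
    (A B H : Fin 2 → Fin 2 → Fin 2 → ℝ) : Prop where
  K00 : K (inl 0) (inl 0) = 0
  -- From g̃ = p q the scalar product of the null vectors e₁, e₂ is 1/2, hence 2 in the inverse.
  K01 : K (inl 0) (inl 1) = 2
  K10 : K (inl 1) (inl 0) = 2
  K11 : K (inl 1) (inl 1) = 0
  Ktz : ∀ i k, K (inl i) (inr k) = 0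
  Kzt : ∀ i k, K (inr k) (inl i) = 0
  Kzz : ∀ k l, K (inr k) (inr l) = η k l
  η10 : η 1 0 = η 0 1
  g1z : ∀ k a b, g₁ (inr k) a b = 0
  g1tt : ∀ m i j, g₁ (inl m) (inl i) (inl j) = A m i j
  A10 : ∀ m, A m 1 0 = A m 0 1
  g1tz : ∀ m i k, g₁ (inl m) (inl i) (inr k) = B m i k
  g1zt : ∀ m i k, g₁ (inl m) (inr k) (inl i) = B m i k
  g1zz : ∀ m k l, g₁ (inl m) (inr k) (inr l) = H m k l
  H10 : ∀ m, H m 1 0 = H m 0 1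
  g2z : ∀ k c a b, g₂ (inr k) c a b = 0
  g2z' : ∀ k c a b, g₂ c (inr k) a b = 0

/-- When h is constant along e₂, its mixed second derivatives in the constant frame come only from
the variation of e₂, as recorded in `h01` and `h10`, and cancel against the connection terms. What
survives is the square of the curvature of f, a matrix of rank at most one. -/
theorem AdaptedJet.ric_zz (J : AdaptedJet K g₁ g₂ η A B H) (hH : ∀ k l, H 1 k l = 0)
    (h01 : ∀ k l, g₂ (inl 0) (inl 1) (inr k) (inr l) = A 0 1 1 * H 0 k l)
    (h10 : ∀ k l, g₂ (inl 1) (inl 0) (inr k) (inr l) = A 0 1 1 * H 0 k l) (k l : Fin 2) :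
    jetRic K g₁ g₂ (inr k) (inr l) = -2 * (B 0 1 k - B 1 0 k) * (B 0 1 l - B 1 0 l) := by
  simp only [jetRic, jetChr, jetDChr, Fintype.sum_sum_type, Fin.sum_univ_two, J.K00, J.K01, J.K10,
    J.K11, J.Ktz, J.Kzt, J.Kzz, J.η10, J.g1z, J.g1tt, J.A10, J.g1tz, J.g1zt, J.g1zz,
    J.g2z, J.g2z', mul_zero, zero_mul, add_zero, zero_add, sub_zero, zero_sub, neg_zero, hH,
    h01, h10]
  revert k l
  simp only [Fin.forall_fin_two, J.H10]
  refine ⟨⟨?_, ?_⟩, ?_, ?_⟩ <;> ring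

/-- The Raychaudhuri-type component. The derivatives of f drop out, so only h and the connection of
the null frame remain. -/
theorem AdaptedJet.ric_00 (J : AdaptedJet K g₁ g₂ η A B H)
    (hc : g₂ (inl 1) (inl 0) (inl 0) (inl 0) = g₂ (inl 0) (inl 1) (inl 0) (inl 0))
    (hs : g₂ (inl 0) (inl 0) (inr 1) (inr 0) = g₂ (inl 0) (inl 0) (inr 0) (inr 1)) :
    jetRic K g₁ g₂ (inl 0) (inl 0)
      = -(1 / 2) * (η 0 0 * g₂ (inl 0) (inl 0) (inr 0) (inr 0)
          + 2 * η 0 1 * g₂ (inl 0) (inl 0) (inr 0) (inr 1)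
          + η 1 1 * g₂ (inl 0) (inl 0) (inr 1) (inr 1))
        + (1 / 4) * ((η 0 0 * H 0 0 0 + η 0 1 * H 0 0 1) ^ 2
          + 2 * (η 0 0 * H 0 0 1 + η 0 1 * H 0 1 1) * (η 0 1 * H 0 0 0 + η 1 1 * H 0 0 1)
          + (η 0 1 * H 0 0 1 + η 1 1 * H 0 1 1) ^ 2)
        + (1 / 2) * A 0 0 0 * (η 0 0 * H 1 0 0 + 2 * η 0 1 * H 1 0 1 + η 1 1 * H 1 1 1)
        + (A 0 0 1 - (1 / 2) * A 1 0 0)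
          * (η 0 0 * H 0 0 0 + 2 * η 0 1 * H 0 0 1 + η 1 1 * H 0 1 1) := by
  simp only [jetRic, jetChr, jetDChr, Fintype.sum_sum_type, Fin.sum_univ_two, J.K00, J.K01, J.K10,
    J.K11, J.Ktz, J.Kzt, J.Kzz, J.η10, J.g1z, J.g1tt, J.A10, J.g1tz, J.g1zt, J.g1zz,
    J.g2z, J.g2z', mul_zero, zero_mul, add_zero, zero_add, sub_zero, zero_sub, neg_zero, J.H10,
    hc, hs]
  ring

/-- This component carries the curvature of the orbit metric. The terms in `B` compensate the part
of the second derivatives `g₂` that is quadratic in the derivatives of f. -/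
theorem AdaptedJet.ric_01 (J : AdaptedJet K g₁ g₂ η A B H) (hH : ∀ k l, H 1 k l = 0)
    (hB : ∀ k, B 1 0 k = B 0 1 k)
    (h10 : ∀ k l, g₂ (inl 1) (inl 0) (inr k) (inr l) = A 0 1 1 * H 0 k l)
    (hc : ∀ i j, g₂ (inl 1) (inl 0) (inl i) (inl j) = g₂ (inl 0) (inl 1) (inl i) (inl j))
    (hs : g₂ (inl 0) (inl 1) (inl 1) (inl 0) = g₂ (inl 0) (inl 1) (inl 0) (inl 1)) :
    jetRic K g₁ g₂ (inl 0) (inl 1)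
      = g₂ (inl 0) (inl 0) (inl 1) (inl 1) + g₂ (inl 1) (inl 1) (inl 0) (inl 0)
        - 2 * g₂ (inl 0) (inl 1) (inl 0) (inl 1)
        - A 0 1 1 * (2 * A 0 0 1 + A 1 0 0) + A 0 0 1 * A 1 0 1 * 4 - A 1 0 0 * A 1 0 1 * 2
        + A 1 1 1 * A 0 0 0
        + 2 * (η 0 0 * (B 0 0 0 * B 1 1 0 - B 0 1 0 ^ 2)
          + η 0 1 * (B 0 0 0 * B 1 1 1 + B 0 0 1 * B 1 1 0 - 2 * B 0 1 0 * B 0 1 1)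
          + η 1 1 * (B 0 0 1 * B 1 1 1 - B 0 1 1 ^ 2)) := by
  simp only [jetRic, jetChr, jetDChr, Fintype.sum_sum_type, Fin.sum_univ_two, J.K00, J.K01, J.K10,
    J.K11, J.Ktz, J.Kzt, J.Kzz, J.η10, J.g1z, J.g1tt, J.A10, J.g1tz, J.g1zt, J.g1zz,
    J.g2z, J.g2z', mul_zero, zero_mul, add_zero, zero_add, sub_zero, zero_sub, neg_zero, J.H10, hH,
    hB, h10, hc, hs]
  ring

end

open Sum

/-! ### Null frames of the orbit metric -/

/-- A null coframe `p, q` of the orbit metric, `g̃ = p q`. -/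
structure NullFrame {U : Set Orbit} (G : Coeffs U) where
  p : Orbit → Fin 2 → ℝ
  q : Orbit → Fin 2 → ℝ
  p_smooth : ∀ i, ContDiffOn ℝ ∞ (fun t => p t i) U
  q_smooth : ∀ i, ContDiffOn ℝ ∞ (fun t => q t i) U
  vol_ne : ∀ t ∈ U, p t 0 * q t 1 - p t 1 * q t 0 ≠ 0
  gt_eq : ∀ t ∈ U, ∀ i j, G.gt t i j = (1 / 2) * (p t i * q t j + q t i * p t j)

namespace NullFrame

variable {U : Set Orbit} {G : Coeffs U} (N : NullFrame G)

def vol (t : Orbit) : ℝ := N.p t 0 * N.q t 1 - N.p t 1 * N.q t 0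

/-- The frame dual to the coframe `p, q`. -/
def e₁ (t : Orbit) : Orbit := ![N.q t 1 / N.vol t, -N.q t 0 / N.vol t]

def e₂ (t : Orbit) : Orbit := ![-N.p t 1 / N.vol t, N.p t 0 / N.vol t]

/-- The same coframe in the opposite order. -/
def swap : NullFrame G where
  p := N.q
  q := N.p
  p_smooth := N.q_smooth
  q_smooth := N.p_smooth
  vol_ne t ht h := N.vol_ne t ht (by linarith)
  gt_eq t ht i j := by rw [N.gt_eq t ht]; ring

theorem swap_vol (t : Orbit) : N.swap.vol t = - N.vol t := by
  simp [vol, swap]; ring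

theorem swap_e₁ (t : Orbit) : N.swap.e₁ t = N.e₂ t := by
  have hq : N.swap.q = N.p := rfl
  ext i; fin_cases i <;> simp [e₁, e₂, N.swap_vol, hq, div_neg, neg_div]

theorem swap_e₂ (t : Orbit) : N.swap.e₂ t = N.e₁ t := by
  have hp : N.swap.p = N.q := rfl
  ext i; fin_cases i <;> simp [e₁, e₂, N.swap_vol, hp, div_neg, neg_div]

/-- The coefficients in `[e₁, e₂] = b e₁ + a e₂`. -/
def a (t : Orbit) : ℝ := -(pd 0 (fun s => N.q s 1) t - pd 1 (fun s => N.q s 0) t) / N.vol t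

def b (t : Orbit) : ℝ := -(pd 0 (fun s => N.p s 1) t - pd 1 (fun s => N.p s 0) t) / N.vol t

/-- The connection form of the null frame. -/
def conn (t : Orbit) (i : Fin 2) : ℝ := N.a t * N.p t i + N.b t * N.q t i

theorem p_e₁ {t : Orbit} (ht : t ∈ U) : N.p t 0 * N.e₁ t 0 + N.p t 1 * N.e₁ t 1 = 1 := by
  have h : N.vol t ≠ 0 := N.vol_ne t ht
  simp only [e₁, Matrix.cons_val_zero, Matrix.cons_val_one]
  rw [← div_self h, vol]
  ring

theorem q_e₁ {t : Orbit} : N.q t 0 * N.e₁ t 0 + N.q t 1 * N.e₁ t 1 = 0 := by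
  simp only [e₁, vol, Matrix.cons_val_zero, Matrix.cons_val_one]
  ring

theorem p_e₂ {t : Orbit} : N.p t 0 * N.e₂ t 0 + N.p t 1 * N.e₂ t 1 = 0 := by
  simp only [e₂, vol, Matrix.cons_val_zero, Matrix.cons_val_one]
  ring

theorem q_e₂ {t : Orbit} (ht : t ∈ U) : N.q t 0 * N.e₂ t 0 + N.q t 1 * N.e₂ t 1 = 1 := by
  have h : N.vol t ≠ 0 := N.vol_ne t ht
  simp only [e₂, Matrix.cons_val_zero, Matrix.cons_val_one]
  rw [← div_self h, vol]
  ring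

theorem smoothOn_vol : ContDiffOn ℝ ∞ N.vol U :=
  ((N.p_smooth 0).mul (N.q_smooth 1)).sub ((N.p_smooth 1).mul (N.q_smooth 0))

theorem smoothOn_e₁ (i : Fin 2) : ContDiffOn ℝ ∞ (fun t => N.e₁ t i) U := by
  fin_cases i
  · exact (N.q_smooth 1).div N.smoothOn_vol N.vol_ne
  · exact (N.q_smooth 0).neg.div N.smoothOn_vol N.vol_ne

theorem smoothOn_e₂ (i : Fin 2) : ContDiffOn ℝ ∞ (fun t => N.e₂ t i) U := by
  fin_cases i
  · exact (N.p_smooth 1).neg.div N.smoothOn_vol N.vol_ne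
  · exact (N.p_smooth 0).div N.smoothOn_vol N.vol_ne

theorem smoothOn_a (hU : IsOpen U) : ContDiffOn ℝ ∞ N.a U :=
  ((smoothOn_pd hU (N.q_smooth 1) 0).sub (smoothOn_pd hU (N.q_smooth 0) 1)).neg.div
    N.smoothOn_vol N.vol_ne

theorem smoothOn_b (hU : IsOpen U) : ContDiffOn ℝ ∞ N.b U :=
  ((smoothOn_pd hU (N.p_smooth 1) 0).sub (smoothOn_pd hU (N.p_smooth 0) 1)).neg.div
    N.smoothOn_vol N.vol_ne

theorem smoothOn_conn (hU : IsOpen U) (i : Fin 2) : ContDiffOn ℝ ∞ (fun t => N.conn t i) U :=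
  ((N.smoothOn_a hU).mul (N.p_smooth i)).add ((N.smoothOn_b hU).mul (N.q_smooth i))

/-! ### The constant frame adapted to a point -/

/-- The vectors `e₁, e₂` at the point `t₀`. -/
def basis (t₀ : Orbit) : Fin 2 → Orbit := ![N.e₁ t₀, N.e₂ t₀]

/-- The components of `p` in the constant frame `e₁(t₀), e₂(t₀)`. -/
def pc (t₀ : Orbit) (i : Fin 2) (t : Orbit) : ℝ :=
  N.p t 0 * N.basis t₀ i 0 + N.p t 1 * N.basis t₀ i 1

def qc (t₀ : Orbit) (i : Fin 2) (t : Orbit) : ℝ :=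
  N.q t 0 * N.basis t₀ i 0 + N.q t 1 * N.basis t₀ i 1

/-- The components of `f - f(t₀)` in the constant frame. -/
def fc (t₀ : Orbit) (i k : Fin 2) (t : Orbit) : ℝ :=
  (G.f t 0 k - G.f t₀ 0 k) * N.basis t₀ i 0 + (G.f t 1 k - G.f t₀ 1 k) * N.basis t₀ i 1

/-- The columns are the lifts of e₁(t₀), e₂(t₀) that are orthogonal to the leaves at t₀, followed by
the two fields ∂_z. The shear by -f(t₀) is the reason why only f - f(t₀), which vanishes at t₀,
occurs in the components below. -/
def frameMatrix (t₀ : Orbit) : Matrix Idx Idx ℝ :=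
  Matrix.fromBlocks (Matrix.of fun i j => N.basis t₀ j i) 0
    (Matrix.of fun k j => -(G.f t₀ 0 k * N.basis t₀ j 0 + G.f t₀ 1 k * N.basis t₀ j 1)) 1

end NullFrame

/-- The components of the metric as functions on the orbit space. -/
def Coeffs.comps {U : Set Orbit} (G : Coeffs U) (t : Orbit) : Matrix Idx Idx ℝ :=
  Matrix.of fun a b =>
    ∑ i, ∑ j, G.gt t i j * (Pi.single (Sum.inl i) 1 : Idx → ℝ) a *
      (Pi.single (Sum.inl j) 1 : Idx → ℝ) b
    + ∑ k, ∑ l, G.h t k l * G.vertForm t k a * G.vertForm t l b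

theorem Coeffs.metric_eq {U : Set Orbit} (G : Coeffs U) :
    G.metric = fun x => G.comps (tPart x) := rfl

namespace NullFrame
variable {U : Set Orbit} {G : Coeffs U} (N : NullFrame G)

/-- The components of the metric in the constant frame adapted to `t₀`. -/
def conj (t₀ s : Orbit) : Matrix Idx Idx ℝ :=
  (N.frameMatrix t₀).transpose * G.comps s * N.frameMatrix t₀

theorem conj_tt {t : Orbit} (ht : t ∈ U) (t₀ : Orbit) (i j : Fin 2) :
    N.conj t₀ t (inl i) (inl j)
      = (1 / 2) * (N.pc t₀ i t * N.qc t₀ j t + N.qc t₀ i t * N.pc t₀ j t)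
        + ∑ k, ∑ l, G.h t k l * (N.fc t₀ i k t * N.fc t₀ j l t) := by
  simp [conj, Matrix.mul_apply, Fintype.sum_sum_type, Fin.sum_univ_two, frameMatrix, Coeffs.comps,
    Coeffs.vertForm, Pi.single_apply, N.gt_eq t ht, pc, qc, fc]
  ring

theorem conj_tz (t t₀ : Orbit) (i k : Fin 2) :
    N.conj t₀ t (inl i) (inr k)
      = ∑ l, G.h t l k * N.fc t₀ i l t := by
  fin_cases k <;>
  simp [conj, Matrix.mul_apply, Fintype.sum_sum_type, Fin.sum_univ_two, frameMatrix, Coeffs.comps,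
    Coeffs.vertForm, Pi.single_apply, fc] <;>
  ring

theorem conj_zt (t t₀ : Orbit) (i k : Fin 2) :
    N.conj t₀ t (inr k) (inl i)
      = ∑ l, G.h t k l * N.fc t₀ i l t := by
  fin_cases k <;>
  simp [conj, Matrix.mul_apply, Fintype.sum_sum_type, Fin.sum_univ_two, frameMatrix, Coeffs.comps,
    Coeffs.vertForm, Pi.single_apply, fc] <;>
  ring

theorem conj_zz (t t₀ : Orbit) (k l : Fin 2) :
    N.conj t₀ t (inr k) (inr l) = G.h t k l := by
  fin_cases k <;> fin_cases l <;>
  simp [conj, Matrix.mul_apply, Fintype.sum_sum_type, Fin.sum_univ_two, frameMatrix, Coeffs.comps,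
    Coeffs.vertForm, Pi.single_apply]

end NullFrame

/-! ### Second derivatives of products -/

section
variable {U : Set Orbit} {F K M : Orbit → ℝ} {t : Orbit}

theorem ddir_ddir_mul (hU : IsOpen U) (hF : ContDiffOn ℝ ∞ F U) (hK : ContDiffOn ℝ ∞ K U)
    (ht : t ∈ U) (v w : Orbit) :
    ddir v (ddir w fun s => F s * K s) t = ddir v (ddir w F) t * K t + ddir w F t * ddir v K t
      + ddir v F t * ddir w K t + F t * ddir v (ddir w K) t := by
  have d : ∀ {X : Orbit → ℝ}, ContDiffOn ℝ ∞ X U → ∀ s ∈ U, DifferentiableAt ℝ X s :=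
    fun hX s hs => differentiableAt_of_smoothOn hU hX hs
  have hF' := smoothOn_ddir hU hF w
  have hK' := smoothOn_ddir hU hK w
  rw [ddir_congr hU (fun s hs => ddir_mul (d hF s hs) (d hK s hs)) ht,
    ddir_add (d (hF'.mul hK) t ht) (d (hF.mul hK') t ht),
    ddir_mul (d hF' t ht) (d hK t ht), ddir_mul (d hF t ht) (d hK' t ht)]
  ring

theorem ddir_ddir_add (hU : IsOpen U) (hF : ContDiffOn ℝ ∞ F U) (hK : ContDiffOn ℝ ∞ K U)
    (ht : t ∈ U) (v w : Orbit) :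
    ddir v (ddir w fun s => F s + K s) t = ddir v (ddir w F) t + ddir v (ddir w K) t := by
  have d : ∀ {X : Orbit → ℝ}, ContDiffOn ℝ ∞ X U → ∀ s ∈ U, DifferentiableAt ℝ X s :=
    fun hX s hs => differentiableAt_of_smoothOn hU hX hs
  rw [ddir_congr hU (fun s hs => ddir_add (d hF s hs) (d hK s hs)) ht,
    ddir_add (d (smoothOn_ddir hU hF w) t ht) (d (smoothOn_ddir hU hK w) t ht)]

theorem ddir_ddir_const_mul (hU : IsOpen U) (hF : ContDiffOn ℝ ∞ F U) (ht : t ∈ U) (c : ℝ)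
    (v w : Orbit) :
    ddir v (ddir w fun s => c * F s) t = c * ddir v (ddir w F) t := by
  rw [ddir_congr hU (fun s hs => ddir_const_mul (differentiableAt_of_smoothOn hU hF hs) c) ht,
    ddir_const_mul (differentiableAt_of_smoothOn hU (smoothOn_ddir hU hF w) ht)]

theorem ddir_ddir_sum (hU : IsOpen U) {Fs : Fin 2 → Orbit → ℝ}
    (hF : ∀ i, ContDiffOn ℝ ∞ (Fs i) U) (ht : t ∈ U) (v w : Orbit) :
    ddir v (ddir w fun s => ∑ i, Fs i s) t = ∑ i, ddir v (ddir w (Fs i)) t := by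
  simp only [Fin.sum_univ_two]
  exact ddir_ddir_add hU (hF 0) (hF 1) ht v w

theorem ddir_mul_of_zero (hU : IsOpen U) (hF : ContDiffOn ℝ ∞ F U) (hK : ContDiffOn ℝ ∞ K U)
    (hM : ContDiffOn ℝ ∞ M U) (ht : t ∈ U) (hK0 : K t = 0) (hM0 : M t = 0) (v : Orbit) :
    ddir v (fun s => F s * (K s * M s)) t = 0 := by
  have d : ∀ {X : Orbit → ℝ}, ContDiffOn ℝ ∞ X U → DifferentiableAt ℝ X t :=
    fun hX => differentiableAt_of_smoothOn hU hX ht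
  rw [ddir_mul (d hF) (d (hK.mul hM)), ddir_mul (d hK) (d hM), hK0, hM0]
  ring

/-- Applied to h (f - f(t₀)) (f - f(t₀)): both of the last factors vanish at t₀, so only the cross
terms of their first derivatives remain at second order. -/
theorem ddir_ddir_mul_of_zero (hU : IsOpen U) (hF : ContDiffOn ℝ ∞ F U)
    (hK : ContDiffOn ℝ ∞ K U) (hM : ContDiffOn ℝ ∞ M U) (ht : t ∈ U) (hK0 : K t = 0)
    (hM0 : M t = 0) (v w : Orbit) :
    ddir v (ddir w fun s => F s * (K s * M s)) t
      = F t * (ddir w K t * ddir v M t + ddir v K t * ddir w M t) := by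
  have d : ∀ {X : Orbit → ℝ}, ContDiffOn ℝ ∞ X U → DifferentiableAt ℝ X t :=
    fun hX => differentiableAt_of_smoothOn hU hX ht
  rw [ddir_ddir_mul hU hF (hK.mul hM) ht, ddir_ddir_mul hU hK hM ht, ddir_mul (d hK) (d hM),
    ddir_mul (d hK) (d hM), hK0, hM0]
  ring

end

/-! ### The metric in the adapted frame at the base point -/

namespace NullFrame

variable {U : Set Orbit} {G : Coeffs U} (N : NullFrame G) {t : Orbit}

theorem smoothOn_pc (t₀ : Orbit) (i : Fin 2) : ContDiffOn ℝ ∞ (N.pc t₀ i) U :=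
  ((N.p_smooth 0).mul contDiffOn_const).add ((N.p_smooth 1).mul contDiffOn_const)

theorem smoothOn_qc (t₀ : Orbit) (i : Fin 2) : ContDiffOn ℝ ∞ (N.qc t₀ i) U :=
  ((N.q_smooth 0).mul contDiffOn_const).add ((N.q_smooth 1).mul contDiffOn_const)

theorem smoothOn_fc (t₀ : Orbit) (i k : Fin 2) : ContDiffOn ℝ ∞ (N.fc t₀ i k) U :=
  (((G.f_smooth 0 k).sub contDiffOn_const).mul contDiffOn_const).add
    (((G.f_smooth 1 k).sub contDiffOn_const).mul contDiffOn_const)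

theorem pc_zero (ht : t ∈ U) : N.pc t 0 t = 1 := N.p_e₁ ht
theorem pc_one : N.pc t 1 t = 0 := N.p_e₂
theorem qc_zero : N.qc t 0 t = 0 := N.q_e₁
theorem qc_one (ht : t ∈ U) : N.qc t 1 t = 1 := N.q_e₂ ht
theorem fc_self (i k : Fin 2) : N.fc t i k t = 0 := by simp [fc]

theorem basis_wedge (ht : t ∈ U) :
    N.basis t 0 0 * N.basis t 1 1 - N.basis t 1 0 * N.basis t 0 1 = 1 / N.vol t := by
  have h : N.vol t ≠ 0 := N.vol_ne t ht
  simp only [basis, e₁, e₂, Matrix.cons_val_zero, Matrix.cons_val_one]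
  field_simp
  rw [vol]; ring

theorem det_frameMatrix (ht : t ∈ U) : (N.frameMatrix t).det ≠ 0 := by
  have h : N.vol t ≠ 0 := N.vol_ne t ht
  rw [frameMatrix, Matrix.det_fromBlocks_zero₁₂, Matrix.det_one, mul_one, Matrix.det_fin_two]
  simp only [Matrix.of_apply]
  rw [N.basis_wedge ht]
  exact one_div_ne_zero h

theorem conj_self (ht : t ∈ U) :
    N.conj t t = Matrix.fromBlocks !![0, 1 / 2; 1 / 2, 0] 0 0 (G.h t) := by
  ext a b
  rcases a with i | k <;> rcases b with j | l
  · rw [N.conj_tt ht]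
    fin_cases i <;> fin_cases j <;>
      simp [N.pc_zero ht, N.pc_one, N.qc_zero, N.qc_one ht, fc_self]
  · rw [N.conj_tz]; simp [fc_self]
  · rw [N.conj_zt]; simp [fc_self]
  · rw [N.conj_zz]; simp

theorem inv_conj_self (ht : t ∈ U) :
    (N.conj t t)⁻¹ = Matrix.fromBlocks !![0, 2; 2, 0] 0 0 (G.h t)⁻¹ := by
  rw [N.conj_self ht]
  apply Matrix.inv_eq_left_inv
  have h : (!![0, 2; 2, 0] : Matrix (Fin 2) (Fin 2) ℝ) * !![0, 1 / 2; 1 / 2, 0] = 1 := by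
    ext i j; fin_cases i <;> fin_cases j <;> simp
  rw [Matrix.fromBlocks_multiply, h, Matrix.nonsing_inv_mul _ (by simpa using G.h_det t ht)]
  simp [Matrix.fromBlocks_one]

/-- The frame adapted to `t` makes the metric block diagonal at `t`, where non-degeneracy is
visible; the components in the coordinate frame are congruent to these. -/
theorem det_comps (N : NullFrame G) (ht : t ∈ U) : (G.comps t).det ≠ 0 := by
  have h : (N.conj t t).det ≠ 0 := by
    rw [N.conj_self ht, Matrix.det_fromBlocks_zero₁₂, Matrix.det_fin_two]
    have := G.h_det t ht
    simpa using this
  intro h0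
  exact h (by rw [conj, Matrix.det_mul, Matrix.det_mul, h0]; ring)

theorem smoothOn_comps (G : Coeffs U) (a b : Idx) : ContDiffOn ℝ ∞ (fun t => G.comps t a b) U := by
  have hv : ∀ k a, ContDiffOn ℝ ∞ (fun t => G.vertForm t k a) U := by
    intro k a
    rcases a with i | l
    · exact G.f_smooth i k
    · exact contDiffOn_const
  simp only [Coeffs.comps, Matrix.of_apply]
  refine ContDiffOn.add ?_ ?_
  · exact ContDiffOn.sum fun i _ => ContDiffOn.sum fun j _ =>
      ((G.gt_smooth i j).mul contDiffOn_const).mul contDiffOn_const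
  · exact ContDiffOn.sum fun k _ => ContDiffOn.sum fun l _ =>
      ((G.h_smooth k l).mul (hv k a)).mul (hv l b)

theorem smoothOn_conj (t₀ : Orbit) (a b : Idx) :
    ContDiffOn ℝ ∞ (fun t => N.conj t₀ t a b) U := by
  simp only [conj, Matrix.mul_apply]
  exact ContDiffOn.sum fun i _ => (ContDiffOn.sum fun j _ =>
    contDiffOn_const.mul (smoothOn_comps G j i)).mul contDiffOn_const

theorem det_conj (ht : t ∈ U) {s : Orbit} (hs : s ∈ U) : (N.conj t s).det ≠ 0 := by
  rw [conj, Matrix.det_mul, Matrix.det_mul, Matrix.det_transpose]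
  have := N.det_frameMatrix ht
  exact mul_ne_zero (mul_ne_zero this (N.det_comps hs)) this

/-- The projections to the orbit space of the constant frame adapted to `t₀`. -/
def proj (t₀ : Orbit) : Idx → Orbit := Sum.elim (N.basis t₀) (fun _ => 0)

theorem changeFrame_frameMatrix (t₀ : Orbit) :
    changeFrame (N.frameMatrix t₀) coordFrame = N.proj t₀ := by
  ext a j
  rcases a with i | k
  · fin_cases j <;> simp [changeFrame, frameMatrix, coordFrame, proj]
  · fin_cases j <;> simp [changeFrame, frameMatrix, coordFrame, proj]

/-- The first derivatives of the metric in the adapted constant frame. -/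
def jet₁ (t₀ : Orbit) (c a b : Idx) : ℝ := ddir (N.proj t₀ c) (fun s => N.conj t₀ s a b) t₀

def jet₂ (t₀ : Orbit) (e c a b : Idx) : ℝ :=
  ddir (N.proj t₀ e) (ddir (N.proj t₀ c) fun s => N.conj t₀ s a b) t₀

/-- The field equations at `t` in the frame adapted to that same point. They are read off at z = 0,
since nothing depends on z. -/
theorem jetRic_eq (hU : IsOpen U) {Λ : ℝ} (hvac : IsLambdaVacuum G.metric Λ (cyl U))
    (ht : t ∈ U) (a b : Idx) :
    jetRic (N.conj t t)⁻¹ (N.jet₁ t) (N.jet₂ t) a b = Λ * N.conj t t a b := by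
  have h1 := ricFrame_eq_jetRic hU (N.smoothOn_conj t) (fun s hs => N.det_conj ht hs) ht
    (N.proj t) a b
  have h2 : ∀ e f, ricFrame coordFrame G.comps e f t = Λ * G.comps t e f := by
    intro e f
    have hx : tPart (Sum.elim t 0) = t := rfl
    have := hvac (Sum.elim t 0) (by simpa [cyl, hx] using ht) e f
    rw [G.metric_eq, ricci_comp_tPart hU (smoothOn_comps G) (fun s hs => N.det_comps hs)
      (by simpa [cyl, hx] using ht)] at this
    simpa [hx] using this
  have h3 := ricFrame_changeFrame hU (smoothOn_comps G) (fun s hs => N.det_comps hs)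
    (N.det_frameMatrix ht) coordFrame ht a b
  rw [N.changeFrame_frameMatrix] at h3
  refine h1.symm.trans (h3.trans ?_)
  simp only [h2, conj, Matrix.mul_apply, Matrix.transpose_apply, Finset.sum_mul, Finset.mul_sum]
  rw [Finset.sum_comm]
  exact Finset.sum_congr rfl fun e _ => Finset.sum_congr rfl fun f _ => by ring

/-! ### The 2-jet of the metric in the adapted constant frame -/

/-- First derivatives of the components of the coframe and of `f`. -/
def dp (t : Orbit) (m i : Fin 2) : ℝ := ddir (N.basis t m) (N.pc t i) t
def dq (t : Orbit) (m i : Fin 2) : ℝ := ddir (N.basis t m) (N.qc t i) t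
def df (t : Orbit) (m i k : Fin 2) : ℝ := ddir (N.basis t m) (N.fc t i k) t
def ddp (t : Orbit) (n m i : Fin 2) : ℝ := ddir (N.basis t n) (ddir (N.basis t m) (N.pc t i)) t
def ddq (t : Orbit) (n m i : Fin 2) : ℝ := ddir (N.basis t n) (ddir (N.basis t m) (N.qc t i)) t
def dh (t : Orbit) (m k l : Fin 2) : ℝ := ddir (N.basis t m) (fun s => G.h s k l) t
def ddh (t : Orbit) (n m k l : Fin 2) : ℝ :=
  ddir (N.basis t n) (ddir (N.basis t m) fun s => G.h s k l) t

theorem jet₁_tt (hU : IsOpen U) (ht : t ∈ U) (m i j : Fin 2) :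
    N.jet₁ t (inl m) (inl i) (inl j) = (1 / 2) * (N.dp t m i * N.qc t j t + N.pc t i t * N.dq t m j
      + (N.dq t m i * N.pc t j t + N.qc t i t * N.dp t m j)) := by
  have d : ∀ {X : Orbit → ℝ}, ContDiffOn ℝ ∞ X U → DifferentiableAt ℝ X t :=
    fun hX => differentiableAt_of_smoothOn hU hX ht
  have hP := N.smoothOn_pc t
  have hQ := N.smoothOn_qc t
  have hF := N.smoothOn_fc t
  have hterm := fun k l => (G.h_smooth k l).mul ((hF i k).mul (hF j l))
  rw [jet₁, ddir_congr hU (fun s hs => N.conj_tt hs t i j) ht,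
    ddir_add (d (contDiffOn_const.mul (((hP i).mul (hQ j)).add ((hQ i).mul (hP j)))))
      (d (ContDiffOn.sum fun k _ => ContDiffOn.sum fun l _ => hterm k l)),
    ddir_const_mul (d (((hP i).mul (hQ j)).add ((hQ i).mul (hP j)))),
    ddir_add (d ((hP i).mul (hQ j))) (d ((hQ i).mul (hP j))),
    ddir_mul (d (hP i)) (d (hQ j)), ddir_mul (d (hQ i)) (d (hP j)),
    ddir_sum _ (fun k _ => d (ContDiffOn.sum fun l _ => hterm k l))]
  simp only [ddir_sum _ (fun l _ => d (hterm _ l)),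
    ddir_mul_of_zero hU (G.h_smooth _ _) (hF i _) (hF j _) ht (N.fc_self i _) (N.fc_self j _)]
  simp [proj, dp, dq]

theorem jet₂_tt (hU : IsOpen U) (ht : t ∈ U) (n m i j : Fin 2) :
    N.jet₂ t (inl n) (inl m) (inl i) (inl j)
      = (1 / 2) * (N.ddp t n m i * N.qc t j t + N.dp t m i * N.dq t n j
          + N.dp t n i * N.dq t m j + N.pc t i t * N.ddq t n m j
        + (N.ddq t n m i * N.pc t j t + N.dq t m i * N.dp t n j
          + N.dq t n i * N.dp t m j + N.qc t i t * N.ddp t n m j))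
        + ∑ k, ∑ l, G.h t k l * (N.df t m i k * N.df t n j l + N.df t n i k * N.df t m j l) := by
  have hP := N.smoothOn_pc t
  have hQ := N.smoothOn_qc t
  have hF := N.smoothOn_fc t
  have hterm := fun k l => (G.h_smooth k l).mul ((hF i k).mul (hF j l))
  have hc : ∀ s ∈ U, ddir (N.proj t (inl m)) (fun s => N.conj t s (inl i) (inl j)) s
      = ddir (N.proj t (inl m)) (fun s => (1 / 2) * (N.pc t i s * N.qc t j s
        + N.qc t i s * N.pc t j s)
        + ∑ k, ∑ l, G.h s k l * (N.fc t i k s * N.fc t j l s)) s :=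
    fun s hs => ddir_congr hU (fun s hs => N.conj_tt hs t i j) hs
  rw [jet₂, ddir_congr hU hc ht,
    ddir_ddir_add hU (contDiffOn_const.mul (((hP i).mul (hQ j)).add ((hQ i).mul (hP j))))
      (ContDiffOn.sum fun k _ => ContDiffOn.sum fun l _ => hterm k l) ht,
    ddir_ddir_const_mul hU (((hP i).mul (hQ j)).add ((hQ i).mul (hP j))) ht,
    ddir_ddir_add hU ((hP i).mul (hQ j)) ((hQ i).mul (hP j)) ht,
    ddir_ddir_mul hU (hP i) (hQ j) ht, ddir_ddir_mul hU (hQ i) (hP j) ht,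
    ddir_ddir_sum hU (fun k => ContDiffOn.sum fun l _ => hterm k l) ht]
  simp only [ddir_ddir_sum hU (fun l => hterm _ l) ht,
    ddir_ddir_mul_of_zero hU (G.h_smooth _ _) (hF i _) (hF j _) ht (N.fc_self i _) (N.fc_self j _)]
  rfl

theorem jet₁_tz (hU : IsOpen U) (ht : t ∈ U) (m i k : Fin 2) :
    N.jet₁ t (inl m) (inl i) (inr k) = ∑ l, G.h t l k * N.df t m i l := by
  have d : ∀ {X : Orbit → ℝ}, ContDiffOn ℝ ∞ X U → DifferentiableAt ℝ X t :=
    fun hX => differentiableAt_of_smoothOn hU hX ht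
  have hF := N.smoothOn_fc t
  rw [jet₁, ddir_congr hU (fun s hs => N.conj_tz s t i k) ht,
    ddir_sum _ (fun l _ => d ((G.h_smooth l k).mul (hF i l)))]
  refine Finset.sum_congr rfl fun l _ => ?_
  rw [ddir_mul (d (G.h_smooth l k)) (d (hF i l)), fc_self]
  simp [df, proj]

theorem jet₁_zt (hU : IsOpen U) (ht : t ∈ U) (m i k : Fin 2) :
    N.jet₁ t (inl m) (inr k) (inl i) = ∑ l, G.h t k l * N.df t m i l := by
  have d : ∀ {X : Orbit → ℝ}, ContDiffOn ℝ ∞ X U → DifferentiableAt ℝ X t :=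
    fun hX => differentiableAt_of_smoothOn hU hX ht
  have hF := N.smoothOn_fc t
  rw [jet₁, ddir_congr hU (fun s hs => N.conj_zt s t i k) ht,
    ddir_sum _ (fun l _ => d ((G.h_smooth k l).mul (hF i l)))]
  refine Finset.sum_congr rfl fun l _ => ?_
  rw [ddir_mul (d (G.h_smooth k l)) (d (hF i l)), fc_self]
  simp [df, proj]

theorem jet₁_zz (m k l : Fin 2) : N.jet₁ t (inl m) (inr k) (inr l) = N.dh t m k l := by
  simp only [jet₁, conj_zz]; rfl

theorem jet₂_zz (n m k l : Fin 2) :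
    N.jet₂ t (inl n) (inl m) (inr k) (inr l) = N.ddh t n m k l := by
  simp only [jet₂, conj_zz]; rfl

end NullFrame

/-! ### The determinant of the leaf metric and derivatives along the moving null frame -/

theorem Coeffs.h10 {U : Set Orbit} (G : Coeffs U) {t : Orbit} (ht : t ∈ U) :
    G.h t 1 0 = G.h t 0 1 := (G.h_symm t ht).apply 0 1

/-- The determinant of the metric of the Killing leaves. -/
def Coeffs.τ {U : Set Orbit} (G : Coeffs U) (t : Orbit) : ℝ := (G.h t).det

theorem Coeffs.τ_eq {U : Set Orbit} (G : Coeffs U) {t : Orbit} (ht : t ∈ U) :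
    G.τ t = G.h t 0 0 * G.h t 1 1 - G.h t 0 1 * G.h t 0 1 := by
  rw [Coeffs.τ, Matrix.det_fin_two, G.h10 ht]

theorem Coeffs.h_inv {U : Set Orbit} (G : Coeffs U) {t : Orbit} (ht : t ∈ U) :
    (G.h t)⁻¹ 0 0 = G.h t 1 1 / G.τ t ∧ (G.h t)⁻¹ 0 1 = -G.h t 0 1 / G.τ t ∧
      (G.h t)⁻¹ 1 0 = -G.h t 0 1 / G.τ t ∧ (G.h t)⁻¹ 1 1 = G.h t 0 0 / G.τ t := by
  simp only [Matrix.inv_def, Matrix.adjugate_fin_two, Ring.inverse_eq_inv', Coeffs.τ,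
    Matrix.smul_apply, smul_eq_mul, Matrix.of_apply, Matrix.cons_val', Matrix.cons_val_zero,
    Matrix.cons_val_one, Matrix.cons_val_fin_one, G.h10 ht]
  refine ⟨?_, ?_, ?_, ?_⟩ <;> ring

theorem smoothOn_τ {U : Set Orbit} (G : Coeffs U) : ContDiffOn ℝ ∞ G.τ U :=
  smoothOn_det G.h_smooth

/-- The extra term is the derivative of the moving vector field `e`; it converts second derivatives
along the null frame into those along the constant frame frozen at `t`. -/
theorem ddir_ddir_field {U : Set Orbit} (hU : IsOpen U) {t : Orbit} (ht : t ∈ U)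
    {F : Orbit → ℝ} (hF : ContDiffOn ℝ ∞ F U) {e : Orbit → Orbit}
    (he : ∀ i, ContDiffOn ℝ ∞ (fun s => e s i) U) (v : Orbit) :
    ddir v (fun s => ddir (e s) F s) t
      = ddir v (ddir (e t) F) t + ddir (fun i => ddir v (fun s => e s i) t) F t := by
  have d : ∀ {X : Orbit → ℝ}, ContDiffOn ℝ ∞ X U → DifferentiableAt ℝ X t :=
    fun hX => differentiableAt_of_smoothOn hU hX ht
  have h0 := smoothOn_pd hU hF 0
  have h1 := smoothOn_pd hU hF 1
  have e1 : (fun s => ddir (e s) F s) = fun s => e s 0 * pd 0 F s + e s 1 * pd 1 F s :=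
    funext fun s => ddir_eq_pd
  have e2 : ddir (e t) F = fun s => e t 0 * pd 0 F s + e t 1 * pd 1 F s :=
    funext fun s => ddir_eq_pd
  rw [e1, e2, ddir_add (d ((he 0).mul h0)) (d ((he 1).mul h1)), ddir_mul (d (he 0)) (d h0),
    ddir_mul (d (he 1)) (d h1),
    ddir_add (d (contDiffOn_const.mul h0)) (d (contDiffOn_const.mul h1)),
    ddir_const_mul (d h0), ddir_const_mul (d h1), ddir_eq_pd (v := fun i => ddir v (fun s => e s i) t)]
  ring

namespace NullFrame

variable {U : Set Orbit} {G : Coeffs U} (N : NullFrame G) {t : Orbit}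

theorem smoothOn_d₁ (hU : IsOpen U) {F : Orbit → ℝ} (hF : ContDiffOn ℝ ∞ F U) :
    ContDiffOn ℝ ∞ (fun t => ddir (N.e₁ t) F t) U := by
  simp only [ddir_eq_pd]
  exact ((N.smoothOn_e₁ 0).mul (smoothOn_pd hU hF 0)).add
    ((N.smoothOn_e₁ 1).mul (smoothOn_pd hU hF 1))

theorem vec_eq (ht : t ∈ U) (w : Orbit) (i : Fin 2) :
    w i = (N.p t 0 * w 0 + N.p t 1 * w 1) * N.e₁ t i
      + (N.q t 0 * w 0 + N.q t 1 * w 1) * N.e₂ t i := by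
  have h : N.vol t ≠ 0 := N.vol_ne t ht
  fin_cases i
  · simp [e₁, e₂]; field_simp; rw [vol]; ring
  · simp [e₁, e₂]; field_simp; rw [vol]; ring

theorem ddir_vec (ht : t ∈ U) (w : Orbit) (F : Orbit → ℝ) :
    ddir w F t = (N.p t 0 * w 0 + N.p t 1 * w 1) * ddir (N.basis t 0) F t
      + (N.q t 0 * w 0 + N.q t 1 * w 1) * ddir (N.basis t 1) F t := by
  simp only [basis, Matrix.cons_val_zero, Matrix.cons_val_one]
  rw [ddir_eq_pd, ddir_eq_pd (v := N.e₁ t), ddir_eq_pd (v := N.e₂ t)]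
  linear_combination pd 0 F t * N.vec_eq ht w 0 + pd 1 F t * N.vec_eq ht w 1

/-- Differentiating the contraction of a coframe element with a frame element. -/
theorem contract_ddir (hU : IsOpen U) (ht : t ∈ U) {p e : Orbit → Fin 2 → ℝ}
    (hp : ∀ i, ContDiffOn ℝ ∞ (fun s => p s i) U) (he : ∀ i, ContDiffOn ℝ ∞ (fun s => e s i) U)
    {c : ℝ} (hc : ∀ s ∈ U, p s 0 * e s 0 + p s 1 * e s 1 = c) (v : Orbit) :
    p t 0 * ddir v (fun s => e s 0) t + p t 1 * ddir v (fun s => e s 1) t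
      = -ddir v (fun s => p s 0 * e t 0 + p s 1 * e t 1) t := by
  have d : ∀ {X : Orbit → ℝ}, ContDiffOn ℝ ∞ X U → DifferentiableAt ℝ X t :=
    fun hX => differentiableAt_of_smoothOn hU hX ht
  have h0 : ddir v (fun s => p s 0 * e s 0 + p s 1 * e s 1) t = 0 := by
    rw [ddir_congr hU hc ht, ddir_const]
  have cc : ∀ c : ℝ, ContDiffOn ℝ ∞ (fun _ : Orbit => c) U := fun c => contDiffOn_const
  rw [ddir_add (d ((hp 0).mul (he 0))) (d ((hp 1).mul (he 1))), ddir_mul (d (hp 0)) (d (he 0)),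
    ddir_mul (d (hp 1)) (d (he 1))] at h0
  rw [ddir_add (d ((hp 0).mul (cc _))) (d ((hp 1).mul (cc _))), ddir_mul (d (hp 0)) (d (cc _)),
    ddir_mul (d (hp 1)) (d (cc _)), ddir_const, ddir_const]
  linarith

/-- Differentiating the duality relations p(e₁) = 1 and q(e₁) = 0 shows that the derivative of e₁
has the components `-dp`, `-dq` in the null frame; this is the correction to the second derivative
in the frozen frame. -/
theorem d₁_deriv (hU : IsOpen U) (ht : t ∈ U) {F : Orbit → ℝ} (hF : ContDiffOn ℝ ∞ F U)
    (m : Fin 2) :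
    ddir (N.basis t m) (fun s => ddir (N.e₁ s) F s) t
      = ddir (N.basis t m) (ddir (N.basis t 0) F) t
        - N.dp t m 0 * ddir (N.basis t 0) F t - N.dq t m 0 * ddir (N.basis t 1) F t := by
  rw [ddir_ddir_field hU ht hF N.smoothOn_e₁,
    N.ddir_vec ht (fun i => ddir (N.basis t m) (fun s => N.e₁ s i) t),
    contract_ddir hU ht N.p_smooth N.smoothOn_e₁ (fun s hs => N.p_e₁ hs),
    contract_ddir hU ht N.q_smooth N.smoothOn_e₁ (fun s hs => N.q_e₁)]
  change _ + (-N.dp t m 0 * _ + -N.dq t m 0 * _) = _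
  rw [show N.e₁ t = N.basis t 0 from rfl]
  ring

theorem d₂_deriv (hU : IsOpen U) (ht : t ∈ U) {F : Orbit → ℝ} (hF : ContDiffOn ℝ ∞ F U)
    (m : Fin 2) :
    ddir (N.basis t m) (fun s => ddir (N.e₂ s) F s) t
      = ddir (N.basis t m) (ddir (N.basis t 1) F) t
        - N.dp t m 1 * ddir (N.basis t 0) F t - N.dq t m 1 * ddir (N.basis t 1) F t := by
  rw [ddir_ddir_field hU ht hF N.smoothOn_e₂,
    N.ddir_vec ht (fun i => ddir (N.basis t m) (fun s => N.e₂ s i) t),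
    contract_ddir hU ht N.p_smooth N.smoothOn_e₂ (fun s hs => N.p_e₂),
    contract_ddir hU ht N.q_smooth N.smoothOn_e₂ (fun s hs => N.q_e₂ hs)]
  change _ + (-N.dp t m 1 * _ + -N.dq t m 1 * _) = _
  rw [show N.e₂ t = N.basis t 1 from rfl]
  ring

theorem curl_const {p : Orbit → Fin 2 → ℝ} {s : Orbit}
    (hp : ∀ i, DifferentiableAt ℝ (fun s => p s i) s) (v w : Orbit) :
    ddir w (fun s => p s 0 * v 0 + p s 1 * v 1) s - ddir v (fun s => p s 0 * w 0 + p s 1 * w 1) s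
      = -(pd 0 (fun s => p s 1) s - pd 1 (fun s => p s 0) s) * (v 0 * w 1 - w 0 * v 1) := by
  have cc : ∀ c : ℝ, DifferentiableAt ℝ (fun _ : Orbit => c) s := fun c => differentiableAt_const c
  rw [ddir_add ((hp 0).fun_mul (cc _)) ((hp 1).fun_mul (cc _)),
    ddir_add ((hp 0).fun_mul (cc _)) ((hp 1).fun_mul (cc _)), ddir_mul (hp 0) (cc _),
    ddir_mul (hp 1) (cc _), ddir_mul (hp 0) (cc _), ddir_mul (hp 1) (cc _)]
  simp only [ddir_const]
  simp only [ddir_eq_pd (v := v), ddir_eq_pd (v := w)]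
  ring

/-- The structure equation dq = -a p ∧ q evaluated on the constant vectors frozen at `t`. It holds
at every `s`, not only at `t`, so that it can be differentiated to give `ddir_a`. -/
theorem a_mul (hU : IsOpen U) (t : Orbit) {s : Orbit} (hs : s ∈ U) :
    N.a s * (N.pc t 0 s * N.qc t 1 s - N.pc t 1 s * N.qc t 0 s)
      = ddir (N.basis t 1) (N.qc t 0) s - ddir (N.basis t 0) (N.qc t 1) s := by
  have h : N.vol s ≠ 0 := N.vol_ne s hs
  have h1 : N.pc t 0 s * N.qc t 1 s - N.pc t 1 s * N.qc t 0 s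
      = N.vol s * (N.basis t 0 0 * N.basis t 1 1 - N.basis t 1 0 * N.basis t 0 1) := by
    simp only [pc, qc, vol]; ring
  unfold qc at *
  rw [curl_const (fun i => differentiableAt_of_smoothOn hU (N.q_smooth i) hs), h1, a]
  field_simp

theorem b_mul (hU : IsOpen U) (t : Orbit) {s : Orbit} (hs : s ∈ U) :
    N.b s * (N.pc t 0 s * N.qc t 1 s - N.pc t 1 s * N.qc t 0 s)
      = ddir (N.basis t 1) (N.pc t 0) s - ddir (N.basis t 0) (N.pc t 1) s := by
  have h : N.vol s ≠ 0 := N.vol_ne s hs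
  have h1 : N.pc t 0 s * N.qc t 1 s - N.pc t 1 s * N.qc t 0 s
      = N.vol s * (N.basis t 0 0 * N.basis t 1 1 - N.basis t 1 0 * N.basis t 0 1) := by
    simp only [pc, qc, vol]; ring
  unfold pc at *
  rw [curl_const (fun i => differentiableAt_of_smoothOn hU (N.p_smooth i) hs), h1, b]
  field_simp

theorem a_eq (hU : IsOpen U) (ht : t ∈ U) : N.a t = N.dq t 1 0 - N.dq t 0 1 := by
  have := N.a_mul hU t ht
  rwa [N.pc_zero ht, N.pc_one, N.qc_zero, N.qc_one ht, mul_zero, sub_zero, mul_one, mul_one]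
    at this

theorem b_eq (hU : IsOpen U) (ht : t ∈ U) : N.b t = N.dp t 1 0 - N.dp t 0 1 := by
  have := N.b_mul hU t ht
  rwa [N.pc_zero ht, N.pc_one, N.qc_zero, N.qc_one ht, mul_zero, sub_zero, mul_one, mul_one]
    at this

theorem ddir_vol (hU : IsOpen U) (ht : t ∈ U) (m : Fin 2) :
    ddir (N.basis t m) (fun s => N.pc t 0 s * N.qc t 1 s - N.pc t 1 s * N.qc t 0 s) t
      = N.dp t m 0 + N.dq t m 1 := by
  have d : ∀ {X : Orbit → ℝ}, ContDiffOn ℝ ∞ X U → DifferentiableAt ℝ X t :=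
    fun hX => differentiableAt_of_smoothOn hU hX ht
  have hP := N.smoothOn_pc t
  have hQ := N.smoothOn_qc t
  rw [ddir_sub (d ((hP 0).mul (hQ 1))) (d ((hP 1).mul (hQ 0))), ddir_mul (d (hP 0)) (d (hQ 1)),
    ddir_mul (d (hP 1)) (d (hQ 0)), N.pc_zero ht, N.pc_one, N.qc_zero, N.qc_one ht]
  simp [dp, dq]

theorem ddir_a (hU : IsOpen U) (ht : t ∈ U) :
    ddir (N.basis t 1) N.a t
      = N.ddq t 1 1 0 - N.ddq t 1 0 1 - N.a t * (N.dp t 1 0 + N.dq t 1 1) := by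
  have d : ∀ {X : Orbit → ℝ}, ContDiffOn ℝ ∞ X U → DifferentiableAt ℝ X t :=
    fun hX => differentiableAt_of_smoothOn hU hX ht
  have hP := N.smoothOn_pc t
  have hQ := N.smoothOn_qc t
  have h := ddir_congr (v := N.basis t 1) hU (fun s hs => N.a_mul hU t hs) ht
  rw [ddir_mul (d (N.smoothOn_a hU)) (d (((hP 0).mul (hQ 1)).sub ((hP 1).mul (hQ 0)))),
    N.ddir_vol hU ht, N.pc_zero ht, N.pc_one, N.qc_zero, N.qc_one ht,
    ddir_sub (d (smoothOn_ddir hU (hQ 0) _)) (d (smoothOn_ddir hU (hQ 1) _))] at h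
  simp only [ddq]
  linarith

theorem ddir_b (hU : IsOpen U) (ht : t ∈ U) :
    ddir (N.basis t 0) N.b t
      = N.ddp t 0 1 0 - N.ddp t 0 0 1 - N.b t * (N.dp t 0 0 + N.dq t 0 1) := by
  have d : ∀ {X : Orbit → ℝ}, ContDiffOn ℝ ∞ X U → DifferentiableAt ℝ X t :=
    fun hX => differentiableAt_of_smoothOn hU hX ht
  have hP := N.smoothOn_pc t
  have hQ := N.smoothOn_qc t
  have h := ddir_congr (v := N.basis t 0) hU (fun s hs => N.b_mul hU t hs) ht
  rw [ddir_mul (d (N.smoothOn_b hU)) (d (((hP 0).mul (hQ 1)).sub ((hP 1).mul (hQ 0)))),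
    N.ddir_vol hU ht, N.pc_zero ht, N.pc_one, N.qc_zero, N.qc_one ht,
    ddir_sub (d (smoothOn_ddir hU (hP 0) _)) (d (smoothOn_ddir hU (hP 1) _))] at h
  simp only [ddp]
  linarith

/-- The exterior derivative of the connection form. -/
theorem curl_conn (hU : IsOpen U) (ht : t ∈ U) :
    pd 0 (fun s => N.conn s 1) t - pd 1 (fun s => N.conn s 0) t
      = N.vol t * (ddir (N.basis t 0) N.b t - ddir (N.basis t 1) N.a t - 2 * N.a t * N.b t) := by
  have h : N.vol t ≠ 0 := N.vol_ne t ht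
  have d : ∀ {X : Orbit → ℝ}, ContDiffOn ℝ ∞ X U → DifferentiableAt ℝ X t :=
    fun hX => differentiableAt_of_smoothOn hU hX ht
  have hc : ∀ i j, pd j (fun s => N.conn s i) t
      = pd j N.a t * N.p t i + N.a t * pd j (fun s => N.p s i) t
        + (pd j N.b t * N.q t i + N.b t * pd j (fun s => N.q s i) t) := by
    intro i j
    change ddir _ (fun s => N.a s * N.p s i + N.b s * N.q s i) t = _
    rw [ddir_add (d ((N.smoothOn_a hU).mul (N.p_smooth i))) (d ((N.smoothOn_b hU).mul (N.q_smooth i))),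
      ddir_mul (d (N.smoothOn_a hU)) (d (N.p_smooth i)),
      ddir_mul (d (N.smoothOn_b hU)) (d (N.q_smooth i))]
    rfl
  have ha : N.a t * N.vol t = -(pd 0 (fun s => N.q s 1) t - pd 1 (fun s => N.q s 0) t) := by
    rw [a]; field_simp
  have hb : N.b t * N.vol t = -(pd 0 (fun s => N.p s 1) t - pd 1 (fun s => N.p s 0) t) := by
    rw [b]; field_simp
  rw [hc, hc, ddir_eq_pd, ddir_eq_pd]
  simp only [basis, e₁, e₂, Matrix.cons_val_zero, Matrix.cons_val_one]
  field_simp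
  -- This is d(a p + b q) = da ∧ p + db ∧ q + a dp + b dq with dp = -b p ∧ q and dq = -a p ∧ q; the
  -- last two terms account for -2ab.
  linear_combination N.a t * hb + N.b t * ha

end NullFrame

namespace NullFrame

variable {U : Set Orbit} {G : Coeffs U} (N : NullFrame G) {t : Orbit}

/-! ### The field equations in a null frame -/

theorem dh10 (hU : IsOpen U) (ht : t ∈ U) (m : Fin 2) : N.dh t m 1 0 = N.dh t m 0 1 :=
  ddir_congr hU (fun _ hs => G.h10 hs) ht

theorem ddh10 (hU : IsOpen U) (ht : t ∈ U) (n m : Fin 2) : N.ddh t n m 1 0 = N.ddh t n m 0 1 :=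
  ddir_congr hU (fun _ hs => ddir_congr hU (fun _ hs => G.h10 hs) hs) ht

theorem adaptedJet (hU : IsOpen U) (ht : t ∈ U) :
    AdaptedJet (N.conj t t)⁻¹ (N.jet₁ t) (N.jet₂ t) (fun k l => (G.h t)⁻¹ k l)
      (fun m i j => N.jet₁ t (inl m) (inl i) (inl j)) (fun m i k => ∑ l, G.h t k l * N.df t m i l)
      (N.dh t) where
  K00 := by rw [N.inv_conj_self ht]; simp
  K01 := by rw [N.inv_conj_self ht]; simp
  K10 := by rw [N.inv_conj_self ht]; simp
  K11 := by rw [N.inv_conj_self ht]; simp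
  Ktz i k := by rw [N.inv_conj_self ht]; simp
  Kzt i k := by rw [N.inv_conj_self ht]; simp
  Kzz k l := by rw [N.inv_conj_self ht]; simp
  η10 := by rw [(G.h_inv ht).2.1, (G.h_inv ht).2.2.1]
  g1z k a b := by simp [jet₁, proj, ddir_zero]
  g1tt m i j := rfl
  A10 m := by rw [N.jet₁_tt hU ht, N.jet₁_tt hU ht]; ring
  g1tz m i k := by
    rw [N.jet₁_tz hU ht]
    exact Finset.sum_congr rfl fun l _ => by rw [(G.h_symm t ht).apply]
  g1zt m i k := N.jet₁_zt hU ht m i k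
  g1zz m k l := N.jet₁_zz m k l
  H10 m := N.dh10 hU ht m
  g2z k c a b := by simp [jet₂, proj, ddir_zero]
  g2z' k c a b := by
    have : (ddir (N.proj t (inr k)) fun s => N.conj t s a b) = fun _ => 0 :=
      funext fun s => by simp [proj, ddir_zero]
    rw [jet₂, this, ddir_const]

theorem ddir_τ (hU : IsOpen U) (ht : t ∈ U) (v : Orbit) :
    ddir v G.τ t = ddir v (fun s => G.h s 0 0) t * G.h t 1 1
      + G.h t 0 0 * ddir v (fun s => G.h s 1 1) t
      - 2 * G.h t 0 1 * ddir v (fun s => G.h s 0 1) t := by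
  have d : ∀ {X : Orbit → ℝ}, ContDiffOn ℝ ∞ X U → DifferentiableAt ℝ X t :=
    fun hX => differentiableAt_of_smoothOn hU hX ht
  have h := G.h_smooth
  rw [ddir_congr hU (fun s hs => G.τ_eq hs) ht,
    ddir_sub (d ((h 0 0).mul (h 1 1))) (d ((h 0 1).mul (h 0 1))), ddir_mul (d (h 0 0)) (d (h 1 1)),
    ddir_mul (d (h 0 1)) (d (h 0 1))]
  ring

theorem ddir_ddir_τ (hU : IsOpen U) (ht : t ∈ U) (v : Orbit) :
    ddir v (ddir v G.τ) t = ddir v (ddir v fun s => G.h s 0 0) t * G.h t 1 1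
      + 2 * ddir v (fun s => G.h s 0 0) t * ddir v (fun s => G.h s 1 1) t
      + G.h t 0 0 * ddir v (ddir v fun s => G.h s 1 1) t
      - 2 * ddir v (fun s => G.h s 0 1) t ^ 2
      - 2 * G.h t 0 1 * ddir v (ddir v fun s => G.h s 0 1) t := by
  have h := G.h_smooth
  have hc : ∀ s ∈ U, G.τ s = G.h s 0 0 * G.h s 1 1 + (-1) * (G.h s 0 1 * G.h s 0 1) :=
    fun s hs => by rw [G.τ_eq hs]; ring
  have hm := (h 0 1).mul (h 0 1)
  rw [ddir_congr hU (fun s hs => ddir_congr hU hc hs) ht,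
    ddir_ddir_add hU ((h 0 0).mul (h 1 1)) (contDiffOn_const.mul hm) ht,
    ddir_ddir_const_mul hU hm ht, ddir_ddir_mul hU (h 0 0) (h 1 1) ht,
    ddir_ddir_mul hU (h 0 1) (h 0 1) ht]
  ring

/-- The field equation `Ric(e₁, e₁) = 0`. -/
theorem ricci_e₁_e₁ (hU : IsOpen U) {Λ : ℝ} (hvac : IsLambdaVacuum G.metric Λ (cyl U))
    (ht : t ∈ U) :
    2 * G.τ t * ddir (N.e₁ t) (fun s => ddir (N.e₁ s) G.τ s) t - ddir (N.e₁ t) G.τ t ^ 2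
      + 2 * N.a t * G.τ t * ddir (N.e₁ t) G.τ t
      - 2 * G.τ t * (ddir (N.e₁ t) (fun s => G.h s 0 0) t * ddir (N.e₁ t) (fun s => G.h s 1 1) t
        - ddir (N.e₁ t) (fun s => G.h s 0 1) t ^ 2) = 0 := by
  have hτ : G.τ t ≠ 0 := G.h_det t ht
  have hR := N.jetRic_eq hU hvac ht (inl 0) (inl 0)
  have hr : N.conj t t (inl 0) (inl 0) = 0 := by rw [N.conj_self ht]; simp
  have hc : N.jet₂ t (inl 1) (inl 0) (inl 0) (inl 0) = N.jet₂ t (inl 0) (inl 1) (inl 0) (inl 0) :=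
    ddir_comm hU (N.smoothOn_conj t _ _) ht
  have hs : N.jet₂ t (inl 0) (inl 0) (inr 1) (inr 0) = N.jet₂ t (inl 0) (inl 0) (inr 0) (inr 1) := by
    rw [N.jet₂_zz, N.jet₂_zz, N.ddh10 hU ht]
  rw [(N.adaptedJet hU ht).ric_00 hc hs, hr, mul_zero] at hR
  simp only [N.jet₁_tt hU ht, N.jet₂_zz, N.pc_zero ht, N.pc_one, N.qc_zero, N.qc_one ht,
    (G.h_inv ht).1, (G.h_inv ht).2.1, (G.h_inv ht).2.2.2] at hR
  rw [show N.e₁ t = N.basis t 0 from rfl, N.d₁_deriv hU ht (smoothOn_τ G), N.a_eq hU ht,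
    ddir_ddir_τ hU ht, ddir_τ hU ht, ddir_τ hU ht]
  have e1 : ∀ m k l, ddir (N.basis t m) (fun s => G.h s k l) t = N.dh t m k l := fun _ _ _ => rfl
  have e2 : ∀ n m k l, ddir (N.basis t n) (ddir (N.basis t m) fun s => G.h s k l) t
    = N.ddh t n m k l := fun _ _ _ _ => rfl
  simp only [e1, e2]
  have hdet := G.τ_eq ht
  -- Denominators are cleared while τ is still an atom; only afterwards is τ replaced by the
  -- quadratic expression in h.
  field_simp at hR
  generalize G.τ t = τ at *
  subst hdet
  linear_combination (-1 / 4 : ℝ) * hR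

/-- If `h` is constant along `e₂`, the field equations imply that `Λ` and the curvature of `f`
vanish and that the orbit metric is flat. -/
theorem flat_of_const_e₂ (hU : IsOpen U) {Λ : ℝ} (hvac : IsLambdaVacuum G.metric Λ (cyl U))
    (hh : ∀ s ∈ U, ∀ k l, ddir (N.e₂ s) (fun s => G.h s k l) s = 0) (ht : t ∈ U) :
    Λ = 0 ∧ (∀ k, pd 0 (fun s => G.f s 1 k) t - pd 1 (fun s => G.f s 0 k) t = 0) ∧
      pd 0 (fun s => N.conn s 1) t - pd 1 (fun s => N.conn s 0) t = 0 := by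
  have hvol : N.vol t ≠ 0 := N.vol_ne t ht
  have J := N.adaptedJet hU ht
  have hH : ∀ k l, N.dh t 1 k l = 0 := hh t ht
  have hA : N.jet₁ t (inl 0) (inl 1) (inl 1) = N.dp t 0 1 := by
    rw [N.jet₁_tt hU ht, N.pc_one, N.qc_one ht]; ring
  have h01 : ∀ k l, N.jet₂ t (inl 0) (inl 1) (inr k) (inr l)
      = N.jet₁ t (inl 0) (inl 1) (inl 1) * N.dh t 0 k l := by
    intro k l
    -- The relation e₂(h) = 0 holds on all of U, so it may be differentiated along e₁.
    have h1 := N.d₂_deriv hU ht (G.h_smooth k l) 0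
    rw [ddir_congr hU (fun s hs => hh s hs k l) ht, ddir_const] at h1
    have h2 : N.ddh t 0 1 k l - N.dp t 0 1 * N.dh t 0 k l - N.dq t 0 1 * N.dh t 1 k l = 0 := h1.symm
    rw [N.jet₂_zz, hA]
    rw [hH] at h2
    linarith
  have h10 : ∀ k l, N.jet₂ t (inl 1) (inl 0) (inr k) (inr l)
      = N.jet₁ t (inl 0) (inl 1) (inl 1) * N.dh t 0 k l := fun k l =>
    (ddir_comm hU (N.smoothOn_conj t _ _) ht).trans (h01 k l)
  have hV : ∀ k l, Λ * G.h t k l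
      = -2 * (∑ m, G.h t k m * (N.df t 0 1 m - N.df t 1 0 m))
        * (∑ m, G.h t l m * (N.df t 0 1 m - N.df t 1 0 m)) := by
    intro k l
    have h1 := N.jetRic_eq hU hvac ht (inr k) (inr l)
    rw [J.ric_zz hH h01 h10, N.conj_zz] at h1
    simp only [mul_sub, Finset.sum_sub_distrib]
    rw [← h1]; ring
  have hτ := G.h_det t ht
  rw [Matrix.det_fin_two] at hτ
  have hΛ : Λ = 0 := by
    -- Taking determinants in Λ h = -2 F Fᵀ: the right side has rank at most one, so Λ² det h = 0.
    have h1 : Λ ^ 2 * (G.h t 0 0 * G.h t 1 1 - G.h t 0 1 * G.h t 1 0) = 0 := by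
      linear_combination (Λ * G.h t 1 1) * hV 0 0 - (Λ * G.h t 1 0) * hV 0 1
        + (-2 * (∑ m, G.h t 0 m * (N.df t 0 1 m - N.df t 1 0 m))
          * (∑ m, G.h t 0 m * (N.df t 0 1 m - N.df t 1 0 m))) * hV 1 1
        - (-2 * (∑ m, G.h t 0 m * (N.df t 0 1 m - N.df t 1 0 m))
        * (∑ m, G.h t 1 m * (N.df t 0 1 m - N.df t 1 0 m))) * hV 1 0
    simpa [hτ] using h1
  have hF : ∀ k, ∑ m, G.h t k m * (N.df t 0 1 m - N.df t 1 0 m) = 0 := fun k => by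
    have h1 := hV k k
    rw [hΛ, zero_mul] at h1
    nlinarith [h1]
  have hdf : ∀ k, N.df t 0 1 k - N.df t 1 0 k = 0 := by
    have h0 := hF 0
    have h1 := hF 1
    simp only [Fin.sum_univ_two] at h0 h1
    have k0 : (G.h t 0 0 * G.h t 1 1 - G.h t 0 1 * G.h t 1 0)
        * (N.df t 0 1 0 - N.df t 1 0 0) = 0 := by
      linear_combination G.h t 1 1 * h0 - G.h t 0 1 * h1
    have k1 : (G.h t 0 0 * G.h t 1 1 - G.h t 0 1 * G.h t 1 0)
        * (N.df t 0 1 1 - N.df t 1 0 1) = 0 := by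
      linear_combination G.h t 0 0 * h1 - G.h t 1 0 * h0
    rw [Fin.forall_fin_two]
    exact ⟨(mul_eq_zero.1 k0).resolve_left hτ, (mul_eq_zero.1 k1).resolve_left hτ⟩
  refine ⟨hΛ, fun k => ?_, ?_⟩
  -- Back from the frozen frame to coordinates: subtracting the constant f(t) does not change the
  -- curl, and evaluation on the two frame vectors contributes the factor 1 / vol.
  · have h1 := curl_const (p := fun s i => G.f s i k - G.f t i k) (s := t)
      (fun i => differentiableAt_of_smoothOn hU ((G.f_smooth i k).sub contDiffOn_const) ht)
      (N.basis t 0) (N.basis t 1)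
    rw [N.basis_wedge ht] at h1
    have h2 : ∀ i j, pd j (fun s => G.f s i k - G.f t i k) t = pd j (fun s => G.f s i k) t :=
      fun i j => by
        unfold pd; rw [fderiv_sub_const]
    rw [h2, h2] at h1
    have h3 : N.df t 1 0 k - N.df t 0 1 k = -(pd 0 (fun s => G.f s 1 k) t
        - pd 1 (fun s => G.f s 0 k) t) * (1 / N.vol t) := h1
    have h4 : N.df t 1 0 k - N.df t 0 1 k = 0 := by linarith [hdf k]
    rw [h4] at h3
    field_simp at h3
    linarith
  · have h1 := N.jetRic_eq hU hvac ht (inl 0) (inl 1)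
    have hB : ∀ k, ∑ l, G.h t k l * N.df t 1 0 l = ∑ l, G.h t k l * N.df t 0 1 l := fun k =>
      Finset.sum_congr rfl fun l _ => by rw [sub_eq_zero.1 (hdf l)]
    have hc : ∀ i j, N.jet₂ t (inl 1) (inl 0) (inl i) (inl j)
        = N.jet₂ t (inl 0) (inl 1) (inl i) (inl j) := fun i j =>
      ddir_comm hU (N.smoothOn_conj t _ _) ht
    have hs : N.jet₂ t (inl 0) (inl 1) (inl 1) (inl 0) = N.jet₂ t (inl 0) (inl 1) (inl 0) (inl 1) := by
      rw [N.jet₂_tt hU ht, N.jet₂_tt hU ht]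
      simp only [Fin.sum_univ_two, G.h10 ht]
      ring
    rw [J.ric_01 hH hB h10 hc hs, hΛ, zero_mul] at h1
    have d01 := fun l => sub_eq_zero.1 (hdf l)
    have c2 : ∀ i, N.ddq t 1 0 i = N.ddq t 0 1 i := fun i => ddir_comm hU (N.smoothOn_qc t i) ht
    simp only [N.jet₁_tt hU ht, N.jet₂_tt hU ht, N.pc_zero ht, N.pc_one, N.qc_zero, N.qc_one ht,
      (G.h_inv ht).1, (G.h_inv ht).2.1, (G.h_inv ht).2.2.2, Fin.sum_univ_two, G.h10 ht, d01]
      at h1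
    rw [N.curl_conn hU ht, N.ddir_a hU ht, N.ddir_b hU ht, N.a_eq hU ht, N.b_eq hU ht, c2]
    refine mul_eq_zero_of_right _ ?_
    have hτ' : G.τ t ≠ 0 := G.h_det t ht
    have hdet := G.τ_eq ht
    field_simp at h1
    generalize G.τ t = τ at *
    subst hdet
    -- The curvature expression is multiplied by det h to match the field equation after its
    -- denominators have been cleared.
    refine (mul_eq_zero.1 (?_ : (G.h t 0 0 * G.h t 1 1 - G.h t 0 1 * G.h t 0 1) * _ = 0)).resolve_left
      hτ'
    linear_combination (-1 / 4 : ℝ) * h1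

end NullFrame

/-! ### Restriction to smaller open sets -/

/-- The restriction of the coefficients to a smaller set. -/
def Coeffs.restrict {U : Set Orbit} (G : Coeffs U) {V : Set Orbit} (hV : V ⊆ U) : Coeffs V where
  gt := G.gt
  f := G.f
  h := G.h
  gt_smooth i j := (G.gt_smooth i j).mono hV
  f_smooth i j := (G.f_smooth i j).mono hV
  h_smooth i j := (G.h_smooth i j).mono hV
  gt_symm t ht := G.gt_symm t (hV ht)
  h_symm t ht := G.h_symm t (hV ht)
  gt_det t ht := G.gt_det t (hV ht)
  h_det t ht := G.h_det t (hV ht)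

theorem IsLambdaVacuum.restrict {U V : Set Orbit} {G : Coeffs U} {Λ : ℝ}
    (h : IsLambdaVacuum G.metric Λ (cyl U)) (hV : V ⊆ U) :
    IsLambdaVacuum (G.restrict hV).metric Λ (cyl V) :=
  fun x hx a b => h x (hV hx) a b

theorem isOpen_ne_zero_of_smoothOn {U : Set Orbit} (hU : IsOpen U) {F : Orbit → ℝ}
    (hF : ContDiffOn ℝ ∞ F U) : IsOpen {t ∈ U | F t ≠ 0} :=
  hF.continuousOn.isOpen_inter_preimage hU isOpen_ne

/-! ### Flatness and vanishing curvature from C_ρ = 0 -/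

namespace NullFrame

variable {U : Set Orbit} {G : Coeffs U} (N : NullFrame G) {t : Orbit}

def restrict {V : Set Orbit} (hV : V ⊆ U) : NullFrame (G.restrict hV) where
  p := N.p
  q := N.q
  p_smooth i := (N.p_smooth i).mono hV
  q_smooth i := (N.q_smooth i).mono hV
  vol_ne t ht := N.vol_ne t (hV ht)
  gt_eq t ht := N.gt_eq t (hV ht)

theorem swap_conn (t : Orbit) (i : Fin 2) : N.swap.conn t i = -N.conn t i := by
  have hp : N.swap.p = N.q := rfl
  have hq : N.swap.q = N.p := rfl
  simp only [conn, a, b, N.swap_vol, hp, hq, div_neg]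
  ring

/-- A symmetric bilinear form that is trace-free with respect to a definite one and has
determinant zero vanishes. -/
theorem eq_zero_of_traceFree {h0 h1 h2 x y z : ℝ} (hpos : 0 < h0 * h2 - h1 * h1)
    (htr : x * h2 + h0 * z - 2 * h1 * y = 0) (hdet : x * z - y ^ 2 = 0) :
    x = 0 ∧ y = 0 ∧ z = 0 := by
  have hp : 0 < h0 * h2 := by nlinarith [sq_nonneg h1]
  have hy : y = 0 := by
    -- The trace and determinant conditions combine into a square plus a positive multiple of y², so
    -- y = 0.
    have h1' : (x * h2 - h0 * z) ^ 2 + 4 * (h0 * h2 - h1 * h1) * y ^ 2 = 0 := by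
      linear_combination (x * h2 + h0 * z + 2 * h1 * y) * htr - 4 * h0 * h2 * hdet
    have h2' : (h0 * h2 - h1 * h1) * y ^ 2 = 0 := by
      nlinarith [sq_nonneg (x * h2 - h0 * z), mul_nonneg hpos.le (sq_nonneg y)]
    have := (mul_eq_zero.1 h2').resolve_left hpos.ne'
    exact pow_eq_zero_iff (two_ne_zero) |>.1 this
  subst hy
  have hh0 : h0 ≠ 0 := fun h => by simp [h] at hp
  have hh2 : h2 ≠ 0 := fun h => by simp [h] at hp
  have hxz : x * z = 0 := by linarith
  rcases mul_eq_zero.1 hxz with h | h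
  · subst h; simpa [hh0] using htr
  · subst h; simpa [hh2] using htr

/-- If the area of the Killing leaves is constant along `e₁`, so is their metric. -/
theorem const_e₁_of_τ (hU : IsOpen U) {Λ : ℝ} (hvac : IsLambdaVacuum G.metric Λ (cyl U))
    (hpos : ∀ t ∈ U, 0 < G.τ t) (hτ : ∀ s ∈ U, ddir (N.e₁ s) G.τ s = 0) (ht : t ∈ U)
    (k l : Fin 2) : ddir (N.e₁ t) (fun s => G.h s k l) t = 0 := by
  have h1 := N.ricci_e₁_e₁ hU hvac ht
  rw [ddir_congr hU (K := fun _ => 0) hτ ht, ddir_const, hτ t ht] at h1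
  have hp := hpos t ht
  have hdet : ddir (N.e₁ t) (fun s => G.h s 0 0) t * ddir (N.e₁ t) (fun s => G.h s 1 1) t
        - ddir (N.e₁ t) (fun s => G.h s 0 1) t ^ 2 = 0 := by
    have h2 : G.τ t * (ddir (N.e₁ t) (fun s => G.h s 0 0) t * ddir (N.e₁ t) (fun s => G.h s 1 1) t
        - ddir (N.e₁ t) (fun s => G.h s 0 1) t ^ 2) = 0 := by linarith
    exact (mul_eq_zero.1 h2).resolve_left hp.ne'
  -- By Jacobi's formula e₁(τ) = τ h^{kl} e₁(h_kl), so constancy of τ along e₁ is the trace-free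
  -- condition for e₁(h).
  have htr := hτ t ht
  rw [ddir_τ hU ht] at htr
  rw [G.τ_eq ht] at hp
  obtain ⟨h00, h01, h11⟩ := eq_zero_of_traceFree hp htr hdet
  have h10 : ddir (N.e₁ t) (fun s => G.h s 1 0) t = 0 := by
    rw [ddir_congr hU (fun s hs => G.h10 hs) ht, h01]
  revert k l
  simp only [Fin.forall_fin_two]
  exact ⟨⟨h00, h01⟩, h10, h11⟩

theorem const_e₂_of_τ (hU : IsOpen U) {Λ : ℝ} (hvac : IsLambdaVacuum G.metric Λ (cyl U))
    (hpos : ∀ t ∈ U, 0 < G.τ t) (hτ : ∀ s ∈ U, ddir (N.e₂ s) G.τ s = 0) (ht : t ∈ U)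
    (k l : Fin 2) : ddir (N.e₂ t) (fun s => G.h s k l) t = 0 := by
  have := N.swap.const_e₁_of_τ hU hvac hpos (fun s hs => by rw [N.swap_e₁]; exact hτ s hs) ht k l
  rwa [N.swap_e₁] at this

/-- The vanishing of `Λ`, of the curvature of `f` and of the curvature of the orbit metric. -/
def IsFlatAt (Λ : ℝ) (t : Orbit) : Prop :=
  Λ = 0 ∧ (∀ k, pd 0 (fun s => G.f s 1 k) t - pd 1 (fun s => G.f s 0 k) t = 0) ∧
      pd 0 (fun s => N.conn s 1) t - pd 1 (fun s => N.conn s 0) t = 0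

theorem isFlatAt_of_e₂_τ (hU : IsOpen U) {Λ : ℝ} (hvac : IsLambdaVacuum G.metric Λ (cyl U))
    (hpos : ∀ t ∈ U, 0 < G.τ t) (hτ : ∀ s ∈ U, ddir (N.e₂ s) G.τ s = 0) (ht : t ∈ U) :
    N.IsFlatAt Λ t :=
  N.flat_of_const_e₂ hU hvac (fun _ hs k l => N.const_e₂_of_τ hU hvac hpos hτ hs k l) ht

theorem isFlatAt_of_e₁_τ (hU : IsOpen U) {Λ : ℝ} (hvac : IsLambdaVacuum G.metric Λ (cyl U))
    (hpos : ∀ t ∈ U, 0 < G.τ t) (hτ : ∀ s ∈ U, ddir (N.e₁ s) G.τ s = 0) (ht : t ∈ U) :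
    N.IsFlatAt Λ t := by
  obtain ⟨h1, h2, h3⟩ := N.swap.isFlatAt_of_e₂_τ hU hvac hpos
    (fun s hs => by rw [N.swap_e₂]; exact hτ s hs) ht
  refine ⟨h1, h2, ?_⟩
  have h4 : ∀ i j, pd j (fun s => N.swap.conn s i) t = -pd j (fun s => N.conn s i) t := fun i j => by
    simp only [N.swap_conn]
    exact ddir_neg
  rw [h4, h4] at h3
  linarith

/-- The inverse of g̃ = p q is 2 (e₁ ⊗ e₂ + e₂ ⊗ e₁), so the squared length of dτ is four times the
product of its null derivatives. -/
theorem Crho_eq (ht : t ∈ U) :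
    G.Crho t = 4 / G.τ t ^ 2 * (ddir (N.e₁ t) G.τ t * ddir (N.e₂ t) G.τ t) := by
  have hv : N.vol t ≠ 0 := N.vol_ne t ht
  have hdet : (G.gt t).det = -(1 / 4) * N.vol t ^ 2 := by
    rw [Matrix.det_fin_two]
    simp only [N.gt_eq t ht, vol]
    ring
  rw [Coeffs.Crho, ddir_eq_pd, ddir_eq_pd]
  change 1 / G.τ t ^ 2 * ∑ i, ∑ j, pd i G.τ t * pd j G.τ t * _ = _
  simp only [Matrix.inv_def, Matrix.adjugate_fin_two, Ring.inverse_eq_inv', hdet, Fin.sum_univ_two,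
    Matrix.smul_apply, smul_eq_mul, Matrix.of_apply, Matrix.cons_val', Matrix.cons_val_zero,
    Matrix.cons_val_one, Matrix.cons_val_fin_one, N.gt_eq t ht, e₁, e₂]
  have hτ : G.τ t ≠ 0 := G.h_det t ht
  field_simp
  ring

/-- Each null derivative vanishes on a closed set and the two sets cover U, but neither need contain
a neighbourhood of the given point. All assertions of `IsFlatAt` are vanishing of smooth functions,
so they can be tested on the open set where such a function is non-zero. -/
theorem isFlatAt (hU : IsOpen U) {Λ : ℝ} (hvac : IsLambdaVacuum G.metric Λ (cyl U))
    (hpos : ∀ t ∈ U, 0 < G.τ t) (hC : ∀ t ∈ U, G.Crho t = 0) (ht : t ∈ U) :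
    N.IsFlatAt Λ t := by
  have hprod : ∀ s ∈ U, ddir (N.e₁ s) G.τ s * ddir (N.e₂ s) G.τ s = 0 := fun s hs => by
    have h := hC s hs
    rw [N.Crho_eq hs] at h
    refine (mul_eq_zero.1 h).resolve_left ?_
    have := hpos s hs
    positivity
  have key : ∀ φ : Orbit → ℝ, ContDiffOn ℝ ∞ φ U → (∀ s ∈ U, N.IsFlatAt Λ s → φ s = 0) →
      φ t = 0 := by
    intro φ hφ hflat
    by_contra hne
    set O := {s ∈ U | φ s ≠ 0} with hO
    have hOo : IsOpen O := isOpen_ne_zero_of_smoothOn hU hφ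
    have hOU : O ⊆ U := fun s hs => hs.1
    -- Where e₂(τ) ≠ 0, which is an open condition, e₁(τ) vanishes and flatness holds, against φ ≠
    -- 0. Thus e₂(τ) vanishes on all of O, and flatness on O follows by the other alternative.
    have h2 : ∀ s ∈ O, ddir (N.e₂ s) G.τ s = 0 := by
      intro s hs
      by_contra h
      set V := {s ∈ U | ddir (N.e₂ s) G.τ s ≠ 0} with hV
      have hVU : V ⊆ U := fun s hs => hs.1
      have hVo : IsOpen V := isOpen_ne_zero_of_smoothOn hU
        (by simpa only [N.swap_e₁] using N.swap.smoothOn_d₁ hU (smoothOn_τ G))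
      refine hs.2 (hflat s hs.1 ((N.restrict hVU).isFlatAt_of_e₁_τ hVo (hvac.restrict hVU)
        (fun r hr => hpos r (hVU hr)) (fun r hr => ?_) ⟨hs.1, h⟩))
      exact (mul_eq_zero.1 (hprod r hr.1)).resolve_right hr.2
    exact hne (hflat t ht ((N.restrict hOU).isFlatAt_of_e₂_τ hOo (hvac.restrict hOU)
        (fun r hr => hpos r (hOU hr)) h2 ⟨ht, hne⟩))
  refine ⟨key (fun _ => Λ) contDiffOn_const fun s _ h => h.1, fun k =>
    key _ ((smoothOn_pd hU (G.f_smooth 1 k) 0).sub (smoothOn_pd hU (G.f_smooth 0 k) 1))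
      fun s _ h => h.2.1 k,
    key _ ((smoothOn_pd hU (N.smoothOn_conn hU 1) 0).sub (smoothOn_pd hU (N.smoothOn_conn hU 0) 1))
      fun s _ h => h.2.2⟩

end NullFrame

/-- A Lorentzian orbit metric has local null frames. -/
theorem exists_nullFrame {U : Set Orbit} (hU : IsOpen U) (G : Coeffs U)
    (hgt : ∀ t ∈ U, (G.gt t).det < 0) {t₀ : Orbit} (ht₀ : t₀ ∈ U) :
    ∃ (V : Set Orbit) (hV : V ⊆ U), IsOpen V ∧ t₀ ∈ V ∧ Nonempty (NullFrame (G.restrict hV)) := by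
  set g := G.gt
  have hg10 : ∀ t ∈ U, g t 1 0 = g t 0 1 := fun t ht => (G.gt_symm t ht).apply 0 1
  have hdisc : ∀ t ∈ U, 0 < g t 0 1 * g t 0 1 - g t 0 0 * g t 1 1 := fun t ht => by
    have := hgt t ht
    rw [Matrix.det_fin_two, hg10 t ht] at this
    linarith
  set s : Orbit → ℝ := fun t => √(g t 0 1 * g t 0 1 - g t 0 0 * g t 1 1) with hs
  have hsm : ContDiffOn ℝ ∞ s U :=
    (((G.gt_smooth 0 1).mul (G.gt_smooth 0 1)).sub ((G.gt_smooth 0 0).mul (G.gt_smooth 1 1))).sqrt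
      (fun t ht => (hdisc t ht).ne')
  have hss : ∀ t ∈ U, s t * s t = g t 0 1 * g t 0 1 - g t 0 0 * g t 1 1 := fun t ht =>
    Real.mul_self_sqrt (hdisc t ht).le
  have hspos : ∀ t ∈ U, 0 < s t := fun t ht => Real.sqrt_pos.2 (hdisc t ht)
  -- The two choices e = ±1 are the roots of the quadratic form; they cannot both make g₀₁ + e s
  -- vanish, since s > 0.
  obtain ⟨e, he, hne⟩ : ∃ e : ℝ, e * e = 1 ∧ g t₀ 0 1 + e * s t₀ ≠ 0 := by
    by_cases h : g t₀ 0 1 + 1 * s t₀ = 0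
    · refine ⟨-1, by norm_num, fun h' => ?_⟩
      have := hspos t₀ ht₀
      linarith
    · exact ⟨1, by norm_num, h⟩
  have hκ : ContDiffOn ℝ ∞ (fun t => g t 0 1 + e * s t) U :=
    (G.gt_smooth 0 1).add (contDiffOn_const.mul hsm)
  have hV : {t ∈ U | g t 0 1 + e * s t ≠ 0} ⊆ U := fun t ht => ht.1
  refine ⟨_, hV, isOpen_ne_zero_of_smoothOn hU hκ, ⟨ht₀, hne⟩, ⟨?_⟩⟩
  exact
    -- With κ = g₀₁ + e s the quadratic form factors as (g₀₀ dt¹ + κ dt²)(dt¹ + (g₁₁/κ) dt²),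
    -- because g₀₀ g₁₁ / κ = g₀₁ - e s.
    { p := fun t => ![g t 0 0, g t 0 1 + e * s t]
      q := fun t => ![1, g t 1 1 / (g t 0 1 + e * s t)]
      p_smooth := by
        rw [Fin.forall_fin_two]
        exact ⟨(G.gt_smooth 0 0).mono hV, hκ.mono hV⟩
      q_smooth := by
        rw [Fin.forall_fin_two]
        exact ⟨contDiffOn_const, ((G.gt_smooth 1 1).mono hV).div (hκ.mono hV) fun t ht => ht.2⟩
      vol_ne := fun t ht h => by
        have h1 := hss t ht.1
        have h2 := hspos t ht.1
        have h3 := ht.2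
        simp only [Matrix.cons_val_zero, Matrix.cons_val_one] at h
        field_simp at h
        have h4 : (2 * e * s t) * (g t 0 1 + e * s t) = 0 := by
          linear_combination -h + (e * e) * h1 + (g t 0 1 * g t 0 1 - g t 0 0 * g t 1 1) * he
        rcases mul_eq_zero.1 h4 with h5 | h5
        · have : e ≠ 0 := fun h => by simp [h] at he
          simp [this, h2.ne'] at h5
        · exact h3 h5
      gt_eq := fun t ht => by
        have h1 := hss t ht.1
        have h3 := ht.2
        change ∀ i j, g t i j = _
        simp only [Fin.forall_fin_two, hg10 t ht.1, Matrix.cons_val_zero, Matrix.cons_val_one]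
        have h4 : g t 0 0 * (g t 1 1 / (g t 0 1 + e * s t)) = g t 0 1 - e * s t := by
          field_simp
          linear_combination h1 + (s t * s t) * he
        refine ⟨⟨by ring, by linear_combination (-1 / 2 : ℝ) * h4⟩,
          by linear_combination (-1 / 2 : ℝ) * h4, ?_⟩
        field_simp
        ring }

/-! ### Closed 1-forms and flat null coordinates -/

theorem pd_comm {U : Set Orbit} (hU : IsOpen U) {F : Orbit → ℝ} (hF : ContDiffOn ℝ ∞ F U)
    {t : Orbit} (ht : t ∈ U) (i j : Fin 2) : pd i (pd j F) t = pd j (pd i F) t :=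
  ddir_comm hU hF ht

theorem fderiv_eq_pd (F : Orbit → ℝ) (t w : Orbit) :
    fderiv ℝ F t w = w 0 * pd 0 F t + w 1 * pd 1 F t := ddir_eq_pd

/-- A smooth closed 1-form on a convex open set has a smooth primitive. -/
theorem exists_primitive {U : Set Orbit} (hU : IsOpen U) (hc : Convex ℝ U) {α : Fin 2 → Orbit → ℝ}
    (hα : ∀ i, ContDiffOn ℝ ∞ (α i) U) (hcl : ∀ t ∈ U, pd 0 (α 1) t - pd 1 (α 0) t = 0) :
    ∃ F : Orbit → ℝ, ContDiffOn ℝ ∞ F U ∧ ∀ t ∈ U, ∀ i, pd i F t = α i t := by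
  set β : Orbit → Orbit →L[ℝ] ℝ := fun t =>
    α 0 t • (ContinuousLinearMap.proj 0 : Orbit →L[ℝ] ℝ)
      + α 1 t • (ContinuousLinearMap.proj 1 : Orbit →L[ℝ] ℝ) with hβ
  have hβs : ContDiffOn ℝ ∞ β U :=
    ((hα 0).smul contDiffOn_const).add ((hα 1).smul contDiffOn_const)
  have hβd : DifferentiableOn ℝ β U := hβs.differentiableOn (by simp)
  have hsym : ∀ a ∈ U, ∀ x y, fderiv ℝ β a x y = fderiv ℝ β a y x := by
    intro a ha x y
    have key : ∀ x y : Orbit, fderiv ℝ β a x y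
        = fderiv ℝ (α 0) a x * y 0 + fderiv ℝ (α 1) a x * y 1 := by
      intro x y
      have h1 : fderiv ℝ β a x y = fderiv ℝ (fun t => β t y) a x := by
        rw [fderiv_clm_apply (hβd.differentiableAt (hU.mem_nhds ha)) (differentiableAt_const y)]
        simp
      have h2 : (fun t => β t y) = fun t => y 0 * α 0 t + y 1 * α 1 t := by
        ext t; simp [hβ]; ring
      have d := fun i => differentiableAt_of_smoothOn hU (hα i) ha
      rw [h1, h2]
      change ddir x _ a = _
      rw [ddir_add ((d 0).const_mul _) ((d 1).const_mul _), ddir_const_mul (d 0),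
        ddir_const_mul (d 1)]
      simp only [ddir]
      ring
    rw [key, key]
    simp only [fderiv_eq_pd]
    linear_combination (x 0 * y 1 - x 1 * y 0) * hcl a ha
  obtain ⟨F, hF⟩ := hc.exists_forall_hasFDerivAt_of_fderiv_symmetric hU hβd hsym
  refine ⟨F, ?_, fun t ht i => ?_⟩
  · rw [contDiffOn_infty_iff_fderiv_of_isOpen hU]
    exact ⟨fun t ht => (hF t ht).differentiableAt.differentiableWithinAt,
      hβs.congr fun t ht => (hF t ht).fderiv⟩
  · rw [pd, (hF t ht).fderiv]
    fin_cases i <;> simp [hβ]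

theorem pd_mul {U : Set Orbit} (hU : IsOpen U) {F K : Orbit → ℝ} (hF : ContDiffOn ℝ ∞ F U)
    (hK : ContDiffOn ℝ ∞ K U) {t : Orbit} (ht : t ∈ U) (i : Fin 2) :
    pd i (fun s => F s * K s) t = pd i F t * K t + F t * pd i K t :=
  ddir_mul (differentiableAt_of_smoothOn hU hF ht) (differentiableAt_of_smoothOn hU hK ht)

theorem pd_exp {U : Set Orbit} (hU : IsOpen U) {F : Orbit → ℝ} (hF : ContDiffOn ℝ ∞ F U)
    {t : Orbit} (ht : t ∈ U) (i : Fin 2) :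
    pd i (fun s => Real.exp (F s)) t = Real.exp (F t) * pd i F t := by
  rw [pd, ((differentiableAt_of_smoothOn hU hF ht).hasFDerivAt.exp).fderiv]
  simp [pd]

namespace NullFrame

variable {U : Set Orbit} {G : Coeffs U} (N : NullFrame G) {t : Orbit}

/-- A flat Lorentzian orbit metric has null coordinates `u, v` on convex sets. -/
theorem exists_flat_coords (hU : IsOpen U) (hc : Convex ℝ U)
    (hflat : ∀ t ∈ U, pd 0 (fun s => N.conn s 1) t - pd 1 (fun s => N.conn s 0) t = 0) :
    ∃ u v : Orbit → ℝ, ContDiffOn ℝ ∞ u U ∧ ContDiffOn ℝ ∞ v U ∧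
      (∀ t ∈ U, pd 0 u t * pd 1 v t - pd 1 u t * pd 0 v t ≠ 0) ∧
      ∀ t ∈ U, ∀ i j, G.gt t i j = (1 / 2) * (pd i u t * pd j v t + pd i v t * pd j u t) := by
  -- Since dp = -b p ∧ q and dq = -a p ∧ q, a function l with dl = a p + b q makes both e^{-l} p and
  -- e^{l} q closed. Their product is still p q, and their primitives are u and v.
  obtain ⟨l, hl, hdl⟩ := exists_primitive hU hc (α := fun i t => N.conn t i)
    (N.smoothOn_conn hU) hflat
  have hl' : ContDiffOn ℝ ∞ (fun t => -l t) U := hl.neg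
  have hdl' : ∀ t ∈ U, ∀ i, pd i (fun t => -l t) t = -N.conn t i := fun t ht i =>
    ddir_neg.trans (congrArg _ (hdl t ht i))
  have ha : ∀ t ∈ U, N.a t * N.vol t
      = -(pd 0 (fun s => N.q s 1) t - pd 1 (fun s => N.q s 0) t) := fun t ht => by
    have h : N.vol t ≠ 0 := N.vol_ne t ht
    rw [a]; field_simp
  have hb : ∀ t ∈ U, N.b t * N.vol t
      = -(pd 0 (fun s => N.p s 1) t - pd 1 (fun s => N.p s 0) t) := fun t ht => by
    have h : N.vol t ≠ 0 := N.vol_ne t ht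
    rw [b]; field_simp
  obtain ⟨u, hu, hdu⟩ := exists_primitive hU hc (α := fun i t => Real.exp (-l t) * N.p t i)
    (fun i => hl'.exp.mul (N.p_smooth i)) (fun t ht => by
      rw [pd_mul hU hl'.exp (N.p_smooth 1) ht, pd_mul hU hl'.exp (N.p_smooth 0) ht,
        pd_exp hU hl' ht, pd_exp hU hl' ht, hdl' t ht, hdl' t ht]
      have := hb t ht
      simp only [conn, vol] at *
      linear_combination Real.exp (-l t) * this)
  obtain ⟨v, hv, hdv⟩ := exists_primitive hU hc (α := fun i t => Real.exp (l t) * N.q t i)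
    (fun i => hl.exp.mul (N.q_smooth i)) (fun t ht => by
      rw [pd_mul hU hl.exp (N.q_smooth 1) ht, pd_mul hU hl.exp (N.q_smooth 0) ht,
        pd_exp hU hl ht, pd_exp hU hl ht, hdl t ht, hdl t ht]
      have := ha t ht
      simp only [conn, vol] at *
      linear_combination Real.exp (l t) * this)
  have hee : ∀ t, Real.exp (-l t) * Real.exp (l t) = 1 := fun t => by
    rw [← Real.exp_add]; simp
  refine ⟨u, v, hu, hv, fun t ht => ?_, fun t ht i j => ?_⟩
  · rw [hdu t ht, hdu t ht, hdv t ht, hdv t ht]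
    intro h
    refine N.vol_ne t ht ?_
    linear_combination h - (N.p t 0 * N.q t 1 - N.p t 1 * N.q t 0) * hee t
  · rw [hdu t ht, hdu t ht, hdv t ht, hdv t ht, N.gt_eq t ht]
    linear_combination (-1 / 2 : ℝ) * (N.p t i * N.q t j + N.q t i * N.p t j) * hee t

/-- The null frame of a pair of null coordinates. -/
def ofCoords (hU : IsOpen U) {u v : Orbit → ℝ} (hu : ContDiffOn ℝ ∞ u U)
    (hv : ContDiffOn ℝ ∞ v U) (hvol : ∀ t ∈ U, pd 0 u t * pd 1 v t - pd 1 u t * pd 0 v t ≠ 0)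
    (hgt : ∀ t ∈ U, ∀ i j, G.gt t i j = (1 / 2) * (pd i u t * pd j v t + pd i v t * pd j u t)) :
    NullFrame G where
  p t i := pd i u t
  q t i := pd i v t
  p_smooth := smoothOn_pd hU hu
  q_smooth := smoothOn_pd hU hv
  vol_ne := hvol
  gt_eq := hgt

/-- The coefficient a is the curl of q up to a factor, and q = dv is closed. -/
theorem ofCoords_a (hU : IsOpen U) {u v : Orbit → ℝ} (hu : ContDiffOn ℝ ∞ u U)
    (hv : ContDiffOn ℝ ∞ v U) (hvol : ∀ t ∈ U, pd 0 u t * pd 1 v t - pd 1 u t * pd 0 v t ≠ 0)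
    (hgt : ∀ t ∈ U, ∀ i j, G.gt t i j = (1 / 2) * (pd i u t * pd j v t + pd i v t * pd j u t))
    (ht : t ∈ U) : (ofCoords hU hu hv hvol hgt).a t = 0 := by
  have : pd 0 (pd 1 v) t - pd 1 (pd 0 v) t = 0 := sub_eq_zero.2 (pd_comm hU hv ht 0 1)
  change -(pd 0 (pd 1 v) t - pd 1 (pd 0 v) t) / _ = 0
  rw [this]; simp

end NullFrame

/-! ### Local inversion -/

/-- Two functions with independent differentials are local coordinates; their image can be taken
to be a square. -/
theorem exists_local_coords {U : Set Orbit} (hU : IsOpen U) {Φ : Orbit → Orbit}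
    (hΦ : ContDiffOn ℝ ∞ Φ U)
    (hinj : ∀ t ∈ U, ∀ w, fderiv ℝ Φ t w = 0 → w = 0) {t₀ : Orbit} (ht₀ : t₀ ∈ U) :
    ∃ (r : ℝ) (Θ : Orbit → Orbit) (V : Set Orbit), 0 < r ∧ IsOpen V ∧ t₀ ∈ V ∧ V ⊆ U ∧
      ContDiffOn ℝ ∞ Θ (Metric.ball (Φ t₀) r) ∧ Set.MapsTo Θ (Metric.ball (Φ t₀) r) V ∧
      (∀ y ∈ Metric.ball (Φ t₀) r, Φ (Θ y) = y) ∧ Set.MapsTo Φ V (Metric.ball (Φ t₀) r) ∧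
      ∀ t ∈ V, Θ (Φ t) = t := by
  have hequiv : ∀ t ∈ U, ∃ L : Orbit ≃L[ℝ] Orbit, (L : Orbit →L[ℝ] Orbit) = fderiv ℝ Φ t := by
    intro t ht
    have hi : Function.Injective (fderiv ℝ Φ t : Orbit →ₗ[ℝ] Orbit) :=
      (injective_iff_map_eq_zero _).2 (hinj t ht)
    refine ⟨(LinearEquiv.ofInjectiveEndo _ hi).toContinuousLinearEquiv, ?_⟩
    ext1 w
    rfl
  have hat : ∀ t ∈ U, ContDiffAt ℝ ∞ Φ t := fun t ht => hΦ.contDiffAt (hU.mem_nhds ht)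
  have hder : ∀ t ∈ U, HasFDerivAt Φ (fderiv ℝ Φ t) t := fun t ht =>
    ((hat t ht).differentiableAt (by simp)).hasFDerivAt
  obtain ⟨L, hL⟩ := hequiv t₀ ht₀
  have hL' : HasFDerivAt Φ (L : Orbit →L[ℝ] Orbit) t₀ := hL ▸ hder t₀ ht₀
  set e := (hat t₀ ht₀).toOpenPartialHomeomorph Φ hL' (by simp) with he
  have hecoe : ∀ t, e t = Φ t := fun t => rfl
  have hsrc : t₀ ∈ e.source := ContDiffAt.mem_toOpenPartialHomeomorph_source _ _ _
  have hT : IsOpen (e.target ∩ e.symm ⁻¹' U) := e.symm.isOpen_inter_preimage hU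
  have hy0 : Φ t₀ ∈ e.target ∩ e.symm ⁻¹' U :=
    ⟨e.map_source hsrc, by
      have : e.symm (Φ t₀) = t₀ := e.left_inv hsrc
      simpa [this] using ht₀⟩
  -- `Orbit` carries the supremum norm, so this ball is an open square.
  obtain ⟨r, hr, hball⟩ := Metric.isOpen_iff.1 hT _ hy0
  refine ⟨r, e.symm, e.source ∩ e ⁻¹' Metric.ball (Φ t₀) r, hr,
    e.isOpen_inter_preimage Metric.isOpen_ball, ⟨hsrc, Metric.mem_ball_self hr⟩, ?_, ?_, ?_, ?_,
    ?_, ?_⟩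
  · intro t ht
    have := (hball ht.2).2
    rwa [Set.mem_preimage, e.left_inv ht.1] at this
  · intro y hy
    have hyU : e.symm y ∈ U := (hball hy).2
    obtain ⟨M, hM⟩ := hequiv _ hyU
    exact (e.contDiffAt_symm (hball hy).1 (hM ▸ hder _ hyU) (hat _ hyU)).contDiffWithinAt
  · intro y hy
    refine ⟨e.map_target (hball hy).1, ?_⟩
    rw [Set.mem_preimage, e.right_inv (hball hy).1]
    exact hy
  · exact fun y hy => e.right_inv (hball hy).1
  · exact fun t ht => ht.2
  · exact fun t ht => e.left_inv ht.1

/-- A function on a square whose derivative in the direction of the coordinate `j` vanishes does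
not depend on that coordinate. -/
theorem eq_of_pd_eq_zero {c : Orbit} {r : ℝ} {F : Orbit → ℝ}
    (hF : ContDiffOn ℝ ∞ F (Metric.ball c r)) {i j : Fin 2} (hij : ∀ k, k = i ∨ k = j)
    (hz : ∀ y ∈ Metric.ball c r, pd j F y = 0) {y y' : Orbit} (hy : y ∈ Metric.ball c r)
    (hy' : y' ∈ Metric.ball c r) (h : y i = y' i) : F y = F y' := by
  set B := Metric.ball c r with hB
  have hmem : ∀ s ∈ Set.Icc (0 : ℝ) 1, y + s • (y' - y) ∈ B := fun s hs =>
    (convex_ball c r).add_smul_sub_mem hy hy' hs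
  have hdir : y' - y = (y' j - y j) • (Pi.single j 1 : Orbit) := by
    ext k
    rcases hij k with rfl | rfl
    · by_cases hkj : k = j
      · subst hkj; simp
      · simp [hkj, h]
    · simp
  have hd : ∀ s ∈ Set.Icc (0 : ℝ) 1,
      HasDerivAt (fun s : ℝ => F (y + s • (y' - y))) 0 s := by
    intro s hs
    have h1 := (differentiableAt_of_smoothOn Metric.isOpen_ball hF (hmem s hs)).hasFDerivAt
    have h2 : HasDerivAt (fun s : ℝ => y + s • (y' - y)) (y' - y) s := by
      simpa using ((hasDerivAt_id s).smul_const (y' - y)).const_add y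
    have h3 := h1.comp_hasDerivAt s h2
    have h4 : fderiv ℝ F (y + s • (y' - y)) (y' - y) = 0 := by
      rw [hdir, map_smul]
      rw [hdir] at hmem
      have := hz _ (hmem s hs)
      rw [pd] at this
      rw [this, smul_zero]
    rw [h4] at h3
    exact h3
  have := constant_of_has_deriv_right_zero (f := fun s : ℝ => F (y + s • (y' - y))) (a := 0) (b := 1)
    (fun s hs => (hd s hs).continuousAt.continuousWithinAt)
    (fun s hs => (hd s ⟨hs.1, hs.2.le⟩).hasDerivWithinAt) 1 (by simp)
  simpa using this.symm

/-- If the product of the partial derivatives of `F` vanishes on a square, so does one of them. -/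
theorem pd_eq_zero_of_mul {c : Orbit} {r : ℝ} {F : Orbit → ℝ}
    (hF : ContDiffOn ℝ ∞ F (Metric.ball c r))
    (hz : ∀ y ∈ Metric.ball c r, pd 0 F y * pd 1 F y = 0) :
    (∀ y ∈ Metric.ball c r, pd 1 F y = 0) ∨ ∀ y ∈ Metric.ball c r, pd 0 F y = 0 := by
  set B := Metric.ball c r with hB
  have hBo : IsOpen B := Metric.isOpen_ball
  have hX := smoothOn_pd hBo hF 0
  have hY := smoothOn_pd hBo hF 1
  have hZs := smoothOn_pd hBo hY 0
  have hconst : ∀ {K : Orbit → ℝ}, (∀ y ∈ B, K y = 0) → ∀ y ∈ B, ∀ i, pd i K y = 0 :=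
    fun hK y hy i => (ddir_congr (K := fun _ => 0) hBo hK hy).trans (ddir_const 0)
  have h1 : ∀ y ∈ B, pd 0 F y * pd 0 (pd 1 F) y = 0 := by
    intro y hy
    have h := hconst hz y hy 0
    rw [pd_mul hBo hX hY hy] at h
    -- Differentiate F₀ F₁ = 0 in the direction 0 and multiply by F₀: the term F₀₀ F₀ F₁ vanishes
    -- and F₀² F₀₁ = 0 is left.
    have h2 : (pd 0 F y * pd 0 (pd 1 F) y) * pd 0 F y = 0 := by
      linear_combination pd 0 F y * h - pd 0 (pd 0 F) y * hz y hy
    rcases mul_eq_zero.1 h2 with h3 | h3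
    · exact h3
    · rw [h3, zero_mul]
  have h2 : ∀ y ∈ B, pd 0 (pd 1 F) y = 0 := by
    intro y hy
    have h := hconst h1 y hy 1
    rw [pd_mul hBo hX hZs hy, ← pd_comm hBo hF hy 0 1] at h
    -- Differentiate F₀ F₀₁ = 0 in the direction 1 and multiply by F₀₁: the other term contains F₀
    -- F₀₁ again.
    have h3 : pd 0 (pd 1 F) y ^ 3 = 0 := by
      linear_combination pd 0 (pd 1 F) y * h - pd 1 (pd 0 (pd 1 F)) y * h1 y hy
    exact pow_eq_zero_iff (by norm_num) |>.1 h3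
  by_contra hcon
  push Not at hcon
  obtain ⟨⟨y, hy, hy1⟩, y', hy', hy0⟩ := hcon
  -- As F₀₁ = 0, F₀ depends only on the first coordinate and F₁ only on the second. The point z
  -- takes the first coordinate where F₀ ≠ 0 and the second where F₁ ≠ 0; it lies in the ball
  -- because the ball is a product of intervals.
  set z : Orbit := ![y' 0, y 1] with hzdef
  have hzB : z ∈ B := by
    have hr : 0 < r := Metric.pos_of_mem_ball hy
    rw [hB, Metric.mem_ball, dist_pi_lt_iff hr] at hy hy' ⊢
    rw [Fin.forall_fin_two]
    exact ⟨hy' 0, hy 1⟩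
  have e1 : pd 1 F z = pd 1 F y := eq_of_pd_eq_zero hY (i := 1) (j := 0)
    (by simp [Fin.forall_fin_two]) (fun y hy => h2 y hy) hzB hy (by simp [hzdef])
  have e0 : pd 0 F z = pd 0 F y' := eq_of_pd_eq_zero hX (i := 0) (j := 1)
    (by simp [Fin.forall_fin_two]) (fun y hy => by rw [pd_comm hBo hF hy]; exact h2 y hy) hzB hy'
    (by simp [hzdef])
  have := hz z hzB
  rw [e1, e0] at this
  exact (mul_ne_zero hy0 hy1) this

/-! ### Reduction to functions of one variable -/

theorem hasDerivAt_of_smoothOn {I : Set ℝ} (hI : IsOpen I) {F : ℝ → ℝ} (hF : ContDiffOn ℝ ∞ F I)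
    {s : ℝ} (hs : s ∈ I) : HasDerivAt F (deriv F s) s :=
  ((hF.contDiffAt (hI.mem_nhds hs)).differentiableAt (by simp)).hasDerivAt

theorem smoothOn_deriv {I : Set ℝ} (hI : IsOpen I) {F : ℝ → ℝ} (hF : ContDiffOn ℝ ∞ F I) :
    ContDiffOn ℝ ∞ (deriv F) I :=
  hF.deriv_of_isOpen hI (by simp)

theorem deriv_congr_on {I : Set ℝ} (hI : IsOpen I) {F K : ℝ → ℝ} (h : ∀ s ∈ I, F s = K s) {s : ℝ}
    (hs : s ∈ I) : deriv F s = deriv K s :=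
  Filter.EventuallyEq.deriv_eq (Filter.eventuallyEq_of_mem (hI.mem_nhds hs) h)

/-- The remaining field equation in terms of the functions `R, W, S`. -/
theorem ode_of_field_eq {I : Set ℝ} (hI : IsOpen I) {R W S h0 h1 h2 T : ℝ → ℝ} {ε : ℝ}
    (hε : ε * ε = 1) (hR : ContDiffOn ℝ ∞ R I) (hW : ContDiffOn ℝ ∞ W I)
    (hS : ContDiffOn ℝ ∞ S I) (hR0 : ∀ s ∈ I, R s ≠ 0) (hS0 : ∀ s ∈ I, S s ≠ 0)
    (e0 : ∀ s ∈ I, h0 s = ε * (R s * R s)) (e1 : ∀ s ∈ I, h1 s = ε * (R s * R s * W s))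
    (e2 : ∀ s ∈ I, h2 s = ε * (R s * R s * (W s * W s) + S s * S s))
    (eT : ∀ s ∈ I, T s = R s * R s * (S s * S s)) {s : ℝ} (hs : s ∈ I)
    (heq : 2 * T s * deriv (deriv T) s - deriv T s ^ 2
      - 2 * T s * (deriv h0 s * deriv h2 s - deriv h1 s ^ 2) = 0) :
    deriv W s ^ 2 = -(2 * S s ^ 2 / R s ^ 2) *
            (deriv (deriv R) s / R s + deriv (deriv S) s / S s) := by
  have dR := fun s hs => hasDerivAt_of_smoothOn hI hR (s := s) hs
  have dW := fun s hs => hasDerivAt_of_smoothOn hI hW (s := s) hs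
  have dS := fun s hs => hasDerivAt_of_smoothOn hI hS (s := s) hs
  have ddR := hasDerivAt_of_smoothOn hI (smoothOn_deriv hI hR) hs
  have ddS := hasDerivAt_of_smoothOn hI (smoothOn_deriv hI hS) hs
  have d0 := (deriv_congr_on hI e0 hs).trans
    (((dR s hs).fun_mul (dR s hs)).const_mul ε).deriv
  have d1 := (deriv_congr_on hI e1 hs).trans
    ((((dR s hs).fun_mul (dR s hs)).fun_mul (dW s hs)).const_mul ε).deriv
  have d2 := (deriv_congr_on hI e2 hs).trans
    (((((dR s hs).fun_mul (dR s hs)).fun_mul ((dW s hs).fun_mul (dW s hs))).fun_add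
      ((dS s hs).fun_mul (dS s hs))).const_mul ε).deriv
  have dT : ∀ s ∈ I, deriv T s = _ := fun s hs => (deriv_congr_on hI eT hs).trans
    (((dR s hs).fun_mul (dR s hs)).fun_mul ((dS s hs).fun_mul (dS s hs))).deriv
  have ddT := (deriv_congr_on hI dT hs).trans
    ((((ddR.fun_mul (dR s hs)).fun_add ((dR s hs).fun_mul ddR)).fun_mul
        ((dS s hs).fun_mul (dS s hs))).fun_add
      (((dR s hs).fun_mul (dR s hs)).fun_mul
        ((ddS.fun_mul (dS s hs)).fun_add ((dS s hs).fun_mul ddS)))).deriv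
  rw [d0, d1, d2, ddT, dT s hs, eT s hs] at heq
  have hRs := hR0 s hs
  have hSs := hS0 s hs
  -- Up to ε² = 1, all products of first derivatives of R and S cancel; W' is the only first
  -- derivative left.
  have key : (2 * R s ^ 2 * S s ^ 2) * (2 * R s * deriv (deriv R) s * S s ^ 2
      + 2 * R s ^ 2 * S s * deriv (deriv S) s + R s ^ 4 * deriv W s ^ 2) = 0 := by
    linear_combination heq + (8 * R s ^ 3 * S s ^ 3 * deriv R s * deriv S s
      - 2 * R s ^ 6 * S s ^ 2 * deriv W s ^ 2) * hε
  have key2 := (mul_eq_zero.1 key).resolve_left (by positivity)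
  field_simp
  have : R s * (R s ^ 3 * deriv W s ^ 2
      + 2 * S s * (deriv (deriv R) s * S s + R s * deriv (deriv S) s)) = 0 := by
    linear_combination key2
  have := (mul_eq_zero.1 this).resolve_left hRs
  linear_combination this

theorem ddir_comp {F : ℝ → ℝ} {u : Orbit → ℝ} {t v : Orbit} (hF : DifferentiableAt ℝ F (u t))
    (hu : DifferentiableAt ℝ u t) : ddir v (fun s => F (u s)) t = deriv F (u t) * ddir v u t := by
  have h := hF.hasDerivAt.comp_hasFDerivAt t hu.hasFDerivAt
  rw [ddir, show (fun s => F (u s)) = F ∘ u from rfl, h.fderiv]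
  simp [ddir]

/-- The field equation `Ric(∂_u, ∂_u) = 0` if the metric of the leaves depends on `u` only. -/
theorem field_eq_of_null_coords {V : Set Orbit} (hV : IsOpen V) {G : Coeffs V} {Λ : ℝ}
    (hvac : IsLambdaVacuum G.metric Λ (cyl V)) {u v : Orbit → ℝ} (hu : ContDiffOn ℝ ∞ u V)
    (hv : ContDiffOn ℝ ∞ v V) (hvol : ∀ t ∈ V, pd 0 u t * pd 1 v t - pd 1 u t * pd 0 v t ≠ 0)
    (hgt : ∀ t ∈ V, ∀ i j, G.gt t i j = (1 / 2) * (pd i u t * pd j v t + pd i v t * pd j u t))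
    {I : Set ℝ} (hI : IsOpen I) (huI : ∀ t ∈ V, u t ∈ I) {H : ℝ → Fin 2 → Fin 2 → ℝ}
    (hH : ∀ k l, ContDiffOn ℝ ∞ (fun s => H s k l) I) (hGH : ∀ t ∈ V, ∀ k l, G.h t k l = H (u t) k l)
    {T : ℝ → ℝ} (hT : ∀ s, T s = H s 0 0 * H s 1 1 - H s 0 1 * H s 0 1) {t : Orbit} (ht : t ∈ V) :
    2 * T (u t) * deriv (deriv T) (u t) - deriv T (u t) ^ 2
      - 2 * T (u t) * (deriv (fun s => H s 0 0) (u t) * deriv (fun s => H s 1 1) (u t)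
        - deriv (fun s => H s 0 1) (u t) ^ 2) = 0 := by
  set N := NullFrame.ofCoords hV hu hv hvol hgt with hN
  have hTs : ContDiffOn ℝ ∞ T I := by
    rw [show T = fun s => H s 0 0 * H s 1 1 - H s 0 1 * H s 0 1 from funext hT]
    exact ((hH 0 0).mul (hH 1 1)).sub ((hH 0 1).mul (hH 0 1))
  have hd : ∀ {F : ℝ → ℝ}, ContDiffOn ℝ ∞ F I → ∀ t ∈ V,
      ddir (N.e₁ t) (fun s => F (u s)) t = deriv F (u t) := by
    intro F hF t ht
    rw [ddir_comp (hasDerivAt_of_smoothOn hI hF (huI t ht)).differentiableAt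
      (differentiableAt_of_smoothOn hV hu ht)]
    have h1 : ddir (N.e₁ t) u t = 1 := by
      rw [ddir_eq_pd, ← N.p_e₁ ht]
      change _ = pd 0 u t * _ + pd 1 u t * _
      ring
    rw [h1, mul_one]
  have hτ : ∀ t ∈ V, G.τ t = T (u t) := fun t ht => by
    rw [G.τ_eq ht, hT]; simp only [hGH t ht]
  have hdτ : ∀ t ∈ V, ddir (N.e₁ t) G.τ t = deriv T (u t) := fun t ht => by
    rw [ddir_congr hV hτ ht, hd hTs t ht]
  have hddτ : ddir (N.e₁ t) (fun s => ddir (N.e₁ s) G.τ s) t = deriv (deriv T) (u t) := by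
    rw [ddir_congr hV hdτ ht, hd (smoothOn_deriv hI hTs) t ht]
  have hdh : ∀ k l, ddir (N.e₁ t) (fun s => G.h s k l) t = deriv (fun s => H s k l) (u t) :=
    fun k l => by
      rw [ddir_congr hV (fun s hs => hGH s hs k l) ht, hd (hH k l) t ht]
  have h := N.ricci_e₁_e₁ hV hvac ht
  rw [hddτ, hdτ t ht, hτ t ht, hdh, hdh, hdh, hN, NullFrame.ofCoords_a _ _ _ _ _ ht] at h
  linear_combination h

/-! ### Lie derivatives of tensor fields that depend on the orbit coordinates only -/

section
variable {V : Set Orbit} {n E E' : Orbit → Idx → ℝ} {t : Orbit}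

/-- If the closed form `E` has constant contraction with `n`, its Lie derivative vanishes. -/
theorem lie_closed_form (hV : IsOpen V) (hn : ∀ c, ContDiffOn ℝ ∞ (fun s => n s c) V)
    (hE : ∀ c, ContDiffOn ℝ ∞ (fun s => E s c) V) {k : ℝ} (hk : ∀ s ∈ V, ∑ c, n s c * E s c = k)
    (ht : t ∈ V) (a : Idx) (hcl : ∀ c, ddir (coordFrame c) (fun s => E s a) t
      = ddir (coordFrame a) (fun s => E s c) t) :
    ∑ c, (n t c * ddir (coordFrame c) (fun s => E s a) t
      + E t c * ddir (coordFrame a) (fun s => n s c) t) = 0 := by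
  have d : ∀ {X : Orbit → ℝ}, ContDiffOn ℝ ∞ X V → DifferentiableAt ℝ X t :=
    fun hX => differentiableAt_of_smoothOn hV hX ht
  have h := ddir_congr (v := coordFrame a) (K := fun _ => k) hV hk ht
  rw [ddir_const, ddir_sum _ (fun c _ => (d (hn c)).fun_mul (d (hE c)))] at h
  rw [← h]
  refine Finset.sum_congr rfl fun c _ => ?_
  rw [ddir_mul (d (hn c)) (d (hE c)), hcl]
  ring

/-- The Lie derivative of the covariant tensor field `M` along `n`. -/
def lieTensor (n : Orbit → Idx → ℝ) (M : Orbit → Idx → Idx → ℝ) (a b : Idx) (t : Orbit) : ℝ :=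
  ∑ c, (n t c * ddir (coordFrame c) (fun s => M s a b) t
    + M t c b * ddir (coordFrame a) (fun s => n s c) t
    + M t a c * ddir (coordFrame b) (fun s => n s c) t)

theorem lieTensor_add (hV : IsOpen V) {M M' : Orbit → Idx → Idx → ℝ}
    (hM : ∀ a b, ContDiffOn ℝ ∞ (fun s => M s a b) V)
    (hM' : ∀ a b, ContDiffOn ℝ ∞ (fun s => M' s a b) V) (ht : t ∈ V) (a b : Idx) :
    lieTensor n (fun s a b => M s a b + M' s a b) a b t
      = lieTensor n M a b t + lieTensor n M' a b t := by
  simp only [lieTensor]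
  rw [← Finset.sum_add_distrib]
  refine Finset.sum_congr rfl fun c _ => ?_
  rw [ddir_add (differentiableAt_of_smoothOn hV (hM a b) ht)
    (differentiableAt_of_smoothOn hV (hM' a b) ht)]
  ring

/-- Leibniz rule: the Lie derivative of h E ⊗ E' has one term for each factor, and each factor is
invariant. -/
theorem lieTensor_mul (hV : IsOpen V) (hE : ∀ c, ContDiffOn ℝ ∞ (fun s => E s c) V)
    (hE' : ∀ c, ContDiffOn ℝ ∞ (fun s => E' s c) V) {h : Orbit → ℝ} (hh : ContDiffOn ℝ ∞ h V)
    (ht : t ∈ V) (hnh : ∑ c, n t c * ddir (coordFrame c) h t = 0)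
    (hL : ∀ a, ∑ c, (n t c * ddir (coordFrame c) (fun s => E s a) t
      + E t c * ddir (coordFrame a) (fun s => n s c) t) = 0)
    (hL' : ∀ a, ∑ c, (n t c * ddir (coordFrame c) (fun s => E' s a) t
      + E' t c * ddir (coordFrame a) (fun s => n s c) t) = 0) (a b : Idx) :
    lieTensor n (fun s a b => h s * (E s a * E' s b)) a b t = 0 := by
  have d : ∀ {X : Orbit → ℝ}, ContDiffOn ℝ ∞ X V → DifferentiableAt ℝ X t :=
    fun hX => differentiableAt_of_smoothOn hV hX ht
  have key : lieTensor n (fun s a b => h s * (E s a * E' s b)) a b t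
      = (E t a * E' t b) * ∑ c, n t c * ddir (coordFrame c) h t
        + (h t * E' t b) * ∑ c, (n t c * ddir (coordFrame c) (fun s => E s a) t
          + E t c * ddir (coordFrame a) (fun s => n s c) t)
        + (h t * E t a) * ∑ c, (n t c * ddir (coordFrame c) (fun s => E' s b) t
          + E' t c * ddir (coordFrame b) (fun s => n s c) t) := by
    simp only [lieTensor, Finset.mul_sum]
    rw [← Finset.sum_add_distrib, ← Finset.sum_add_distrib]
    refine Finset.sum_congr rfl fun c _ => ?_
    rw [ddir_mul (d hh) (d ((hE a).mul (hE' b))), ddir_mul (d (hE a)) (d (hE' b))]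
    ring
  rw [key, hnh, hL, hL']
  ring

end

/-- A Killing field whose metric dual is closed is parallel. -/
theorem isParallelField_of_isKillingField {V : Set Orbit} (hV : IsOpen V)
    {Q : Orbit → Matrix Idx Idx ℝ} (hQ : ∀ a b, ContDiffOn ℝ ∞ (fun t => Q t a b) V)
    (hsym : ∀ t ∈ V, ∀ a b, Q t a b = Q t b a) (hdet : ∀ t ∈ V, (Q t).det ≠ 0) {n w : Orbit → Idx → ℝ}
    (hn : ∀ c, ContDiffOn ℝ ∞ (fun s => n s c) V)
    (hw : ∀ t ∈ V, ∀ a, ∑ c, Q t a c * n t c = w t a)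
    (hcl : ∀ t ∈ V, ∀ a b, ddir (coordFrame a) (fun s => w s b) t
      = ddir (coordFrame b) (fun s => w s a) t)
    (hK : ∀ t ∈ V, ∀ a b, lieTensor n Q a b t = 0) {t : Orbit} (ht : t ∈ V) (a c : Idx) :
    ddir (coordFrame a) (fun s => n s c) t + ∑ b, chrFrame coordFrame Q c a b t * n t b = 0 := by
  have d : ∀ {X : Orbit → ℝ}, ContDiffOn ℝ ∞ X V → DifferentiableAt ℝ X t :=
    fun hX => differentiableAt_of_smoothOn hV hX ht
  set x : Idx → ℝ := fun c =>
    ddir (coordFrame a) (fun s => n s c) t + ∑ b, chrFrame coordFrame Q c a b t * n t b with hx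
  have hdw : ∀ a b, ddir (coordFrame a) (fun s => w s b) t
      = ∑ c, (ddir (coordFrame a) (fun s => Q s b c) t * n t c
        + Q t b c * ddir (coordFrame a) (fun s => n s c) t) := by
    intro a b
    rw [← ddir_congr (v := coordFrame a) hV (fun s hs => hw s hs b) ht,
      ddir_sum _ (fun c _ => (d (hQ b c)).fun_mul (d (hn c)))]
    exact Finset.sum_congr rfl fun c _ => ddir_mul (d (hQ b c)) (d (hn c))
  have hchr : ∀ e, ∑ c, Q t e c * ∑ b, chrFrame coordFrame Q c a b t * n t b
      = (1 / 2) * ∑ b, chrLower coordFrame Q a b e t * n t b := by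
    intro e
    have h1 : ∀ b, ∑ c, Q t e c * chrFrame coordFrame Q c a b t
        = (1 / 2) * chrLower coordFrame Q a b e t := by
      intro b
      have h2 : (Q t).mulVec (fun c => chrFrame coordFrame Q c a b t)
          = (1 / 2 : ℝ) • fun d => chrLower coordFrame Q a b d t := by
        rw [show (fun c => chrFrame coordFrame Q c a b t) = (1 / 2 : ℝ) • ((Q t)⁻¹.mulVec fun d =>
          chrLower coordFrame Q a b d t) from funext fun c => chrFrame_eq_mulVec coordFrame c a b,
          Matrix.mulVec_smul, Matrix.mulVec_mulVec,
          Matrix.mul_nonsing_inv _ (by simpa using hdet t ht), Matrix.one_mulVec]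
      exact congrFun h2 e
    simp only [Finset.mul_sum]
    rw [Finset.sum_comm]
    refine Finset.sum_congr rfl fun b _ => ?_
    rw [← mul_assoc, ← h1, Finset.sum_mul]
    exact Finset.sum_congr rfl fun c _ => by ring
  -- With the index lowered, 2 ∇_a n_e = (L_n g)_{ae} + (dw)_{ae}, where w = g(n, ·). Both terms
  -- vanish.
  have hQx : (Q t).mulVec x = 0 := by
    ext e
    change ∑ c, Q t e c * x c = 0
    have hkill := hK t ht a e
    have h1 := hdw a e
    have h2 := hdw e a
    rw [hcl t ht e a] at h2
    simp only [hx, mul_add, Finset.sum_add_distrib, hchr]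
    simp only [lieTensor, Finset.sum_add_distrib] at hkill h1 h2
    simp only [chrLower, add_mul, sub_mul, Finset.sum_add_distrib, Finset.sum_sub_distrib]
    have s1 : ∑ c, Q t c e * ddir (coordFrame a) (fun s => n s c) t
        = ∑ c, Q t e c * ddir (coordFrame a) (fun s => n s c) t :=
      Finset.sum_congr rfl fun c _ => by rw [hsym t ht]
    have s2 : ∑ c, n t c * ddir (coordFrame c) (fun s => Q s a e) t
        = ∑ c, ddir (coordFrame c) (fun s => Q s e a) t * n t c :=
      Finset.sum_congr rfl fun c _ => by
        rw [ddir_congr hV (fun s hs => hsym s hs a e) ht]; ring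
    rw [s1, s2] at hkill
    linarith
  have hx0 : x = 0 := by
    have := congrArg (Q t)⁻¹.mulVec hQx
    rwa [Matrix.mulVec_mulVec, Matrix.nonsing_inv_mul _ (by simpa using hdet t ht),
      Matrix.one_mulVec, Matrix.mulVec_zero] at this
  exact congrFun hx0 c

/-! ### The horizontal lift of a null coordinate field -/

/-- The components of the differential of a function of the orbit coordinates. -/
def orbitForm (F : Orbit → ℝ) (t : Orbit) : Idx → ℝ := Sum.elim (fun i => pd i F t) 0

/-- The lift of `e` to a vector field annihilated by the forms `dzᵏ + f_iᵏ dtⁱ`. -/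
def Coeffs.horizontalLift {V : Set Orbit} (G : Coeffs V) (e : Orbit → Orbit) (t : Orbit) :
    Idx → ℝ :=
  Sum.elim (e t) fun k => -(G.f t 0 k * e t 0 + G.f t 1 k * e t 1)

section
variable {V : Set Orbit} {F : Orbit → ℝ}

theorem smoothOn_orbitForm (hV : IsOpen V) (hF : ContDiffOn ℝ ∞ F V) (a : Idx) :
    ContDiffOn ℝ ∞ (fun t => orbitForm F t a) V := by
  rcases a with i | k
  · exact smoothOn_pd hV hF i
  · exact contDiffOn_const

theorem orbitForm_closed (hV : IsOpen V) (hF : ContDiffOn ℝ ∞ F V) {t : Orbit} (ht : t ∈ V)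
    (a b : Idx) : ddir (coordFrame a) (fun s => orbitForm F s b) t
      = ddir (coordFrame b) (fun s => orbitForm F s a) t := by
  rcases a with i | k <;> rcases b with j | l <;>
    simp only [orbitForm, coordFrame, Sum.elim_inl, Sum.elim_inr, Pi.zero_apply, ddir_const,
      ddir_zero]
  exact ddir_comm hV hF ht

namespace Coeffs
variable (G : Coeffs V)

theorem smoothOn_vertForm (k : Fin 2) (a : Idx) :
    ContDiffOn ℝ ∞ (fun t => G.vertForm t k a) V := by
  rcases a with i | l
  · exact G.f_smooth i k
  · exact contDiffOn_const

theorem vertForm_closed {t : Orbit} {k : Fin 2}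
    (hf : pd 0 (fun s => G.f s 1 k) t - pd 1 (fun s => G.f s 0 k) t = 0) (a b : Idx) :
    ddir (coordFrame a) (fun s => G.vertForm s k b) t
      = ddir (coordFrame b) (fun s => G.vertForm s k a) t := by
  rcases a with i | l <;> rcases b with j | m <;>
    simp only [vertForm, coordFrame, Sum.elim_inl, Sum.elim_inr, ddir_const, ddir_zero]
  have h := sub_eq_zero.1 hf
  change pd i (fun s => G.f s j k) t = pd j (fun s => G.f s i k) t
  fin_cases i <;> fin_cases j <;> first | rfl | exact h | exact h.symm

theorem sum_horizontalLift_vertForm (e : Orbit → Orbit) (t : Orbit) (k : Fin 2) :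
    ∑ c, G.horizontalLift e t c * G.vertForm t k c = 0 := by
  simp only [Fintype.sum_sum_type, horizontalLift, vertForm, Sum.elim_inl, Sum.elim_inr,
    Fin.sum_univ_two]
  fin_cases k <;> simp <;> ring

theorem sum_horizontalLift_orbitForm (e : Orbit → Orbit) (t : Orbit) :
    ∑ c, G.horizontalLift e t c * orbitForm F t c = pd 0 F t * e t 0 + pd 1 F t * e t 1 := by
  simp only [Fintype.sum_sum_type, horizontalLift, orbitForm, Sum.elim_inl, Sum.elim_inr,
    Fin.sum_univ_two, Pi.zero_apply]
  ring

theorem sum_horizontalLift_ddir (e : Orbit → Orbit) (t : Orbit) :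
    ∑ c, G.horizontalLift e t c * ddir (coordFrame c) F t = ddir (e t) F t := by
  simp only [Fintype.sum_sum_type, horizontalLift, coordFrame, Sum.elim_inl, Sum.elim_inr,
    Fin.sum_univ_two, ddir_zero, ddir_eq_pd (v := e t)]
  simp [ddir, pd]

theorem smoothOn_horizontalLift {e : Orbit → Orbit} (he : ∀ i, ContDiffOn ℝ ∞ (fun t => e t i) V)
    (a : Idx) : ContDiffOn ℝ ∞ (fun t => G.horizontalLift e t a) V := by
  rcases a with i | k
  · exact he i
  · exact (((G.f_smooth 0 k).mul (he 0)).add ((G.f_smooth 1 k).mul (he 1))).neg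

theorem comps_symm {t : Orbit} (ht : t ∈ V) (a b : Idx) : G.comps t a b = G.comps t b a := by
  have h1 := (G.gt_symm t ht).apply 0 1
  have h2 := (G.h_symm t ht).apply 0 1
  simp only [comps, Matrix.of_apply, Fin.sum_univ_two, h1, h2]
  ring

/-- The metric as du dv + h_kl Eᵏ Eˡ, spelled out as six products so that `lieTensor_mul` applies to
each. -/
theorem comps_eq {u v : Orbit → ℝ} {t : Orbit}
    (hgt : ∀ i j, G.gt t i j = (1 / 2) * (pd i u t * pd j v t + pd i v t * pd j u t)) (a b : Idx) :
    G.comps t a b = (1 / 2) * (orbitForm u t a * orbitForm v t b)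
      + (1 / 2) * (orbitForm v t a * orbitForm u t b)
      + ((G.h t 0 0 * (G.vertForm t 0 a * G.vertForm t 0 b)
        + G.h t 0 1 * (G.vertForm t 0 a * G.vertForm t 1 b))
      + (G.h t 1 0 * (G.vertForm t 1 a * G.vertForm t 0 b)
        + G.h t 1 1 * (G.vertForm t 1 a * G.vertForm t 1 b))) := by
  have key : ∑ i, ∑ j, G.gt t i j * (Pi.single (Sum.inl i) 1 : Idx → ℝ) a *
      (Pi.single (Sum.inl j) 1 : Idx → ℝ) b = (1 / 2) * (orbitForm u t a * orbitForm v t b)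
      + (1 / 2) * (orbitForm v t a * orbitForm u t b) := by
    rcases a with i | k <;> rcases b with j | l <;>
      simp [orbitForm, Pi.single_apply]
    rw [hgt]; ring
  rw [comps, Matrix.of_apply, key]
  simp only [Fin.sum_univ_two]
  ring

end Coeffs

theorem lieTensor_congr {n : Orbit → Idx → ℝ} (hV : IsOpen V) {M M' : Orbit → Idx → Idx → ℝ}
    (h : ∀ s ∈ V, ∀ a b, M s a b = M' s a b) {t : Orbit} (ht : t ∈ V) (a b : Idx) :
    lieTensor n M a b t = lieTensor n M' a b t := by
  simp only [lieTensor]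
  refine Finset.sum_congr rfl fun c _ => ?_
  rw [ddir_congr hV (fun s hs => h s hs a b) ht, h t ht, h t ht]

theorem lieTensor_add_eq_zero {n : Orbit → Idx → ℝ} (hV : IsOpen V)
    {M M' : Orbit → Idx → Idx → ℝ}
    (hM : ∀ a b, ContDiffOn ℝ ∞ (fun s => M s a b) V)
    (hM' : ∀ a b, ContDiffOn ℝ ∞ (fun s => M' s a b) V) {t : Orbit} (ht : t ∈ V) (a b : Idx)
    (h : lieTensor n M a b t = 0) (h' : lieTensor n M' a b t = 0) :
    lieTensor n (fun s a b => M s a b + M' s a b) a b t = 0 := by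
  rw [lieTensor_add hV hM hM' ht, h, h', add_zero]

end

/-! ### The lift of ∂_v is null, Killing and parallel -/

section
variable {V : Set Orbit} (hV : IsOpen V) {G : Coeffs V} {u v : Orbit → ℝ}
  (hu : ContDiffOn ℝ ∞ u V) (hv : ContDiffOn ℝ ∞ v V)
  (hvol : ∀ t ∈ V, pd 0 u t * pd 1 v t - pd 1 u t * pd 0 v t ≠ 0)
  (hgt : ∀ t ∈ V, ∀ i j, G.gt t i j = (1 / 2) * (pd i u t * pd j v t + pd i v t * pd j u t))

/-- The horizontal lift of the coordinate field `∂_v`. -/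
def nullLift : Orbit → Idx → ℝ :=
  G.horizontalLift (NullFrame.ofCoords hV hu hv hvol hgt).e₂

theorem smoothOn_nullLift (a : Idx) :
    ContDiffOn ℝ ∞ (fun t => nullLift hV hu hv hvol hgt t a) V :=
  G.smoothOn_horizontalLift (NullFrame.smoothOn_e₂ _) a

theorem sum_nullLift_vertForm (t : Orbit) (k : Fin 2) :
    ∑ c, nullLift hV hu hv hvol hgt t c * G.vertForm t k c = 0 :=
  G.sum_horizontalLift_vertForm _ t k

theorem sum_nullLift_u (t : Orbit) : ∑ c, nullLift hV hu hv hvol hgt t c * orbitForm u t c = 0 :=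
  (G.sum_horizontalLift_orbitForm _ t).trans (NullFrame.p_e₂ (NullFrame.ofCoords hV hu hv hvol hgt))

theorem sum_nullLift_v {t : Orbit} (ht : t ∈ V) :
    ∑ c, nullLift hV hu hv hvol hgt t c * orbitForm v t c = 1 :=
  (G.sum_horizontalLift_orbitForm _ t).trans (NullFrame.q_e₂ (NullFrame.ofCoords hV hu hv hvol hgt) ht)

/-- The 1-form dual to the lift of `∂_v` is `du / 2`. -/
theorem comps_nullLift {t : Orbit} (ht : t ∈ V) (a : Idx) :
    ∑ c, G.comps t a c * nullLift hV hu hv hvol hgt t c = (1 / 2) * orbitForm u t a := by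
  have h1 := sum_nullLift_u hV hu hv hvol hgt t
  have h2 := sum_nullLift_v hV hu hv hvol hgt ht
  have h3 := sum_nullLift_vertForm hV hu hv hvol hgt t
  set n := nullLift hV hu hv hvol hgt t
  have key : ∑ c, G.comps t a c * n c = (1 / 2) * orbitForm u t a * ∑ c, n c * orbitForm v t c
      + (1 / 2) * orbitForm v t a * ∑ c, n c * orbitForm u t c
      + (G.h t 0 0 * G.vertForm t 0 a + G.h t 1 0 * G.vertForm t 1 a)
        * ∑ c, n c * G.vertForm t 0 c
      + (G.h t 0 1 * G.vertForm t 0 a + G.h t 1 1 * G.vertForm t 1 a)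
        * ∑ c, n c * G.vertForm t 1 c := by
    simp only [Finset.mul_sum]
    rw [← Finset.sum_add_distrib, ← Finset.sum_add_distrib, ← Finset.sum_add_distrib]
    refine Finset.sum_congr rfl fun c _ => ?_
    rw [G.comps_eq (hgt t ht)]
    ring
  rw [key, h1, h2, h3, h3]
  ring

/-- The metric is built from the forms du, dv, dzᵏ + fᵏ, all closed once the curvature of f
vanishes, whose contractions with the lift are the constants 0, 1, 0; by Cartan's formula they are
invariant. The coefficients h_kl are invariant by `hh`. -/
theorem lieTensor_nullLift
    (hf : ∀ t ∈ V, ∀ k, pd 0 (fun s => G.f s 1 k) t - pd 1 (fun s => G.f s 0 k) t = 0)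
    (hh : ∀ t ∈ V, ∀ k l,
      ddir ((NullFrame.ofCoords hV hu hv hvol hgt).e₂ t) (fun s => G.h s k l) t = 0)
    {t : Orbit} (ht : t ∈ V) (a b : Idx) :
    lieTensor (nullLift hV hu hv hvol hgt) G.comps a b t = 0 := by
  have hn := smoothOn_nullLift hV hu hv hvol hgt
  have sU := smoothOn_orbitForm hV hu
  have sV := smoothOn_orbitForm hV hv
  have sE := G.smoothOn_vertForm
  have lU := fun a => lie_closed_form hV hn sU (fun s _ => sum_nullLift_u hV hu hv hvol hgt s) ht a
    fun c => orbitForm_closed hV hu ht c a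
  have lV := fun a => lie_closed_form hV hn sV (fun s hs => sum_nullLift_v hV hu hv hvol hgt hs) ht
    a fun c => orbitForm_closed hV hv ht c a
  have lE := fun k a => lie_closed_form hV hn (sE k)
    (fun s _ => sum_nullLift_vertForm hV hu hv hvol hgt s k) ht a
    fun c => G.vertForm_closed (hf t ht k) c a
  have hc : ContDiffOn ℝ ∞ (fun _ : Orbit => (1 / 2 : ℝ)) V := contDiffOn_const
  have zc : ∑ c, nullLift hV hu hv hvol hgt t c * ddir (coordFrame c) (fun _ => (1 / 2 : ℝ)) t = 0 :=
    Finset.sum_eq_zero fun c _ => by rw [ddir_const, mul_zero]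
  have zh : ∀ k l, ∑ c, nullLift hV hu hv hvol hgt t c
      * ddir (coordFrame c) (fun s => G.h s k l) t = 0 := fun k l =>
    (G.sum_horizontalLift_ddir _ t).trans (hh t ht k l)
  have s1 := fun a b => hc.mul ((sU a).mul (sV b))
  have s2 := fun a b => hc.mul ((sV a).mul (sU b))
  have s3 := fun k l a b => (G.h_smooth k l).mul ((sE k a).mul (sE l b))
  have z3 := fun k l a b => lieTensor_mul hV (sE k) (sE l) (G.h_smooth k l) ht (zh k l) (lE k)
    (lE l) a b
  rw [lieTensor_congr hV (fun s hs a b => G.comps_eq (hgt s hs) a b) ht]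
  refine lieTensor_add_eq_zero hV (fun a b => (s1 a b).add (s2 a b))
    (fun a b => ((s3 0 0 a b).add (s3 0 1 a b)).add ((s3 1 0 a b).add (s3 1 1 a b))) ht a b ?_ ?_
  · exact lieTensor_add_eq_zero hV s1 s2 ht a b (lieTensor_mul hV sU sV hc ht zc lU lV a b)
      (lieTensor_mul hV sV sU hc ht zc lV lU a b)
  · refine lieTensor_add_eq_zero hV (fun a b => (s3 0 0 a b).add (s3 0 1 a b))
      (fun a b => (s3 1 0 a b).add (s3 1 1 a b)) ht a b ?_ ?_
    · exact lieTensor_add_eq_zero hV (s3 0 0) (s3 0 1) ht a b (z3 0 0 a b) (z3 0 1 a b)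
    · exact lieTensor_add_eq_zero hV (s3 1 0) (s3 1 1) ht a b (z3 1 0 a b) (z3 1 1 a b)

/-- The lift of `∂_v` to the space-time. -/
def nullField (x : Coord) : Coord := nullLift hV hu hv hvol hgt (tPart x)

theorem smoothOn_nullField : ContDiffOn ℝ ∞ (nullField hV hu hv hvol hgt) (cyl V) := by
  rw [contDiffOn_pi]
  exact fun a => (smoothOn_nullLift hV hu hv hvol hgt a).comp tPartL.contDiff.contDiffOn
    fun x hx => hx

theorem pd_nullField {x : Coord} (hx : x ∈ cyl V) (a c : Idx) :
    pd a (fun y => nullField hV hu hv hvol hgt y c) x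
      = ddir (coordFrame a) (fun s => nullLift hV hu hv hvol hgt s c) (tPart x) :=
  pd_comp_tPart (F := fun s => nullLift hV hu hv hvol hgt s c)
    (differentiableAt_of_smoothOn hV (smoothOn_nullLift hV hu hv hvol hgt c) hx) a

theorem isNullField_nullField :
    IsNullField G.metric (nullField hV hu hv hvol hgt) (cyl V) := by
  intro x hx
  have h1 := sum_nullLift_u hV hu hv hvol hgt (tPart x)
  have h2 := comps_nullLift hV hu hv hvol hgt hx
  change ∑ a, ∑ b, G.comps (tPart x) a b * nullLift hV hu hv hvol hgt (tPart x) a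
    * nullLift hV hu hv hvol hgt (tPart x) b = 0
  set n := nullLift hV hu hv hvol hgt (tPart x)
  calc _ = ∑ a, n a * ∑ b, G.comps (tPart x) a b * n b := by
        simp only [Finset.mul_sum]
        exact Finset.sum_congr rfl fun a _ => Finset.sum_congr rfl fun b _ => by ring
    _ = (1 / 2) * ∑ a, n a * orbitForm u (tPart x) a := by
        rw [Finset.mul_sum]
        exact Finset.sum_congr rfl fun a _ => by rw [h2]; ring
    _ = 0 := by rw [h1, mul_zero]

theorem isKillingField_nullField
    (hf : ∀ t ∈ V, ∀ k, pd 0 (fun s => G.f s 1 k) t - pd 1 (fun s => G.f s 0 k) t = 0)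
    (hh : ∀ t ∈ V, ∀ k l,
      ddir ((NullFrame.ofCoords hV hu hv hvol hgt).e₂ t) (fun s => G.h s k l) t = 0) :
    IsKillingField G.metric (nullField hV hu hv hvol hgt) (cyl V) := by
  intro x hx a b
  rw [← lieTensor_nullLift hV hu hv hvol hgt hf hh hx a b]
  refine Finset.sum_congr rfl fun c _ => ?_
  rw [pd_nullField hV hu hv hvol hgt hx, pd_nullField hV hu hv hvol hgt hx]
  have : pd c (fun y => G.metric y a b) x
      = ddir (coordFrame c) (fun s => G.comps s a b) (tPart x) :=
    pd_comp_tPart (F := fun s => G.comps s a b)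
      (differentiableAt_of_smoothOn hV (NullFrame.smoothOn_comps G a b) hx) c
  rw [this]
  rfl

theorem isParallelField_nullField
    (hf : ∀ t ∈ V, ∀ k, pd 0 (fun s => G.f s 1 k) t - pd 1 (fun s => G.f s 0 k) t = 0)
    (hh : ∀ t ∈ V, ∀ k l,
      ddir ((NullFrame.ofCoords hV hu hv hvol hgt).e₂ t) (fun s => G.h s k l) t = 0) :
    IsParallelField G.metric (nullField hV hu hv hvol hgt) (cyl V) := by
  intro x hx a c
  have hs := NullFrame.smoothOn_comps G
  have hdet : ∀ t ∈ V, (G.comps t).det ≠ 0 := fun t ht =>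
    (NullFrame.ofCoords hV hu hv hvol hgt).det_comps ht
  have hcl : ∀ t ∈ V, ∀ a b, ddir (coordFrame a) (fun s => (1 / 2) * orbitForm u s b) t
      = ddir (coordFrame b) (fun s => (1 / 2) * orbitForm u s a) t := fun t ht a b => by
    rw [ddir_const_mul (differentiableAt_of_smoothOn hV (smoothOn_orbitForm hV hu b) ht),
      ddir_const_mul (differentiableAt_of_smoothOn hV (smoothOn_orbitForm hV hu a) ht),
      orbitForm_closed hV hu ht]
  have := isParallelField_of_isKillingField hV hs (fun t ht => G.comps_symm ht) hdet
    (smoothOn_nullLift hV hu hv hvol hgt) (fun t ht => comps_nullLift hV hu hv hvol hgt ht) hcl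
    (fun t ht => lieTensor_nullLift hV hu hv hvol hgt hf hh ht) hx a c
  rw [← this, pd_nullField hV hu hv hvol hgt hx, G.metric_eq]
  congr 1
  exact Finset.sum_congr rfl fun b _ => by
    rw [christoffel_comp_tPart hV hs hx]; rfl

end

/-! ### The normal form -/

/-- The change of adapted coordinates `(t, z) ↦ (u, v, z + ψ)`. -/
def AdaptedChange.ofCoords {V : Set Orbit} {u v : Orbit → ℝ} (hu : ContDiffOn ℝ ∞ u V)
    (hv : ContDiffOn ℝ ∞ v V) (hvol : ∀ t ∈ V, pd 0 u t * pd 1 v t - pd 1 u t * pd 0 v t ≠ 0)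
    (hinj : ∀ s ∈ V, ∀ t ∈ V, u s = u t → v s = v t → s = t) {ψ : Fin 2 → Orbit → ℝ}
    (hψ : ∀ k, ContDiffOn ℝ ∞ (ψ k) V) : AdaptedChange V where
  φ t := ![u t, v t]
  ψ t k := ψ k t
  α := 1
  φ_smooth := by
    rw [contDiffOn_pi, Fin.forall_fin_two]
    exact ⟨hu, hv⟩
  ψ_smooth := contDiffOn_pi.2 hψ
  φ_inj s hs t ht h := hinj s hs t ht (congrFun h 0) (congrFun h 1)
  φ_jac t ht := by
    rw [Matrix.det_fin_two]
    exact hvol t ht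
  α_det := by simp

/-- Since dψᵏ = fᵏ, the new differentials dz̄ᵏ are exactly the forms dzᵏ + fᵏ. The rows of the
Jacobian are therefore the coframe in which the metric is already expressed. -/
theorem AdaptedChange.jac_ofCoords {V : Set Orbit} (hV : IsOpen V) {G : Coeffs V}
    {u v : Orbit → ℝ} (hu : ContDiffOn ℝ ∞ u V) (hv : ContDiffOn ℝ ∞ v V)
    (hvol : ∀ t ∈ V, pd 0 u t * pd 1 v t - pd 1 u t * pd 0 v t ≠ 0)
    (hinj : ∀ s ∈ V, ∀ t ∈ V, u s = u t → v s = v t → s = t) {ψ : Fin 2 → Orbit → ℝ}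
    (hψ : ∀ k, ContDiffOn ℝ ∞ (ψ k) V) (hdψ : ∀ k, ∀ t ∈ V, ∀ i, pd i (ψ k) t = G.f t i k)
    {x : Coord} (hx : x ∈ cyl V) :
    jac (AdaptedChange.ofCoords hu hv hvol hinj hψ).toMap x
      = Matrix.of (Sum.elim ![orbitForm u (tPart x), orbitForm v (tPart x)]
          (G.vertForm (tPart x))) := by
  have horb : ∀ {F : Orbit → ℝ}, ContDiffOn ℝ ∞ F V → ∀ a,
      pd a (fun y => F (tPart y)) x = orbitForm F (tPart x) a := by
    intro F hF a
    rw [pd_comp_tPart (differentiableAt_of_smoothOn hV hF hx)]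
    rcases a with i | k
    · rfl
    · exact ddir_zero
  ext m a
  rcases m with i | k
  · revert i
    rw [Fin.forall_fin_two]
    exact ⟨horb hu a, horb hv a⟩
  · have h1 : (fun y : Coord => (AdaptedChange.ofCoords hu hv hvol hinj hψ).toMap y (inr k))
        = fun y => (ContinuousLinearMap.proj (inr k) : Coord →L[ℝ] ℝ) y + ψ k (tPart y) := by
      ext y
      simp [AdaptedChange.toMap, AdaptedChange.ofCoords, zPart]
    have h2 : DifferentiableAt ℝ (fun y : Coord => ψ k (tPart y)) x :=
      DifferentiableAt.comp x (differentiableAt_of_smoothOn hV (hψ k) hx)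
        tPartL.differentiableAt
    have h3 := horb (hψ k) a
    rw [pd] at h3
    change pd a (fun y : Coord => (AdaptedChange.ofCoords hu hv hvol hinj hψ).toMap y (inr k)) x
      = G.vertForm (tPart x) k a
    rw [h1, pd, fderiv_fun_add (ContinuousLinearMap.differentiableAt _) h2,
      ContinuousLinearMap.fderiv, add_apply, h3]
    rcases a with i | l
    · simp [orbitForm, Coeffs.vertForm, hdψ k _ hx]
    · simp [orbitForm, Coeffs.vertForm, Pi.single_apply, eq_comm]

theorem pullback_ppMetric {Φ : Coord → Coord} {x : Coord} {U V Z₀ Z₁ : Idx → ℝ}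
    (hJ : jac Φ x = Matrix.of (Sum.elim ![U, V] ![Z₀, Z₁])) (ε : ℝ) (R W S : ℝ → ℝ) (a b : Idx) :
    pullback Φ (ppMetric ε R W S) x a b
      = (1 / 2) * (U a * V b + V a * U b)
        + ε * (R (Φ x (inl 0)) ^ 2 * ((Z₀ a + W (Φ x (inl 0)) * Z₁ a)
            * (Z₀ b + W (Φ x (inl 0)) * Z₁ b))
          + S (Φ x (inl 0)) ^ 2 * (Z₁ a * Z₁ b)) := by
  simp only [pullback, hJ, ppMetric, Matrix.mul_apply, Matrix.transpose_apply, Matrix.of_apply,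
    Fintype.sum_sum_type, Fin.sum_univ_two, Sum.elim_inl, Sum.elim_inr, Matrix.cons_val_zero,
    Matrix.cons_val_one, Pi.single_apply, Sum.inl.injEq, Sum.inr.injEq, reduceCtorEq, if_false,
    if_true, zero_ne_one, one_ne_zero]
  ring

/-- The Gram matrix of a definite form in terms of `R, W, S`. -/
theorem gram_eq {ε h0 h1 h2 T r s : ℝ} (hε : ε * ε = 1) (h : 0 < ε * h0)
    (hT : T = h0 * h2 - h1 * h1) (hr : r * r = ε * h0) (hs : s * s = T / (ε * h0)) :
    h0 = ε * (r * r) ∧ h1 = ε * (r * r * (h1 / h0)) ∧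
      h2 = ε * (r * r * (h1 / h0 * (h1 / h0)) + s * s) ∧ T = r * r * (s * s) := by
  have hε0 : ε ≠ 0 := left_ne_zero_of_mul h.ne'
  have h00 : h0 ≠ 0 := right_ne_zero_of_mul h.ne'
  rw [hr, hs]
  refine ⟨?_, ?_, ?_, ?_⟩
  · linear_combination -h0 * hε
  · field_simp
    linear_combination -h1 * hε
  · field_simp
    rw [hT]
    linear_combination -(h1 ^ 2) * hε
  · field_simp

/-- A metric whose leaves have a metric depending only on the null coordinate `u` of the flat orbit
metric is of the form `ppMetric`. -/
theorem exists_ppMetric {V : Set Orbit} (hV : IsOpen V) {G : Coeffs V} {Λ : ℝ}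
    (hvac : IsLambdaVacuum G.metric Λ (cyl V)) {u v : Orbit → ℝ} (hu : ContDiffOn ℝ ∞ u V)
    (hv : ContDiffOn ℝ ∞ v V) (hvol : ∀ t ∈ V, pd 0 u t * pd 1 v t - pd 1 u t * pd 0 v t ≠ 0)
    (hgt : ∀ t ∈ V, ∀ i j, G.gt t i j = (1 / 2) * (pd i u t * pd j v t + pd i v t * pd j u t))
    (hinj : ∀ s ∈ V, ∀ t ∈ V, u s = u t → v s = v t → s = t) {ψ : Fin 2 → Orbit → ℝ}
    (hψ : ∀ k, ContDiffOn ℝ ∞ (ψ k) V) (hdψ : ∀ k, ∀ t ∈ V, ∀ i, pd i (ψ k) t = G.f t i k)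
    (hf : ∀ t ∈ V, ∀ k, pd 0 (fun s => G.f s 1 k) t - pd 1 (fun s => G.f s 0 k) t = 0)
    {I : Set ℝ} (hI : IsOpen I) (huI : ∀ t ∈ V, u t ∈ I) (hsurj : ∀ s ∈ I, ∃ t ∈ V, u t = s)
    {H : ℝ → Fin 2 → Fin 2 → ℝ} (hH : ∀ k l, ContDiffOn ℝ ∞ (fun s => H s k l) I)
    (hGH : ∀ t ∈ V, ∀ k l, G.h t k l = H (u t) k l)
    (hh : ∀ t ∈ V, ∀ k l,
      ddir ((NullFrame.ofCoords hV hu hv hvol hgt).e₂ t) (fun s => G.h s k l) t = 0)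
    {ε : ℝ} (hε : ε * ε = 1) (hpos : ∀ t ∈ V, 0 < ε * G.h t 0 0) (hτ : ∀ t ∈ V, 0 < G.τ t) :
    ∃ (A : AdaptedChange V) (R W S : ℝ → ℝ),
        (∀ t ∈ V, A.φ t 0 ∈ I) ∧
        ContDiffOn ℝ ∞ R I ∧ ContDiffOn ℝ ∞ W I ∧ ContDiffOn ℝ ∞ S I ∧
        (∀ s ∈ I, R s * S s ≠ 0) ∧
        (∀ s ∈ I, deriv W s ^ 2 = -(2 * S s ^ 2 / R s ^ 2) *
            (deriv (deriv R) s / R s + deriv (deriv S) s / S s)) ∧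
        (∀ x ∈ cyl V, G.metric x = pullback A.toMap (ppMetric ε R W S) x) ∧
        ∃ N : Coord → Coord,
          ContDiffOn ℝ ∞ N (cyl V) ∧
          (∀ x ∈ cyl V, (jac A.toMap x).mulVec (N x) = Pi.single (Sum.inl 1) 1) ∧
          IsNullField G.metric N (cyl V) ∧
          IsKillingField G.metric N (cyl V) ∧
          IsParallelField G.metric N (cyl V) := by
  set T : ℝ → ℝ := fun s => H s 0 0 * H s 1 1 - H s 0 1 * H s 0 1 with hTdef
  have hTs : ContDiffOn ℝ ∞ T I := ((hH 0 0).mul (hH 1 1)).sub ((hH 0 1).mul (hH 0 1))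
  -- Every `s` in `I` is a value of u on V, which transfers the sign conditions from V to the
  -- interval.
  have hHpos : ∀ s ∈ I, 0 < ε * H s 0 0 := fun s hs => by
    obtain ⟨t, ht, rfl⟩ := hsurj s hs
    rw [← hGH t ht]; exact hpos t ht
  have hTpos : ∀ s ∈ I, 0 < T s := fun s hs => by
    obtain ⟨t, ht, rfl⟩ := hsurj s hs
    have := hτ t ht
    rw [G.τ_eq ht] at this
    simpa only [hTdef, ← hGH t ht] using this
  have hH00 : ∀ s ∈ I, H s 0 0 ≠ 0 := fun s hs => right_ne_zero_of_mul (hHpos s hs).ne'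
  have hεH : ContDiffOn ℝ ∞ (fun s => ε * H s 0 0) I := contDiffOn_const.mul (hH 0 0)
  -- These come from completing the square in dz¹: R² = ε h₀₀, W = h₀₁ / h₀₀, and S² = det h / (ε
  -- h₀₀).
  set R : ℝ → ℝ := fun s => √(ε * H s 0 0) with hRdef
  set W : ℝ → ℝ := fun s => H s 0 1 / H s 0 0 with hWdef
  set S : ℝ → ℝ := fun s => √(T s / (ε * H s 0 0)) with hSdef
  have hquot : ∀ s ∈ I, 0 < T s / (ε * H s 0 0) := fun s hs => div_pos (hTpos s hs) (hHpos s hs)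
  have hR : ContDiffOn ℝ ∞ R I := hεH.sqrt fun s hs => (hHpos s hs).ne'
  have hW : ContDiffOn ℝ ∞ W I := (hH 0 1).div (hH 0 0) hH00
  have hS : ContDiffOn ℝ ∞ S I := (hTs.div hεH fun s hs => (hHpos s hs).ne').sqrt
    fun s hs => (hquot s hs).ne'
  have hR0 : ∀ s ∈ I, R s ≠ 0 := fun s hs => (Real.sqrt_pos.2 (hHpos s hs)).ne'
  have hS0 : ∀ s ∈ I, S s ≠ 0 := fun s hs => (Real.sqrt_pos.2 (hquot s hs)).ne'
  have hgram : ∀ s ∈ I, H s 0 0 = ε * (R s * R s) ∧ H s 0 1 = ε * (R s * R s * W s) ∧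
      H s 1 1 = ε * (R s * R s * (W s * W s) + S s * S s) ∧ T s = R s * R s * (S s * S s) :=
    fun s hs => gram_eq (h1 := H s 0 1) (h2 := H s 1 1) hε (hHpos s hs) rfl
    (Real.mul_self_sqrt (hHpos s hs).le) (Real.mul_self_sqrt (hquot s hs).le)
  have hJ := fun {x} hx =>
    AdaptedChange.jac_ofCoords hV (G := G) hu hv hvol hinj hψ hdψ (x := x) hx
  refine ⟨AdaptedChange.ofCoords hu hv hvol hinj hψ, R, W, S, huI, hR, hW, hS,
    fun s hs => mul_ne_zero (hR0 s hs) (hS0 s hs), fun s hs => ?_, fun x hx => ?_,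
    nullField hV hu hv hvol hgt, smoothOn_nullField hV hu hv hvol hgt, fun x hx => ?_,
    isNullField_nullField hV hu hv hvol hgt, isKillingField_nullField hV hu hv hvol hgt hf hh,
    isParallelField_nullField hV hu hv hvol hgt hf hh⟩
  · refine ode_of_field_eq hI hε hR hW hS hR0 hS0 (fun s hs => (hgram s hs).1)
      (fun s hs => (hgram s hs).2.1) (fun s hs => (hgram s hs).2.2.1)
      (fun s hs => (hgram s hs).2.2.2) hs ?_
    obtain ⟨t, ht, rfl⟩ := hsurj s hs
    exact field_eq_of_null_coords hV hvac hu hv hvol hgt hI huI hH hGH (fun _ => rfl) ht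
  · ext a b
    have hrow : G.vertForm (tPart x) = ![G.vertForm (tPart x) 0, G.vertForm (tPart x) 1] := by
      ext k; fin_cases k <;> rfl
    have hJx := hJ hx
    rw [hrow] at hJx
    obtain ⟨g0, g1, g2, -⟩ := hgram (u (tPart x)) (huI _ hx)
    have hcomps := G.comps_eq (hgt _ hx) a b
    rw [G.h10 hx, hGH _ hx, hGH _ hx, hGH _ hx] at hcomps
    rw [pullback_ppMetric hJx]
    refine hcomps.trans ?_
    change _ = _ + ε * (R (u (tPart x)) ^ 2 * ((_ + W (u (tPart x)) * _) *
      (_ + W (u (tPart x)) * _)) + S (u (tPart x)) ^ 2 * _)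
    set Z := G.vertForm (tPart x)
    linear_combination (Z 0 a * Z 0 b) * g0 + (Z 0 a * Z 1 b + Z 1 a * Z 0 b) * g1
      + (Z 1 a * Z 1 b) * g2
  · have h1 := sum_nullLift_u hV hu hv hvol hgt (tPart x)
    have h2 := sum_nullLift_v hV hu hv hvol hgt hx
    have h3 := sum_nullLift_vertForm hV hu hv hvol hgt (tPart x)
    rw [hJ hx]
    have hm : ∀ (y : Idx → ℝ), ∑ c, y c * nullLift hV hu hv hvol hgt (tPart x) c
        = ∑ c, nullLift hV hu hv hvol hgt (tPart x) c * y c :=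
      fun y => Finset.sum_congr rfl fun c _ => mul_comm _ _
    ext m
    rcases m with i | k
    · revert i
      rw [Fin.forall_fin_two]
      exact ⟨(hm _).trans (h1.trans (by simp)), (hm _).trans (h2.trans (by simp))⟩
    · exact (hm _).trans ((h3 k).trans (by simp))

/-! ### Charts of null coordinates -/

/-- Null coordinates `u, v` of a flat orbit metric, with inverse `Θ` defined on a square. The indices
`i, j` are those of the coordinates `u, v` in the square. -/
structure NullChart {V : Set Orbit} (G : Coeffs V) (u v : Orbit → ℝ) (Θ : Orbit → Orbit) (c : Orbit)
    (r : ℝ) (i j : Fin 2) : Prop where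
  isOpen : IsOpen V
  smooth_u : ContDiffOn ℝ ∞ u V
  smooth_v : ContDiffOn ℝ ∞ v V
  vol : ∀ t ∈ V, pd 0 u t * pd 1 v t - pd 1 u t * pd 0 v t ≠ 0
  gt_eq : ∀ t ∈ V, ∀ i j, G.gt t i j = (1 / 2) * (pd i u t * pd j v t + pd i v t * pd j u t)
  ne : j ≠ i
  cover : ∀ k, k = i ∨ k = j
  smooth_Θ : ContDiffOn ℝ ∞ Θ (Metric.ball c r)
  mapsTo : Set.MapsTo Θ (Metric.ball c r) V
  u_Θ : ∀ y ∈ Metric.ball c r, u (Θ y) = y i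
  v_Θ : ∀ y ∈ Metric.ball c r, v (Θ y) = y j
  mem : ∀ t ∈ V, ∀ y : Orbit, y i = u t → y j = v t → y ∈ Metric.ball c r ∧ Θ y = t

namespace NullChart

variable {V : Set Orbit} {G : Coeffs V} {u v : Orbit → ℝ} {Θ : Orbit → Orbit} {c : Orbit} {r : ℝ}
  {i j : Fin 2}

/-- The roles of u and v are exchanged without touching Θ or the square. The indices `i`, `j` are
parameters of the structure for this purpose, so that the coordinate along which τ is constant can
always be called v. -/
theorem swap (C : NullChart G u v Θ c r i j) : NullChart G v u Θ c r j i where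
  isOpen := C.isOpen
  smooth_u := C.smooth_v
  smooth_v := C.smooth_u
  vol t ht h := C.vol t ht (by linarith)
  gt_eq t ht i j := by rw [C.gt_eq t ht]; ring
  ne := C.ne.symm
  cover k := (C.cover k).symm
  smooth_Θ := C.smooth_Θ
  mapsTo := C.mapsTo
  u_Θ := C.v_Θ
  v_Θ := C.u_Θ
  mem t ht y hv hu := C.mem t ht y hu hv

/-- The null frame `∂_u, ∂_v`. -/
def frame (C : NullChart G u v Θ c r i j) : NullFrame G :=
  NullFrame.ofCoords C.isOpen C.smooth_u C.smooth_v C.vol C.gt_eq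

theorem swap_frame_e₂ (C : NullChart G u v Θ c r i j) (t : Orbit) :
    C.swap.frame.e₂ t = C.frame.e₁ t :=
  C.frame.swap_e₂ t

theorem fderiv_comp (C : NullChart G u v Θ c r i j) {F : Orbit → ℝ} (hF : ContDiffOn ℝ ∞ F V)
    {y : Orbit} (hy : y ∈ Metric.ball c r) (w : Orbit) :
    fderiv ℝ (fun y => F (Θ y)) y w = fderiv ℝ F (Θ y) (fderiv ℝ Θ y w) := by
  have h1 : DifferentiableAt ℝ Θ y :=
    (C.smooth_Θ.contDiffAt (Metric.isOpen_ball.mem_nhds hy)).differentiableAt (by simp)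
  have h2 := (differentiableAt_of_smoothOn C.isOpen hF (C.mapsTo hy)).hasFDerivAt.comp y
    h1.hasFDerivAt
  rw [show (fun y => F (Θ y)) = F ∘ Θ from rfl, h2.fderiv]
  rfl

/-- The image under dΘ of the j-th unit vector satisfies du = 0 and dv = 1; by Cramer's rule it is
e₂ = ∂_v. -/
theorem pd_comp (C : NullChart G u v Θ c r i j) {F : Orbit → ℝ} (hF : ContDiffOn ℝ ∞ F V)
    {y : Orbit} (hy : y ∈ Metric.ball c r) :
    pd j (fun y => F (Θ y)) y = ddir (C.frame.e₂ (Θ y)) F (Θ y) := by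
  have hproj : ∀ k l : Fin 2, fderiv ℝ (fun y : Orbit => y k) y (Pi.single l 1)
      = (Pi.single l 1 : Orbit) k := fun k l => by
    rw [show (fun y : Orbit => y k) = (ContinuousLinearMap.proj k : Orbit →L[ℝ] ℝ) from rfl,
      ContinuousLinearMap.fderiv]
    rfl
  set w := fderiv ℝ Θ y (Pi.single j 1) with hw
  have hu : fderiv ℝ u (Θ y) w = 0 := by
    rw [hw, ← C.fderiv_comp C.smooth_u hy]
    have := ddir_congr (v := Pi.single j 1) Metric.isOpen_ball C.u_Θ hy
    refine this.trans ((hproj i j).trans ?_)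
    simp [C.ne.symm]
  have hv : fderiv ℝ v (Θ y) w = 1 := by
    rw [hw, ← C.fderiv_comp C.smooth_v hy]
    have := ddir_congr (v := Pi.single j 1) Metric.isOpen_ball C.v_Θ hy
    refine this.trans ((hproj j j).trans ?_)
    simp
  rw [fderiv_eq_pd] at hu hv
  have hvol : C.frame.vol (Θ y) ≠ 0 := C.frame.vol_ne _ (C.mapsTo hy)
  have hwe : w = C.frame.e₂ (Θ y) := by
    ext k
    revert k
    rw [Fin.forall_fin_two]
    change w 0 = -C.frame.p (Θ y) 1 / _ ∧ w 1 = C.frame.p (Θ y) 0 / _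
    rw [eq_div_iff hvol, eq_div_iff hvol]
    change w 0 * (pd 0 u _ * pd 1 v _ - pd 1 u _ * pd 0 v _) = -pd 1 u _
      ∧ w 1 * (pd 0 u _ * pd 1 v _ - pd 1 u _ * pd 0 v _) = pd 0 u _
    constructor
    · linear_combination pd 1 v (Θ y) * hu - pd 1 u (Θ y) * hv
    · linear_combination pd 0 u (Θ y) * hv - pd 0 v (Θ y) * hu
  rw [← hwe]
  exact C.fderiv_comp hF hy _

/-- The hypothesis `hj` says ∂_v τ = 0. The field equations propagate this from τ to h, which is
thus a function of u alone on the square. -/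
theorem exists_ppMetric (C : NullChart G u v Θ c r i j) {Λ : ℝ}
    (hvac : IsLambdaVacuum G.metric Λ (cyl V)) {ψ : Fin 2 → Orbit → ℝ}
    (hψ : ∀ k, ContDiffOn ℝ ∞ (ψ k) V) (hdψ : ∀ k, ∀ t ∈ V, ∀ i, pd i (ψ k) t = G.f t i k)
    (hf : ∀ t ∈ V, ∀ k, pd 0 (fun s => G.f s 1 k) t - pd 1 (fun s => G.f s 0 k) t = 0)
    {ε : ℝ} (hε : ε * ε = 1) (hpos : ∀ t ∈ V, 0 < ε * G.h t 0 0) (hτ : ∀ t ∈ V, 0 < G.τ t)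
    (hj : ∀ y ∈ Metric.ball c r, pd j (fun y => G.τ (Θ y)) y = 0) :
    ∃ (A : AdaptedChange V) (a b : ℝ) (R W S : ℝ → ℝ),
        (∀ t ∈ V, A.φ t 0 ∈ Set.Ioo a b) ∧
        ContDiffOn ℝ ∞ R (Set.Ioo a b) ∧ ContDiffOn ℝ ∞ W (Set.Ioo a b) ∧
        ContDiffOn ℝ ∞ S (Set.Ioo a b) ∧
        (∀ s ∈ Set.Ioo a b, R s * S s ≠ 0) ∧
        (∀ s ∈ Set.Ioo a b, deriv W s ^ 2 = -(2 * S s ^ 2 / R s ^ 2) *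
            (deriv (deriv R) s / R s + deriv (deriv S) s / S s)) ∧
        (∀ x ∈ cyl V, G.metric x = pullback A.toMap (ppMetric ε R W S) x) ∧
        ∃ N : Coord → Coord,
          ContDiffOn ℝ ∞ N (cyl V) ∧
          (∀ x ∈ cyl V, (jac A.toMap x).mulVec (N x) = Pi.single (Sum.inl 1) 1) ∧
          IsNullField G.metric N (cyl V) ∧
          IsKillingField G.metric N (cyl V) ∧
          IsParallelField G.metric N (cyl V) := by
  have hpre : ∀ t ∈ V, ∃ y ∈ Metric.ball c r, Θ y = t ∧ y i = u t := fun t ht => by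
    -- The updated constant function is the point of the square with i-th coordinate u(t) and j-th
    -- coordinate v(t).
    have hi : Function.update (fun _ => v t) i (u t) i = u t := Function.update_self ..
    obtain ⟨h1, h2⟩ := C.mem t ht (Function.update (fun _ => v t) i (u t)) hi
      (Function.update_of_ne C.ne ..)
    exact ⟨_, h1, h2, hi⟩
  have hτe : ∀ t ∈ V, ddir (C.frame.e₂ t) G.τ t = 0 := fun t ht => by
    obtain ⟨y, hy, rfl, -⟩ := hpre t ht
    rw [← C.pd_comp (smoothOn_τ G) hy, hj y hy]
  have hh : ∀ t ∈ V, ∀ k l, ddir (C.frame.e₂ t) (fun s => G.h s k l) t = 0 := fun t ht k l =>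
    C.frame.const_e₂_of_τ C.isOpen hvac hτ hτe ht k l
  have hline : ∀ s ∈ Set.Ioo (c i - r) (c i + r), Function.update c i s ∈ Metric.ball c r := by
    intro s hs
    have hr : 0 < r := by linarith [hs.1, hs.2]
    rw [Metric.mem_ball, dist_pi_lt_iff hr]
    intro k
    rcases C.cover k with rfl | rfl
    · rw [Function.update_self, Real.dist_eq, abs_lt]
      exact ⟨by linarith [hs.1], by linarith [hs.2]⟩
    · rw [Function.update_of_ne C.ne, dist_self]
      exact hr
  have huI : ∀ t ∈ V, u t ∈ Set.Ioo (c i - r) (c i + r) := fun t ht => by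
    obtain ⟨y, hy, -, hyu⟩ := hpre t ht
    have hr : 0 < r := Metric.pos_of_mem_ball hy
    rw [Metric.mem_ball, dist_pi_lt_iff hr] at hy
    have := hy i
    rw [Real.dist_eq, abs_lt] at this
    rw [← hyu]
    exact ⟨by linarith [this.1], by linarith [this.2]⟩
  have hΘline : ContDiffOn ℝ ∞ (fun s => Θ (Function.update c i s))
      (Set.Ioo (c i - r) (c i + r)) :=
    C.smooth_Θ.comp (contDiff_update ∞ c i).contDiffOn hline
  have hmain := G2.exists_ppMetric C.isOpen hvac C.smooth_u C.smooth_v C.vol C.gt_eq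
    (fun s hs t ht hu hv => by
      obtain ⟨y, hy, rfl, hyu⟩ := hpre s hs
      exact (C.mem t ht y (hyu.trans hu) ((C.v_Θ y hy).symm.trans hv)).2)
    hψ hdψ hf (I := Set.Ioo (c i - r) (c i + r)) isOpen_Ioo huI
    (fun s hs => ⟨Θ (Function.update c i s), C.mapsTo (hline s hs),
      (C.u_Θ _ (hline s hs)).trans (Function.update_self ..)⟩)
    -- The one-variable leaf metric is h along the line v = const through the centre of the square;
    -- by `eq_of_pd_eq_zero` any other such line gives the same values.
    (H := fun s k l => G.h (Θ (Function.update c i s)) k l)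
    (fun k l => (G.h_smooth k l).comp hΘline fun s hs => C.mapsTo (hline s hs))
    (fun t ht k l => by
      obtain ⟨y, hy, rfl, hyu⟩ := hpre t ht
      refine eq_of_pd_eq_zero (F := fun y => G.h (Θ y) k l)
        ((G.h_smooth k l).comp C.smooth_Θ C.mapsTo) C.cover (fun y hy => ?_) hy
        (hline _ (huI _ ht)) (by rw [Function.update_self, hyu])
      rw [C.pd_comp (G.h_smooth k l) hy, hh _ (C.mapsTo hy)])
    hh hε hpos hτ
  obtain ⟨A, R, W, S, h⟩ := hmain
  exact ⟨A, _, _, R, W, S, h⟩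

end NullChart

/-! ### Orthogonal transitivity -/

theorem fderiv_comp_tPart {F : Orbit → ℝ} {x : Coord} (hF : DifferentiableAt ℝ F (tPart x))
    (w : Coord) : fderiv ℝ (fun y => F (tPart y)) x w = ∑ b, w b * ddir (coordFrame b) F (tPart x) := by
  have hw : w = ∑ b, w b • (Pi.single b 1 : Coord) := by
    ext b; simp [Finset.sum_apply, Pi.single_apply]
  conv_lhs => rw [hw]
  rw [map_sum]
  refine Finset.sum_congr rfl fun b _ => ?_
  rw [map_smul, smul_eq_mul, ← pd_comp_tPart hF]
  rfl

/-- The Lie bracket of two fields annihilated by a closed 1-form is annihilated by it. -/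
theorem closed_form_lieBracket {U : Set Orbit} (hU : IsOpen U) {E : Orbit → Idx → ℝ}
    (hE : ∀ c, ContDiffOn ℝ ∞ (fun s => E s c) U)
    (hcl : ∀ t ∈ U, ∀ a b, ddir (coordFrame a) (fun s => E s b) t
      = ddir (coordFrame b) (fun s => E s a) t) {O : Set Coord} (hO : IsOpen O) (hOU : O ⊆ cyl U)
    {X Y : Coord → Coord} (hX : ContDiffOn ℝ ∞ X O) (hY : ContDiffOn ℝ ∞ Y O)
    (h0X : ∀ x ∈ O, ∑ a, E (tPart x) a * X x a = 0) (h0Y : ∀ x ∈ O, ∑ a, E (tPart x) a * Y x a = 0)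
    {x : Coord} (hx : x ∈ O) :
    ∑ a, E (tPart x) a * VectorField.lieBracket ℝ X Y x a = 0 := by
  have key : ∀ {X : Coord → Coord}, ContDiffOn ℝ ∞ X O → (∀ x ∈ O, ∑ a, E (tPart x) a * X x a = 0) →
      ∀ w, ∑ a, E (tPart x) a * fderiv ℝ X x w a
        = -∑ a, ∑ b, w b * ddir (coordFrame b) (fun s => E s a) (tPart x) * X x a := by
    intro X hX h0 w
    have hXd : DifferentiableAt ℝ X x :=
      (hX.contDiffAt (hO.mem_nhds hx)).differentiableAt (by simp)
    have hXa := differentiableAt_pi.1 hXd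
    have hEd := fun a => differentiableAt_of_smoothOn hU (hE a) (hOU hx)
    have hEx : ∀ a, DifferentiableAt ℝ (fun y => E (tPart y) a) x := fun a =>
      DifferentiableAt.comp x (hEd a) tPartL.differentiableAt
    have h1 : fderiv ℝ (fun y => ∑ a, E (tPart y) a * X y a) x w = 0 := by
      rw [Filter.EventuallyEq.fderiv_eq (f := fun _ : Coord => (0 : ℝ))
        (Filter.eventuallyEq_of_mem (hO.mem_nhds hx) h0)]
      simp
    rw [fderiv_fun_sum fun a _ => (hEx a).fun_mul (hXa a)] at h1
    rw [eq_neg_iff_add_eq_zero, ← h1, sum_apply, ← Finset.sum_add_distrib]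
    refine Finset.sum_congr rfl fun a _ => ?_
    rw [fderiv_fun_mul (hEx a) (hXa a), ← Finset.sum_mul, ← fderiv_comp_tPart (hEd a), fderiv_pi hXa]
    simp
    ring
  have hX' := key hX h0X (Y x)
  have hY' := key hY h0Y (X x)
  simp only [VectorField.lieBracket, Pi.sub_apply, mul_sub, Finset.sum_sub_distrib]
  rw [hX', hY', Finset.sum_comm, sub_neg_eq_add, neg_add_eq_zero]
  refine Finset.sum_congr rfl fun a _ => Finset.sum_congr rfl fun b _ => ?_
  rw [hcl _ (hOU hx)]
  ring

theorem Coeffs.inner_single {U : Set Orbit} (G : Coeffs U) (x X : Coord) (k : Fin 2) :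
    inner G.metric x X (Pi.single (Sum.inr k) 1)
      = ∑ l, (∑ a, G.vertForm (tPart x) l a * X a) * G.h (tPart x) l k := by
  simp [inner, Coeffs.metric, Coeffs.vertForm, Fintype.sum_sum_type, Fin.sum_univ_two,
    Pi.single_apply]
  fin_cases k <;> simp <;> ring

/-- By non-degeneracy of h, orthogonality to the leaves means annihilation by both forms dzᵏ + fᵏ.
These are closed, and the common kernel of closed 1-forms is closed under brackets. -/
theorem Coeffs.isOrthogonallyTransitive {U : Set Orbit} (hU : IsOpen U) (G : Coeffs U)
    (hf : ∀ t ∈ U, ∀ k, pd 0 (fun s => G.f s 1 k) t - pd 1 (fun s => G.f s 0 k) t = 0) :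
    IsOrthogonallyTransitive G.metric (cyl U) := by
  intro O hO hOU X Y hX hY h0X h0Y x hx k
  have key : ∀ {X : Coord → Coord},
      (∀ x ∈ O, ∀ k : Fin 2, inner G.metric x (X x) (Pi.single (Sum.inr k) 1) = 0) →
      ∀ x ∈ O, ∀ l, ∑ a, G.vertForm (tPart x) l a * X x a = 0 := by
    intro X h x hx l
    refine congrFun (Matrix.eq_zero_of_vecMul_eq_zero (G.h_det _ (hOU hx))
      (v := fun l => ∑ a, G.vertForm (tPart x) l a * X x a) ?_) l
    ext k
    exact (G.inner_single x (X x) k).symm.trans (h x hx k)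
  rw [G.inner_single]
  refine Finset.sum_eq_zero fun l _ => ?_
  rw [closed_form_lieBracket hU (G.smoothOn_vertForm l)
    (fun t ht => G.vertForm_closed (hf t ht l)) hO hOU hX hY (fun x hx => key h0X x hx l)
    (fun x hx => key h0Y x hx l) hx, zero_mul]

/-! ### The local normal form -/

theorem posDef_fin_two {M : Matrix (Fin 2) (Fin 2) ℝ} (hs : M.IsSymm) (h0 : 0 < M 0 0)
    (hd : 0 < M.det) : M.PosDef := by
  refine Matrix.PosDef.of_dotProduct_mulVec_pos ?_ fun x hx => ?_
  · rw [Matrix.IsHermitian, Matrix.conjTranspose_eq_transpose_of_trivial]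
    exact hs
  · have h10 : M 1 0 = M 0 1 := hs.apply 0 1
    rw [Matrix.det_fin_two, h10] at hd
    simp only [dotProduct, Matrix.mulVec, Fin.sum_univ_two, Pi.star_apply, star_trivial, h10]
    -- After multiplication by M₀₀ > 0 the quadratic form is a sum of two squares with positive
    -- weights.
    refine pos_of_mul_pos_right (a := M 0 0) ?_ h0.le
    have key : M 0 0 * (x 0 * (M 0 0 * x 0 + M 0 1 * x 1) + x 1 * (M 0 1 * x 0 + M 1 1 * x 1))
        = (M 0 0 * x 0 + M 0 1 * x 1) ^ 2 + (M 0 0 * M 1 1 - M 0 1 * M 0 1) * x 1 ^ 2 := by ring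
    rw [key]
    by_cases h1 : x 1 = 0
    · have h2 : x 0 ≠ 0 := fun h => hx (by ext i; fin_cases i <;> assumption)
      have := mul_ne_zero h0.ne' h2
      rw [h1, mul_zero, add_zero]
      positivity
    · positivity

namespace Coeffs

variable {U : Set Orbit} (G : Coeffs U)

/-- A symmetric 2 × 2 matrix with positive determinant is definite, and h₀₀ shows the sign. -/
theorem exists_sign {t : Orbit} (ht : t ∈ U) (hH : 0 < (G.h t).det) :
    ∃ ε : ℝ, ε * ε = 1 ∧ 0 < ε * G.h t 0 0 ∧
      ((ε = 1 ∧ (G.h t).PosDef) ∨ (ε = -1 ∧ (-(G.h t)).PosDef)) := by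
  have hs := G.h_symm t ht
  have h00 : G.h t 0 0 ≠ 0 := fun h => by
    rw [Matrix.det_fin_two, h, hs.apply 0 1] at hH
    nlinarith [mul_self_nonneg (G.h t 0 1)]
  rcases h00.lt_or_gt with h | h
  · refine ⟨-1, by norm_num, by linarith, Or.inr ⟨rfl, posDef_fin_two ?_ ?_ ?_⟩⟩
    · exact hs.neg
    · simpa using h
    · rwa [Matrix.det_neg, Fintype.card_fin, neg_one_sq, one_mul]
  · exact ⟨1, by norm_num, by linarith, Or.inl ⟨rfl, posDef_fin_two hs h hH⟩⟩

/-- Null frames exist only locally, but Λ and the curl of f do not refer to them, so the conclusion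
holds on all of U. -/
theorem flat_of_Crho (hU : IsOpen U) {Λ : ℝ} (hvac : IsLambdaVacuum G.metric Λ (cyl U))
    (hC : ∀ t ∈ U, G.Crho t = 0) (hgt : ∀ t ∈ U, (G.gt t).det < 0)
    (hH : ∀ t ∈ U, 0 < (G.h t).det) {t : Orbit} (ht : t ∈ U) :
    Λ = 0 ∧ ∀ k, pd 0 (fun s => G.f s 1 k) t - pd 1 (fun s => G.f s 0 k) t = 0 := by
  obtain ⟨V, hVU, hV, htV, ⟨N⟩⟩ := exists_nullFrame hU G hgt ht
  obtain ⟨h1, h2, -⟩ := N.isFlatAt hV (hvac.restrict hVU) (fun s hs => hH s (hVU hs))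
    (fun s hs => hC s (hVU hs)) htV
  exact ⟨h1, h2⟩

/-- A closed `f` is the differential of smooth functions on convex sets. -/
theorem exists_potential (hU : IsOpen U) (hc : Convex ℝ U)
    (hf : ∀ t ∈ U, ∀ k, pd 0 (fun s => G.f s 1 k) t - pd 1 (fun s => G.f s 0 k) t = 0) :
    ∃ ψ : Fin 2 → Orbit → ℝ, (∀ k, ContDiffOn ℝ ∞ (ψ k) U) ∧
      ∀ k, ∀ t ∈ U, ∀ i, pd i (ψ k) t = G.f t i k := by
  have := fun k => exists_primitive hU hc (α := fun i t => G.f t i k) (fun i => G.f_smooth i k)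
    fun t ht => hf t ht k
  choose ψ h1 h2 using this
  exact ⟨ψ, h1, h2⟩

theorem exists_nullChart (hU : IsOpen U) {u v : Orbit → ℝ} (hu : ContDiffOn ℝ ∞ u U)
    (hv : ContDiffOn ℝ ∞ v U) (hvol : ∀ t ∈ U, pd 0 u t * pd 1 v t - pd 1 u t * pd 0 v t ≠ 0)
    (hgt : ∀ t ∈ U, ∀ i j, G.gt t i j = (1 / 2) * (pd i u t * pd j v t + pd i v t * pd j u t))
    {t₀ : Orbit} (ht₀ : t₀ ∈ U) :
    ∃ (V : Set Orbit) (hV : V ⊆ U) (Θ : Orbit → Orbit) (c : Orbit) (r : ℝ), t₀ ∈ V ∧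
      NullChart (G.restrict hV) u v Θ c r 0 1 := by
  have hΦ : ContDiffOn ℝ ∞ (fun t => (![u t, v t] : Orbit)) U := by
    rw [contDiffOn_pi, Fin.forall_fin_two]
    exact ⟨hu, hv⟩
  obtain ⟨r, Θ, V, -, hV, htV, hVU, hΘ, hmaps, hΦΘ, hmapsΦ, hΘΦ⟩ :=
    exists_local_coords hU hΦ (fun t ht w hw => by
      have hd : ∀ i, DifferentiableAt ℝ (fun s => (![u s, v s] : Orbit) i) t := by
        rw [Fin.forall_fin_two]
        exact ⟨differentiableAt_of_smoothOn hU hu ht, differentiableAt_of_smoothOn hU hv ht⟩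
      rw [fderiv_pi hd] at hw
      have h0 : fderiv ℝ u t w = 0 := congrFun hw 0
      have h1 : fderiv ℝ v t w = 0 := congrFun hw 1
      rw [fderiv_eq_pd] at h0 h1
      ext i
      refine (mul_eq_zero.1 ?_).resolve_right (hvol t ht)
      revert i
      rw [Fin.forall_fin_two]
      constructor
      · linear_combination pd 1 v t * h0 - pd 1 u t * h1
      · linear_combination pd 0 u t * h1 - pd 0 v t * h0) ht₀
  refine ⟨V, hVU, Θ, ![u t₀, v t₀], r, htV, ?_⟩
  exact
    { isOpen := hV
      smooth_u := hu.mono hVU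
      smooth_v := hv.mono hVU
      vol := fun t ht => hvol t (hVU ht)
      gt_eq := fun t ht => hgt t (hVU ht)
      ne := one_ne_zero
      cover := by simp [Fin.forall_fin_two]
      smooth_Θ := hΘ
      mapsTo := hmaps
      u_Θ := fun y hy => congrFun (hΦΘ y hy) 0
      v_Θ := fun y hy => congrFun (hΦΘ y hy) 1
      mem := fun t ht y h0 h1 => by
        have hy : y = ![u t, v t] := by
          ext k; revert k; rw [Fin.forall_fin_two]; exact ⟨h0, h1⟩
        rw [hy]
        exact ⟨hmapsΦ ht, hΘΦ t ht⟩ }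

theorem exists_local_ppMetric (hU : IsOpen U) {Λ : ℝ} (hvac : IsLambdaVacuum G.metric Λ (cyl U))
    (hC : ∀ t ∈ U, G.Crho t = 0) (hgt : ∀ t ∈ U, (G.gt t).det < 0)
    (hH : ∀ t ∈ U, 0 < (G.h t).det) {t₀ : Orbit} (ht₀ : t₀ ∈ U) {ε : ℝ} (hε : ε * ε = 1)
    (hpos : 0 < ε * G.h t₀ 0 0) :
    ∃ V : Set Orbit, IsOpen V ∧ t₀ ∈ V ∧ V ⊆ U ∧
      ∃ (A : AdaptedChange V) (a b : ℝ) (R W S : ℝ → ℝ),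
        (∀ t ∈ V, A.φ t 0 ∈ Set.Ioo a b) ∧
        ContDiffOn ℝ ∞ R (Set.Ioo a b) ∧ ContDiffOn ℝ ∞ W (Set.Ioo a b) ∧
        ContDiffOn ℝ ∞ S (Set.Ioo a b) ∧
        (∀ s ∈ Set.Ioo a b, R s * S s ≠ 0) ∧
        (∀ s ∈ Set.Ioo a b, deriv W s ^ 2 = -(2 * S s ^ 2 / R s ^ 2) *
            (deriv (deriv R) s / R s + deriv (deriv S) s / S s)) ∧
        (∀ x ∈ cyl V, G.metric x = pullback A.toMap (ppMetric ε R W S) x) ∧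
        ∃ N : Coord → Coord,
          ContDiffOn ℝ ∞ N (cyl V) ∧
          (∀ x ∈ cyl V, (jac A.toMap x).mulVec (N x) = Pi.single (Sum.inl 1) 1) ∧
          IsNullField G.metric N (cyl V) ∧
          IsKillingField G.metric N (cyl V) ∧
          IsParallelField G.metric N (cyl V) := by
  obtain ⟨V₁, hV₁U, hV₁, ht₁, ⟨N₁⟩⟩ := exists_nullFrame hU G hgt ht₀
  have hV₂ : IsOpen {t ∈ V₁ | 0 < ε * G.h t 0 0} :=
    (contDiffOn_const.mul ((G.h_smooth 0 0).mono hV₁U)).continuousOn.isOpen_inter_preimage hV₁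
      isOpen_Ioi
  -- The ball is convex, so closed 1-forms have primitives on it, and small enough for h₀₀ to keep
  -- its sign.
  obtain ⟨r, hr, hB⟩ := Metric.isOpen_iff.1 hV₂ t₀ ⟨ht₁, hpos⟩
  set B := Metric.ball t₀ r
  have hBo : IsOpen B := Metric.isOpen_ball
  have hBc : Convex ℝ B := convex_ball _ _
  have hBV₁ : B ⊆ V₁ := fun t ht => (hB ht).1
  have hBU : B ⊆ U := hBV₁.trans hV₁U
  have hflat := fun t ht => (N₁.restrict hBV₁).isFlatAt hBo (hvac.restrict hBU)
    (fun s hs => hH s (hBU hs)) (fun s hs => hC s (hBU hs)) (t := t) ht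
  obtain ⟨u, v, hu, hv, hvol, hguv⟩ := (N₁.restrict hBV₁).exists_flat_coords hBo hBc
    fun t ht => (hflat t ht).2.2
  have hf : ∀ t ∈ B, ∀ k, pd 0 (fun s => G.f s 1 k) t - pd 1 (fun s => G.f s 0 k) t = 0 :=
    fun t ht => (hflat t ht).2.1
  obtain ⟨ψ, hψ, hdψ⟩ := (G.restrict hBU).exists_potential hBo hBc hf
  obtain ⟨V, hVB, Θ, c, r', htV, C⟩ := (G.restrict hBU).exists_nullChart hBo hu hv hvol hguv
    (Metric.mem_ball_self hr)
  set K := (G.restrict hBU).restrict hVB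
  have hVU := hVB.trans hBU
  have hτ : ∀ t ∈ V, 0 < K.τ t := fun t ht => hH t (hVU ht)
  have hprod : ∀ y ∈ Metric.ball c r',
      pd 0 (fun y => K.τ (Θ y)) y * pd 1 (fun y => K.τ (Θ y)) y = 0 := fun y hy => by
    have hy' := C.mapsTo hy
    have h : K.Crho (Θ y) = 0 := hC _ (hVU hy')
    rw [C.frame.Crho_eq hy'] at h
    have hp := hτ _ hy'
    rw [C.pd_comp (smoothOn_τ K) hy, C.swap.pd_comp (smoothOn_τ K) hy, C.swap_frame_e₂]
    exact (mul_eq_zero.1 h).resolve_left (by positivity)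
  refine ⟨V, C.isOpen, htV, hVU, ?_⟩
  have hψ' := fun k => (hψ k).mono hVB
  have hdψ' := fun k t (ht : t ∈ V) => hdψ k t (hVB ht)
  have hf' := fun t (ht : t ∈ V) => hf t (hVB ht)
  have hpos' : ∀ t ∈ V, 0 < ε * K.h t 0 0 := fun t ht => (hB (hVB ht)).2
  -- One null derivative of τ vanishes on the entire square; if it is the one along u, the names of
  -- u and v are exchanged.
  rcases pd_eq_zero_of_mul ((smoothOn_τ K).comp C.smooth_Θ C.mapsTo) hprod with h | h
  · exact C.exists_ppMetric ((hvac.restrict hBU).restrict hVB) hψ' hdψ' hf' hε hpos' hτ h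
  · exact C.swap.exists_ppMetric ((hvac.restrict hBU).restrict hVB) hψ' hdψ' hf' hε hpos' hτ h

end Coeffs

end G2

end

/-! ### Assembly of the global and the local statements -/

theorem mainTheorem8 (U : Set G2.Orbit) (hU : IsOpen U) (hne : U.Nonempty)
    (G : G2.Coeffs U) (Λ : ℝ)
    (hvac : G2.IsLambdaVacuum G.metric Λ (G2.cyl U))
    (hC : ∀ t ∈ U, G.Crho t = 0)
    (hgt : ∀ t ∈ U, (G.gt t).det < 0)
    (hH : ∀ t ∈ U, 0 < (G.h t).det) :
    Λ = 0 ∧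
    (∀ t ∈ U, ∀ k, G.curv t k = 0) ∧
    (∀ t ∈ U, G.ellC t = 0) ∧
    G2.IsOrthogonallyTransitive G.metric (G2.cyl U) ∧
    ∀ t₀ ∈ U, ∃ V : Set G2.Orbit, IsOpen V ∧ t₀ ∈ V ∧ V ⊆ U ∧
      ∃ (A : G2.AdaptedChange V) (ε a b : ℝ) (R W S : ℝ → ℝ),
        ((ε = 1 ∧ (G.h t₀).PosDef) ∨ (ε = -1 ∧ (-(G.h t₀)).PosDef)) ∧
        (∀ t ∈ V, A.φ t 0 ∈ Set.Ioo a b) ∧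
        ContDiffOn ℝ ∞ R (Set.Ioo a b) ∧
        ContDiffOn ℝ ∞ W (Set.Ioo a b) ∧
        ContDiffOn ℝ ∞ S (Set.Ioo a b) ∧
        (∀ s ∈ Set.Ioo a b, R s * S s ≠ 0) ∧
        (∀ s ∈ Set.Ioo a b,
          deriv W s ^ 2 = -(2 * S s ^ 2 / R s ^ 2) *
            (deriv (deriv R) s / R s + deriv (deriv S) s / S s)) ∧
        (∀ x ∈ G2.cyl V, G.metric x = G2.pullback A.toMap (G2.ppMetric ε R W S) x) ∧
        -- `N` is the coordinate vector field `∂/∂t²` of the new adapted coordinates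
        ∃ N : G2.Coord → G2.Coord,
          ContDiffOn ℝ ∞ N (G2.cyl V) ∧
          (∀ x ∈ G2.cyl V,
            (G2.jac A.toMap x).mulVec (N x) = Pi.single (Sum.inl 1) 1) ∧
          G2.IsNullField G.metric N (G2.cyl V) ∧
          G2.IsKillingField G.metric N (G2.cyl V) ∧
          G2.IsParallelField G.metric N (G2.cyl V) := by
  have hflat := fun t ht => G.flat_of_Crho hU hvac hC hgt hH (t := t) ht
  have hcurv : ∀ t ∈ U, ∀ k, G.curv t k = 0 := fun t ht k => by
    rw [G2.Coeffs.curv, ← neg_sub, (hflat t ht).2 k, neg_zero, zero_div]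
  obtain ⟨t₁, ht₁⟩ := hne
  refine ⟨(hflat t₁ ht₁).1, hcurv, fun t ht => ?_,
    G.isOrthogonallyTransitive hU fun t ht => (hflat t ht).2, fun t₀ ht₀ => ?_⟩
  · exact Finset.sum_eq_zero fun k _ => Finset.sum_eq_zero fun l _ => by
      rw [hcurv t ht k, mul_zero, zero_mul]
  · obtain ⟨ε, hε, hpos, hdef⟩ := G.exists_sign ht₀ (hH t₀ ht₀)
    obtain ⟨V, hV, htV, hVU, A, a, b, R, W, S, h⟩ :=
      G.exists_local_ppMetric hU hvac hC hgt hH ht₀ hε hpos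
    exact ⟨V, hV, htV, hVU, A, ε, a, b, R, W, S, hdef, h⟩
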